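/- Let $d\ge 3$ and let $v:\mathbb R^d\to\mathbb R$ be bounded and Borel measurable with bounded support. For $z\in\mathbb R^d$ let $(W_z(s))_{s\ge0}$ be a $d$-dimensional Brownian motion with $W_z(0)=z$, and let $Y_z=\int_0^\infty v(W_z(s))\,ds$. For $t>0$ let $x(t),y(t)\in\mathbb R^d$, let $(X^t_s)_{0\le s\le t}$ be a $d$-dimensional Brownian bridge of duration $t$ from $X^t_0=x(t)$ to $X^t_t=y(t)$, and let $Z(t)=\int_0^t v(X^t_s)\,ds$. Suppose that $x(t)\to x\in\mathbb R^d$ and $y(t)\to y\in\mathbb R^d$ as $t\to\infty$. Let $Y'_y$ be a random variable independent of $Y_x$ with the same distribution as $Y_y$. (0) For every $z$ the integral defining $Y_z$ converges absolutely almost surely. (1) For every integer $k\ge0$ all of the following moments are finite, and $E[Z(t)^k]\to E[(Y_x+Y'_y)^k]$ as $t\to\infty$. (2) There is $\alpha_0>0$ such that $$E\exp\Big(\alpha\int_0^\infty|v(W_z(s))|\,ds\Big)<\infty\qquad\text{for all }|\alpha|<\alpha_0\text{ and all }z\in\mathbb R^d,$$ and for every $\alpha_0$ with this property and every $\alpha\in(-\alpha_0,\alpha_0)$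 the following expectations are finite and $$E e^{\alpha Z(t)}\to E e^{\alpha(Y_x+Y'_y)}=E e^{\alpha Y_x}\,E e^{\alpha Y_y}\qquad(t\to\infty).\tag{$*$}$$ (3) If $v\ge0$, let $\alpha_1=\sup\{\alpha\in\mathbb R: E e^{\alpha Y_z}<\infty\text{ for all }z\in\mathbb R^d\}\in[-\infty,\infty]$. Then $\alpha_1>0$, and for every real $\alpha<\alpha_1$ the expectations in $(*)$ are finite and $(*)$ holds. -/

import Mathlib

open MeasureTheory ProbabilityTheory Filter Topology
open scoped NNReal ENNReal

/-- The transition density `q(t; z) = (2πt)^(-d/2) exp (-|z|²/(2t))` of Brownian motion in `ℝᵈ`. -/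
noncomputable def heatKernel {d : ℕ} (t : ℝ) (z : EuclideanSpace ℝ (Fin d)) : ℝ :=
  (2 * Real.pi * t) ^ (-(d : ℝ) / 2) * Real.exp (-‖z‖ ^ 2 / (2 * t))

/-- `W` is a `d`-dimensional Brownian motion (Wiener process) started at `x`: it starts at `x`, has
independent increments, `W t - W s` has the density `q(t - s; ·)` for `s < t`, and its paths are
almost surely continuous. -/
structure IsBrownianMotionFrom {d : ℕ} {Ω : Type*} [MeasurableSpace Ω]
    (x : EuclideanSpace ℝ (Fin d)) (W : ℝ≥0 → Ω → EuclideanSpace ℝ (Fin d))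
    (P : Measure Ω) : Prop where
  start : ∀ᵐ ω ∂P, W 0 ω = x
  indep : HasIndepIncrements W P
  increments : ∀ s t : ℝ≥0, s < t →
    HasLaw (fun ω => W t ω - W s ω)
      (volume.withDensity fun z => ENNReal.ofReal (heatKernel ((t : ℝ) - s) z)) P
  cont : ∀ᵐ ω ∂P, Continuous fun s => W s ω

/-- The joint density at `(z₁, …, zₖ)` of the positions at the times `s₁ < ⋯ < sₖ` in `(0, t)` of
the Brownian bridge of duration `t` from `x` to `y`:
`∏_{j=0}^{k} q(s_{j+1} - s_j; z_{j+1} - z_j) / q(t; y - x)`,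
where `s₀ = 0`, `z₀ = x`, `s_{k+1} = t`, `z_{k+1} = y`. -/
noncomputable def bridgeDensity {d : ℕ} (t : ℝ) (x y : EuclideanSpace ℝ (Fin d)) {k : ℕ}
    (s : Fin k → ℝ) (z : Fin k → EuclideanSpace ℝ (Fin d)) : ℝ :=
  let S : Fin (k + 2) → ℝ := Fin.cons 0 (Fin.snoc s t : Fin (k + 1) → ℝ)
  let Z : Fin (k + 2) → EuclideanSpace ℝ (Fin d) :=
    Fin.cons x (Fin.snoc z y : Fin (k + 1) → EuclideanSpace ℝ (Fin d))
  (∏ j : Fin (k + 1), heatKernel (S j.succ - S j.castSucc) (Z j.succ - Z j.castSucc)) /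
    heatKernel t (y - x)

/-- `X`, restricted to the times in `[0, t]`, is a `d`-dimensional Brownian bridge of duration
`t > 0` from `x` to `y`: it has the endpoints `x` and `y`, its finite-dimensional distributions at
times in `(0, t)` have the densities `bridgeDensity`, and its paths are almost surely continuous. -/
structure IsBrownianBridge {d : ℕ} {Ω : Type*} [MeasurableSpace Ω]
    (t : ℝ) (x y : EuclideanSpace ℝ (Fin d)) (X : ℝ → Ω → EuclideanSpace ℝ (Fin d))
    (P : Measure Ω) : Prop where
  start : ∀ᵐ ω ∂P, X 0 ω = x
  finish : ∀ᵐ ω ∂P, X t ω = y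
  fdd : ∀ (k : ℕ) (s : Fin k → ℝ), StrictMono s → (∀ i, s i ∈ Set.Ioo 0 t) →
    HasLaw (fun ω i => X (s i) ω)
      (volume.withDensity fun z => ENNReal.ofReal (bridgeDensity t x y s z)) P
  cont : ∀ᵐ ω ∂P, ContinuousOn (fun s => X s ω) (Set.Icc 0 t)

/-- The path integral `∫₀ᵗ v(X_s) ds` of `v` along `X` up to the finite time `t`. -/
noncomputable def pathIntegral {d : ℕ} {Ω : Type*} (v : EuclideanSpace ℝ (Fin d) → ℝ)
    (X : ℝ → Ω → EuclideanSpace ℝ (Fin d)) (t : ℝ) (ω : Ω) : ℝ :=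
  ∫ s in (0 : ℝ)..t, v (X s ω)

/-- The whole-time path integral `∫₀^∞ v(W_s) ds` of `v` along `W`. -/
noncomputable def totalPathIntegral {d : ℕ} {Ω : Type*} (v : EuclideanSpace ℝ (Fin d) → ℝ)
    (W : ℝ≥0 → Ω → EuclideanSpace ℝ (Fin d)) (ω : Ω) : ℝ :=
  ∫ s in Set.Ioi (0 : ℝ), v (W s.toNNReal ω)

/-- `α₀` is such that `E exp (α ∫₀^∞ |v(W_z(s))| ds) < ∞` for all `|α| < α₀` and all `z`. -/
def HasExpMomentsBelow {d : ℕ} {Ω : Type*} [MeasurableSpace Ω] (P : Measure Ω)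
    (v : EuclideanSpace ℝ (Fin d) → ℝ)
    (W : EuclideanSpace ℝ (Fin d) → ℝ≥0 → Ω → EuclideanSpace ℝ (Fin d)) (α₀ : ℝ) : Prop :=
  ∀ α : ℝ, |α| < α₀ → ∀ z,
    Integrable (fun ω => Real.exp (α * totalPathIntegral (fun u => |v u|) (W z) ω)) P

/-- The critical exponent `α₁ = sup {α : E exp (α ∫₀^∞ v(W_z(s)) ds) < ∞ for all z}`, an extended
real number. -/
noncomputable def criticalExponent {d : ℕ} {Ω : Type*} [MeasurableSpace Ω] (P : Measure Ω)
    (v : EuclideanSpace ℝ (Fin d) → ℝ)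
    (W : EuclideanSpace ℝ (Fin d) → ℝ≥0 → Ω → EuclideanSpace ℝ (Fin d)) : EReal :=
  sSup {a : EReal | ∃ α : ℝ, a = (α : EReal) ∧
    ∀ z, Integrable (fun ω => Real.exp (α * totalPathIntegral v (W z) ω)) P}

/-! The moments of an occupation integral can be computed exactly. For `f ≥ 0`, expanding the `k`-th
power over ordered times and using the Gaussian increments gives `k! Gᵏ1(x)` for Brownian motion
from `x`, where `G g(x) = ∫₀^∞ ∫ q(s; w - x) f(w) g(w) dw ds` (`greenOp`,
`IsBrownianMotionFrom.lintegral_pow_eq`). For `d ≥ 3` the peak `(2πs)^(-d/2)` of the heat kernel is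
integrable at infinity, so `G` is a bounded operator on bounded functions. All moments are finite,
and their growth like `k! Mᵏ` gives exponential moments near `0`.

For the bridge the same expansion gives `k!` times an integral over the simplex of a product of `k +
1` heat kernels, divided by `q(t; y - x)` (`IsBrownianBridge.lintegral_pow_eq`). For large `t` only
configurations with exactly one long gap matter. The kernel of that gap is nearly the peak at time
`t`, which cancels the denominator. The `j` points before it form a path from `x`, and the `k - j`
points after it, read backwards, form a path from `y`. The limit is `k! ∑ Gʲ1(x) Gᵏ⁻ʲ1(y)`
(`greenConv`, `IsPotential.eventually_bridgeIter_approx`), which by the binomial theorem is the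
`k`-th moment of the sum of two independent total occupations (`moment_pairSum`). A signed `v`
reduces to nonnegative functions: `(a - b)ᵏ` is a fixed linear combination of the powers `(a + i
b)ᵏ`, so the potentials `v⁺ + i v⁻` suffice (`exists_sub_pow_eq_sum`).

Exponential moments follow by summing the exponential series termwise, which needs moment bounds
uniform in `t`. By pigeonhole one of the `k + 1` gaps has length at least `t / (k + 1)`, so the
normalized kernels are at most a power of `k + 1` times `greenConv` (`bridgeIter_le`). The
polynomial factor costs nothing in the radius of convergence. A Harnack estimate carries geometric
bounds on `Gʲ1` from one point to bounded sets (`IsPotential.exists_pow_mul_greenIter_le`).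

For `v ≥ 0` and negative exponents the series at `0` may have too small a radius. However, `E Zᵏ
e^(-βZ) ≤ k!/βᵏ` holds for every `Z ≥ 0`, so the series recentred at `-β` has radius at least `β`,
and convergence propagates along the negative half-line (`tendsto_integral_exp_of_nonneg`). -/

/-! ### Pointwise and integral estimates for the heat kernel. -/

section HeatKernel

variable {d : ℕ}

/-- The heat kernel as an extended nonnegative density. -/
noncomputable def heatDensity (t : ℝ) (z : EuclideanSpace ℝ (Fin d)) : ℝ≥0∞ :=
  ENNReal.ofReal (heatKernel t z)

/-- The maximum `(2πt)^(-d/2)` of the heat kernel at time `t`. -/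
noncomputable def heatPeak (d : ℕ) (t : ℝ) : ℝ≥0∞ :=
  ENNReal.ofReal ((2 * Real.pi * t) ^ (-(d : ℝ) / 2))

lemma measurable_heatKernel :
    Measurable fun p : ℝ × EuclideanSpace ℝ (Fin d) => heatKernel p.1 p.2 := by
  unfold heatKernel
  fun_prop

@[fun_prop]
lemma Measurable.heatDensity {α : Type*} [MeasurableSpace α] {g : α → ℝ}
    {h : α → EuclideanSpace ℝ (Fin d)} (hg : Measurable g) (hh : Measurable h) :
    Measurable fun a => heatDensity (g a) (h a) :=
  (measurable_heatKernel.comp (hg.prodMk hh)).ennreal_ofReal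

@[fun_prop]
lemma measurable_heatPeak : Measurable (heatPeak d) := by
  unfold heatPeak
  fun_prop

lemma heatDensity_sub_comm (t : ℝ) (x y : EuclideanSpace ℝ (Fin d)) :
    heatDensity t (x - y) = heatDensity t (y - x) := by
  simp [heatDensity, heatKernel, norm_sub_rev]

lemma heatDensity_eq {t : ℝ} (ht : 0 < t) (z : EuclideanSpace ℝ (Fin d)) :
    heatDensity t z = heatPeak d t * ENNReal.ofReal (Real.exp (-‖z‖ ^ 2 / (2 * t))) := by
  unfold heatDensity heatPeak heatKernel
  rw [ENNReal.ofReal_mul]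
  positivity

lemma heatDensity_le {t : ℝ} (ht : 0 < t) (z : EuclideanSpace ℝ (Fin d)) :
    heatDensity t z ≤ heatPeak d t := by
  rw [heatDensity_eq ht]
  refine mul_le_of_le_one_right' ?_
  rw [ENNReal.ofReal_le_one, Real.exp_le_one_iff]
  exact div_nonpos_of_nonpos_of_nonneg (by simp) (by positivity)

lemma heatDensity_ne_zero {t : ℝ} (ht : 0 < t) (z : EuclideanSpace ℝ (Fin d)) :
    heatDensity t z ≠ 0 := by
  have : 0 < heatKernel t z := by unfold heatKernel; positivity
  simpa [heatDensity] using this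

lemma heatPeak_ne_top (t : ℝ) : heatPeak d t ≠ ∞ := ENNReal.ofReal_ne_top

lemma heatPeak_ne_zero {t : ℝ} (ht : 0 < t) : heatPeak d t ≠ 0 := by
  have : 0 < (2 * Real.pi * t) ^ (-(d : ℝ) / 2) := by positivity
  simpa [heatPeak] using this

lemma heatPeak_antitone {s t : ℝ} (hs : 0 < s) (hst : s ≤ t) : heatPeak d t ≤ heatPeak d s := by
  refine ENNReal.ofReal_le_ofReal (Real.rpow_le_rpow_of_nonpos (by positivity) (by gcongr) ?_)
  exact div_nonpos_of_nonpos_of_nonneg (by simp) (by norm_num)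

lemma heatPeak_mul {c t : ℝ} (hc : 0 < c) (ht : 0 < t) :
    heatPeak d (c * t) = ENNReal.ofReal (c ^ (-(d : ℝ) / 2)) * heatPeak d t := by
  unfold heatPeak
  rw [← ENNReal.ofReal_mul (by positivity), ← Real.mul_rpow (by positivity) (by positivity)]
  ring_nf

lemma lintegral_heatDensity {t : ℝ} (ht : 0 < t) :
    ∫⁻ z : EuclideanSpace ℝ (Fin d), heatDensity t z = 1 := by
  have h := GaussianFourier.integral_rexp_neg_mul_sq_norm (V := EuclideanSpace ℝ (Fin d))
    (b := 1 / (2 * t)) (by positivity)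
  have h2 : (fun v : EuclideanSpace ℝ (Fin d) => Real.exp (-‖v‖ ^ 2 / (2 * t))) =
      fun v => Real.exp (-(1 / (2 * t)) * ‖v‖ ^ 2) := by
    ext v; ring_nf
  have hint : Integrable fun v : EuclideanSpace ℝ (Fin d) =>
      Real.exp (-(1 / (2 * t)) * ‖v‖ ^ 2) := by
    -- The integral of a nonintegrable function is `0` by convention, so the positive value of the
    -- Gaussian integral already forces integrability.
    by_contra hn
    rw [integral_undef hn] at h
    have : 0 < (Real.pi / (1 / (2 * t))) ^
      ((Module.finrank ℝ (EuclideanSpace ℝ (Fin d)) : ℝ) / 2) := by positivity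
    exact this.ne h
  have hk : ∀ z : EuclideanSpace ℝ (Fin d), heatDensity t z =
      heatPeak d t * ENNReal.ofReal (Real.exp (-(1 / (2 * t)) * ‖z‖ ^ 2)) := fun z => by
    rw [heatDensity_eq ht]
    exact congrArg _ (congrArg _ (congrFun h2 z))
  simp_rw [hk]
  rw [lintegral_const_mul _ (by fun_prop),
    ← ofReal_integral_eq_lintegral_ofReal hint (ae_of_all _ fun _ => (Real.exp_pos _).le), h,
    heatPeak, ← ENNReal.ofReal_mul (by positivity), finrank_euclideanSpace, Fintype.card_fin,
    show Real.pi / (1 / (2 * t)) = 2 * Real.pi * t by field_simp,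
    ← Real.rpow_add (by positivity)]
  rw [show -(d : ℝ) / 2 + d / 2 = 0 by ring]
  simp

lemma lintegral_heatDensity_sub {t : ℝ} (ht : 0 < t) (x : EuclideanSpace ℝ (Fin d)) :
    ∫⁻ z, heatDensity t (z - x) = 1 := by
  rw [lintegral_sub_right_eq_self (fun z => heatDensity t z) x]
  exact lintegral_heatDensity ht

/-- This is `1 ≤ e⁻ᵘ + u` with `u = ‖z‖² / (2t)`. The error stands on the right because subtraction
in `ℝ≥0∞` is truncated. -/
lemma heatPeak_le_heatDensity_add {t : ℝ} (ht : 0 < t) {r : ℝ} {z : EuclideanSpace ℝ (Fin d)}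
    (hz : ‖z‖ ≤ r) :
    heatPeak d t ≤ heatDensity t z + heatPeak d t * ENNReal.ofReal (r ^ 2 / (2 * t)) := by
  rw [heatDensity_eq ht, ← mul_add, ← ENNReal.ofReal_add (by positivity) (by positivity)]
  refine le_mul_of_one_le_right' ?_
  rw [ENNReal.one_le_ofReal]
  have h1 := Real.add_one_le_exp (-‖z‖ ^ 2 / (2 * t))
  have h2 : ‖z‖ ^ 2 / (2 * t) ≤ r ^ 2 / (2 * t) := by gcongr
  rw [neg_div] at *
  linarith

/-- A parabolic Harnack inequality: waiting a further time `δ` pays for moving the centre by `r`.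
The factor `2^(d/2)` comes from `s + δ ≤ 2 s`. -/
lemma heatDensity_le_heatDensity_add {s δ r : ℝ} (hδ : 0 < δ) (hs : δ ≤ s)
    {x y w : EuclideanSpace ℝ (Fin d)} (hxy : ‖x - y‖ ≤ r) :
    heatDensity s (w - x) ≤ ENNReal.ofReal (2 ^ ((d : ℝ) / 2) * Real.exp (r ^ 2 / (2 * δ))) *
      heatDensity (s + δ) (w - y) := by
  have hs0 : 0 < s := hδ.trans_le hs
  have hr : 0 ≤ r := (norm_nonneg _).trans hxy
  unfold heatDensity
  rw [← ENNReal.ofReal_mul (by positivity)]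
  refine ENNReal.ofReal_le_ofReal ?_
  unfold heatKernel
  have h1 : (2 * Real.pi * s) ^ (-(d : ℝ) / 2) ≤
      2 ^ ((d : ℝ) / 2) * (2 * Real.pi * (s + δ)) ^ (-(d : ℝ) / 2) := by
    have h2 : (2 * Real.pi * s) ^ (-(d : ℝ) / 2) =
        2 ^ ((d : ℝ) / 2) * (2 * (2 * Real.pi * s)) ^ (-(d : ℝ) / 2) := by
      rw [Real.mul_rpow (by norm_num : (0 : ℝ) ≤ 2) (by positivity : 0 ≤ 2 * Real.pi * s),
        ← mul_assoc, ← Real.rpow_add two_pos, show (d : ℝ) / 2 + -(d : ℝ) / 2 = 0 by ring]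
      simp
    rw [h2]
    refine mul_le_mul_of_nonneg_left ?_ (by positivity)
    refine Real.rpow_le_rpow_of_nonpos (by positivity) ?_
      (div_nonpos_of_nonpos_of_nonneg (by simp) (by norm_num))
    nlinarith [Real.pi_pos]
  have h3 : Real.exp (-‖w - x‖ ^ 2 / (2 * s)) ≤
      Real.exp (r ^ 2 / (2 * δ)) * Real.exp (-‖w - y‖ ^ 2 / (2 * (s + δ))) := by
    rw [← Real.exp_add, Real.exp_le_exp]
    have h4 : ‖w - y‖ ≤ ‖w - x‖ + r := by
      have := norm_add_le (w - x) (x - y)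
      rw [sub_add_sub_cancel] at this
      linarith
    have h5 : ‖w - y‖ ^ 2 ≤ (‖w - x‖ + r) ^ 2 := by gcongr
    -- Cauchy–Schwarz in the form `(a + b)² / (p + q) ≤ a² / p + b² / q`; the defect is the square
    -- of `a q - b p`.
    have h6 : (‖w - x‖ + r) ^ 2 / (2 * (s + δ)) ≤ ‖w - x‖ ^ 2 / (2 * s) + r ^ 2 / (2 * δ) := by
      rw [div_add_div _ _ (by positivity) (by positivity), div_le_div_iff₀ (by positivity)
        (by positivity)]
      nlinarith [sq_nonneg (‖w - x‖ * δ - r * s)]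
    have h7 : ‖w - y‖ ^ 2 / (2 * (s + δ)) ≤ (‖w - x‖ + r) ^ 2 / (2 * (s + δ)) := by gcongr
    rw [neg_div, neg_div]
    linarith
  calc _ ≤ (2 ^ ((d : ℝ) / 2) * (2 * Real.pi * (s + δ)) ^ (-(d : ℝ) / 2)) *
        (Real.exp (r ^ 2 / (2 * δ)) * Real.exp (-‖w - y‖ ^ 2 / (2 * (s + δ)))) :=
        mul_le_mul h1 h3 (Real.exp_pos _).le (by positivity)
    _ = _ := by ring

/-- Transience: the exponent `-d/2` is below `-1`. Every later use of the dimension goes back to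
this bound. -/
lemma heatPeak_lintegral_Ioi_lt_top (hd : 3 ≤ d) : ∫⁻ s in Set.Ioi (1 : ℝ), heatPeak d s < ∞ := by
  have h1 : IntegrableOn (fun s : ℝ => (2 * Real.pi) ^ (-(d : ℝ) / 2) * s ^ (-(d : ℝ) / 2))
      (Set.Ioi 1) := by
    refine (integrableOn_Ioi_rpow_of_lt ?_ one_pos).const_mul _
    have : (3 : ℝ) ≤ d := by exact_mod_cast hd
    linarith
  refine lt_of_eq_of_lt ?_ h1.lintegral_lt_top
  refine setLIntegral_congr_fun measurableSet_Ioi fun s hs => ?_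
  unfold heatPeak
  rw [Real.mul_rpow (by positivity) (zero_le_one.trans (le_of_lt hs))]

lemma tendsto_lintegral_Ici_heatPeak (hd : 3 ≤ d) :
    Tendsto (fun S : ℝ => ∫⁻ s in Set.Ici S, heatPeak d s) atTop (𝓝 0) := by
  have h : Tendsto (fun S : ℝ => ∫⁻ s, (Set.Ici S).indicator (heatPeak d) s) atTop
      (𝓝 (∫⁻ _ : ℝ, 0)) := by
    refine tendsto_lintegral_filter_of_dominated_convergence
      ((Set.Ioi 1).indicator (heatPeak d)) ?_ ?_ ?_ ?_
    · exact Eventually.of_forall fun S => measurable_heatPeak.indicator measurableSet_Ici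
    · filter_upwards [eventually_gt_atTop 1] with S hS
      exact ae_of_all _ fun s => Set.indicator_le_indicator_of_subset
        (fun u hu => lt_of_lt_of_le hS hu) (fun _ => zero_le) s
    · rw [lintegral_indicator measurableSet_Ioi]
      exact (heatPeak_lintegral_Ioi_lt_top hd).ne
    · refine ae_of_all _ fun s => tendsto_const_nhds.congr' ?_
      filter_upwards [eventually_gt_atTop s] with S hS
      simp [hS]
  simpa [lintegral_indicator measurableSet_Ici] using h

end HeatKernel

/-! ### The Green operator: boundedness, continuity and a Harnack estimate. -/

section Green

variable {d : ℕ}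

/-- `f` is measurable, bounded by `K`, and vanishes outside the closed ball of radius `R`. -/
structure IsPotential (f : EuclideanSpace ℝ (Fin d) → ℝ≥0∞) (K : ℝ≥0) (R : ℝ) : Prop where
  meas : Measurable f
  le : ∀ z, f z ≤ K
  supp : ∀ z, f z ≠ 0 → ‖z‖ ≤ R

/-- The integral of `f * g` against the heat kernel centred at `x`. -/
noncomputable def heatOp (f g : EuclideanSpace ℝ (Fin d) → ℝ≥0∞) (s : ℝ)
    (x : EuclideanSpace ℝ (Fin d)) : ℝ≥0∞ :=
  ∫⁻ w, heatDensity s (w - x) * (f w * g w)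

/-- The Green operator of Brownian motion applied to `f * g`. -/
noncomputable def greenOp (f g : EuclideanSpace ℝ (Fin d) → ℝ≥0∞)
    (x : EuclideanSpace ℝ (Fin d)) : ℝ≥0∞ :=
  ∫⁻ s in Set.Ioi (0 : ℝ), heatOp f g s x

/-- The iterates of `greenOp f`, starting from the constant function `1`. -/
noncomputable def greenIter (f : EuclideanSpace ℝ (Fin d) → ℝ≥0∞) :
    ℕ → EuclideanSpace ℝ (Fin d) → ℝ≥0∞
  | 0 => fun _ => 1
  | k + 1 => greenOp f (greenIter f k)

variable {f g : EuclideanSpace ℝ (Fin d) → ℝ≥0∞} {K : ℝ≥0} {R : ℝ}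

lemma measurable_heatOp (hf : Measurable f) (hg : Measurable g) :
    Measurable fun p : ℝ × EuclideanSpace ℝ (Fin d) => heatOp f g p.1 p.2 := by
  unfold heatOp
  refine Measurable.lintegral_prod_right'
    (f := fun q : (ℝ × EuclideanSpace ℝ (Fin d)) × EuclideanSpace ℝ (Fin d) =>
      heatDensity q.1.1 (q.2 - q.1.2) * (f q.2 * g q.2)) ?_
  fun_prop

lemma measurable_greenOp (hf : Measurable f) (hg : Measurable g) : Measurable (greenOp f g) :=
  Measurable.lintegral_prod_left (μ := volume.restrict (Set.Ioi (0 : ℝ)))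
    (f := heatOp f g) (measurable_heatOp hf hg)

lemma measurable_greenIter (hf : Measurable f) : ∀ k, Measurable (greenIter f k)
  | 0 => measurable_const
  | k + 1 => measurable_greenOp hf (measurable_greenIter hf k)

lemma heatOp_mono {h : EuclideanSpace ℝ (Fin d) → ℝ≥0∞} (hgh : ∀ w, f w ≠ 0 → g w ≤ h w)
    (s : ℝ) (x : EuclideanSpace ℝ (Fin d)) : heatOp f g s x ≤ heatOp f h s x := by
  refine lintegral_mono fun w => mul_le_mul_right ?_ _
  by_cases hw : f w = 0
  · simp [hw]
  · exact mul_le_mul_right (hgh w hw) _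

lemma heatOp_const (hf : Measurable f) (c : ℝ≥0∞) (s : ℝ) (x : EuclideanSpace ℝ (Fin d)) :
    heatOp f (fun _ => c) s x = c * heatOp f (fun _ => 1) s x := by
  unfold heatOp
  rw [← lintegral_const_mul _ (by fun_prop)]
  refine lintegral_congr fun w => ?_
  ring

lemma heatOp_add (hf : Measurable f) (hg : Measurable g) (h : EuclideanSpace ℝ (Fin d) → ℝ≥0∞)
    (s : ℝ) (x : EuclideanSpace ℝ (Fin d)) :
    heatOp f (fun w => g w + h w) s x = heatOp f g s x + heatOp f h s x := by
  unfold heatOp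
  rw [← lintegral_add_left (by fun_prop)]
  refine lintegral_congr fun w => ?_
  ring

lemma greenOp_sum_mul (hf : Measurable f) {a : ℕ → EuclideanSpace ℝ (Fin d) → ℝ≥0∞}
    (ha : ∀ j, Measurable (a j)) (c : ℕ → ℝ≥0∞) (n : ℕ) (x : EuclideanSpace ℝ (Fin d)) :
    greenOp f (fun w => ∑ j ∈ Finset.range n, a j w * c j) x =
      ∑ j ∈ Finset.range n, greenOp f (a j) x * c j := by
  have h1 : ∀ s, heatOp f (fun w => ∑ j ∈ Finset.range n, a j w * c j) s x =
      ∑ j ∈ Finset.range n, heatOp f (a j) s x * c j := fun s => by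
    unfold heatOp
    simp_rw [Finset.mul_sum]
    rw [lintegral_finsetSum _ fun j _ => by have := ha j; fun_prop]
    refine Finset.sum_congr rfl fun j _ => ?_
    have := ha j
    rw [← lintegral_mul_const _ (by fun_prop)]
    refine lintegral_congr fun w => ?_
    ring
  unfold greenOp
  simp_rw [h1]
  have h2 : ∀ j, Measurable fun s => heatOp f (a j) s x := fun j =>
    (measurable_heatOp hf (ha j)).comp measurable_prodMk_right
  rw [lintegral_finsetSum _ fun j _ => (h2 j).mul_const _]
  exact Finset.sum_congr rfl fun j _ => lintegral_mul_const _ (h2 j)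

lemma heatOp_le_heatPeak {s : ℝ} (hs : 0 < s) (x : EuclideanSpace ℝ (Fin d)) :
    heatOp f g s x ≤ heatPeak d s * ∫⁻ w, f w * g w := by
  unfold heatOp
  rw [← lintegral_const_mul' _ _ (heatPeak_ne_top s)]
  exact lintegral_mono fun w => mul_le_mul_left (heatDensity_le hs _) _

namespace IsPotential

lemma lintegral_lt_top (hf : IsPotential f K R) : ∫⁻ w, f w < ∞ := by
  calc ∫⁻ w, f w ≤ ∫⁻ w, (Metric.closedBall (0 : EuclideanSpace ℝ (Fin d)) R).indicator
          (fun _ => (K : ℝ≥0∞)) w := by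
        refine lintegral_mono fun w => ?_
        by_cases hw : f w = 0
        · simp [hw]
        · rw [Set.indicator_of_mem (by simpa using hf.supp w hw)]
          exact hf.le w
    _ = K * volume (Metric.closedBall (0 : EuclideanSpace ℝ (Fin d)) R) := by
        rw [lintegral_indicator Metric.isClosed_closedBall.measurableSet, setLIntegral_const]
    _ < ∞ := ENNReal.mul_lt_top (by simp) measure_closedBall_lt_top

variable (hf : IsPotential f K R)
include hf

lemma heatOp_le_sup {s : ℝ} (hs : 0 < s) {c : ℝ≥0∞} (hg : ∀ w, f w ≠ 0 → g w ≤ c)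
    (x : EuclideanSpace ℝ (Fin d)) : heatOp f g s x ≤ K * c := by
  calc heatOp f g s x ≤ ∫⁻ w, heatDensity s (w - x) * (K * c) := by
        refine lintegral_mono fun w => mul_le_mul_right ?_ _
        by_cases hw : f w = 0
        · simp [hw]
        · exact mul_le_mul' (hf.le w) (hg w hw)
    _ = K * c := by
        rw [lintegral_mul_const _ (by fun_prop), lintegral_heatDensity_sub hs, one_mul]

/-- Two bounds with different purposes: total mass one controls short times, where the peak is not
integrable, and the decay of the peak controls long times. -/
lemma heatOp_one_le {s : ℝ} (hs : 0 < s) (x : EuclideanSpace ℝ (Fin d)) :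
    heatOp f (fun _ => 1) s x ≤ min (K : ℝ≥0∞) (heatPeak d s * ∫⁻ w, f w) := by
  refine le_min ?_ ?_
  · simpa using hf.heatOp_le_sup hs (g := fun _ => 1) (c := 1) (fun _ _ => le_rfl) x
  · simpa using _root_.heatOp_le_heatPeak (f := f) hs (g := fun _ => 1) x

lemma heatOp_le_mul {c : ℝ≥0∞} (hg : ∀ w, f w ≠ 0 → g w ≤ c) (s : ℝ)
    (x : EuclideanSpace ℝ (Fin d)) : heatOp f g s x ≤ c * heatOp f (fun _ => 1) s x :=
  (heatOp_mono hg s x).trans (heatOp_const hf.meas c s x).le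

lemma lintegral_min_lt_top (hd : 3 ≤ d) :
    ∫⁻ s in Set.Ioi (0 : ℝ), min (K : ℝ≥0∞) (heatPeak d s * ∫⁻ w, f w) < ∞ := by
  rw [← Set.Ioc_union_Ioi_eq_Ioi zero_le_one]
  refine (lintegral_union_le _ _ _).trans_lt (ENNReal.add_lt_top.2 ⟨?_, ?_⟩)
  · refine (lintegral_mono fun s => min_le_left _ _).trans_lt ?_
    simp
  · refine (lintegral_mono fun s => min_le_right _ _).trans_lt ?_
    rw [lintegral_mul_const _ measurable_heatPeak]
    exact ENNReal.mul_lt_top (heatPeak_lintegral_Ioi_lt_top hd) hf.lintegral_lt_top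

lemma greenOp_le {c : ℝ≥0∞} (hg : ∀ w, f w ≠ 0 → g w ≤ c) (x : EuclideanSpace ℝ (Fin d)) :
    greenOp f g x ≤
      c * ∫⁻ s in Set.Ioi (0 : ℝ), min (K : ℝ≥0∞) (heatPeak d s * ∫⁻ w, f w) := by
  unfold greenOp
  rw [← lintegral_const_mul _ (by fun_prop)]
  refine setLIntegral_mono' measurableSet_Ioi fun s hs => (hf.heatOp_le_mul hg s x).trans ?_
  exact mul_le_mul_right (hf.heatOp_one_le hs x) _

lemma exists_greenIter_le (hd : 3 ≤ d) : ∃ M : ℝ≥0, 1 ≤ M ∧ (∀ k x, greenIter f k x ≤ M ^ k) ∧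
    ∀ (g : EuclideanSpace ℝ (Fin d) → ℝ≥0∞) (c : ℝ≥0∞), (∀ w, f w ≠ 0 → g w ≤ c) →
      ∀ x, greenOp f g x ≤ c * M := by
  obtain ⟨M, hM⟩ : ∃ M : ℝ≥0, (M : ℝ≥0∞) = _ := ⟨_, ENNReal.coe_toNNReal (hf.lintegral_min_lt_top hd).ne⟩
  have h : ∀ (g : EuclideanSpace ℝ (Fin d) → ℝ≥0∞) (c : ℝ≥0∞), (∀ w, f w ≠ 0 → g w ≤ c) →
      ∀ x, greenOp f g x ≤ c * (max 1 M : ℝ≥0) := fun g c hg x => by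
    refine (hf.greenOp_le hg x).trans (mul_le_mul_right ?_ _)
    rw [← hM]
    exact_mod_cast le_max_right 1 M
  -- The maximum with `1` makes the constant positive, so that later choices may divide by it.
  refine ⟨max 1 M, le_max_left _ _, fun k => ?_, h⟩
  induction k with
  | zero => simp [greenIter]
  | succ k ih =>
    intro x
    rw [pow_succ]
    exact h _ _ (fun w _ => ih w) x

/-- Dominated convergence in time and, inside, in space. Bounding the heat kernel by its peak gives
dominating functions that do not depend on the point. -/
lemma continuous_greenOp (hd : 3 ≤ d) (hg : Measurable g) {c : ℝ≥0} (hgc : ∀ w, g w ≤ c) :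
    Continuous (greenOp f g) := by
  refine continuous_iff_continuousAt.2 fun x => ?_
  unfold greenOp
  refine tendsto_lintegral_filter_of_dominated_convergence
    (fun s => c * min (K : ℝ≥0∞) (heatPeak d s * ∫⁻ w, f w)) ?_ ?_ ?_ ?_
  · exact Eventually.of_forall fun y =>
      (measurable_heatOp hf.meas hg).comp measurable_prodMk_right
  · refine Eventually.of_forall fun y => (ae_restrict_iff' measurableSet_Ioi).2 (ae_of_all _ ?_)
    exact fun s hs => (hf.heatOp_le_mul (fun w _ => hgc w) s y).trans
      (mul_le_mul_right (hf.heatOp_one_le hs y) _)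
  · rw [lintegral_const_mul _ (by fun_prop)]
    exact (ENNReal.mul_lt_top (by simp) (hf.lintegral_min_lt_top hd)).ne
  · refine (ae_restrict_iff' measurableSet_Ioi).2 (ae_of_all _ fun s hs => ?_)
    have hs0 : 0 < s := hs
    have hm := hf.meas
    refine tendsto_lintegral_filter_of_dominated_convergence
      (fun w => heatPeak d s * (f w * c)) ?_ ?_ ?_ ?_
    · exact Eventually.of_forall fun y => by fun_prop
    · refine Eventually.of_forall fun y => ae_of_all _ fun w => ?_
      exact mul_le_mul' (heatDensity_le hs0 _) (mul_le_mul_right (hgc w) _)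
    · rw [lintegral_const_mul' _ _ (heatPeak_ne_top s), lintegral_mul_const _ hm]
      exact (ENNReal.mul_lt_top (heatPeak_ne_top s).lt_top
        (ENNReal.mul_lt_top hf.lintegral_lt_top (by simp))).ne
    · refine ae_of_all _ fun w => ?_
      refine ENNReal.Tendsto.mul_const ?_ (Or.inr ?_)
      · have : Continuous fun y : EuclideanSpace ℝ (Fin d) => heatDensity s (w - y) := by
          unfold heatDensity heatKernel
          refine ENNReal.continuous_ofReal.comp ?_
          fun_prop
        exact this.tendsto x
      · exact ((mul_le_mul' (hf.le w) (hgc w)).trans_lt (by finiteness)).ne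

lemma continuous_greenIter (hd : 3 ≤ d) : ∀ k, Continuous (greenIter f k)
  | 0 => continuous_const
  | k + 1 => by
    obtain ⟨M, -, hM, -⟩ := hf.exists_greenIter_le hd
    exact hf.continuous_greenOp hd (measurable_greenIter hf.meas k) (c := M ^ k)
      (fun w => by simpa using hM k w)

/-- Times before `δ` contribute at most `δ K c` because the heat kernel has mass one; at times after
`δ` the kernel at `x` is dominated by the kernel at `y` a time `δ` later. The first term is small
with `δ`, so it can be absorbed in an induction. -/
lemma greenOp_le_add {δ r : ℝ} (hδ : 0 < δ) {c : ℝ≥0∞}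
    (hgc : ∀ w, f w ≠ 0 → g w ≤ c) {x y : EuclideanSpace ℝ (Fin d)} (hxy : ‖x - y‖ ≤ r) :
    greenOp f g x ≤ ENNReal.ofReal δ * (K * c) +
      ENNReal.ofReal (2 ^ ((d : ℝ) / 2) * Real.exp (r ^ 2 / (2 * δ))) * greenOp f g y := by
  have hm := hf.meas
  unfold greenOp
  rw [← Set.Ioc_union_Ioi_eq_Ioi hδ.le]
  refine (lintegral_union_le _ _ _).trans (add_le_add ?_ ?_)
  · calc _ ≤ ∫⁻ s in Set.Ioc 0 δ, K * c :=
          setLIntegral_mono' measurableSet_Ioc fun s hs => hf.heatOp_le_sup hs.1 hgc x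
      _ = _ := by simp [mul_comm]
  · rw [Set.Ioc_union_Ioi_eq_Ioi hδ.le]
    calc _ ≤ ∫⁻ s in Set.Ioi δ, ENNReal.ofReal (2 ^ ((d : ℝ) / 2) * Real.exp (r ^ 2 / (2 * δ))) *
            heatOp f g (s + δ) y := by
          refine setLIntegral_mono' measurableSet_Ioi fun s hs => ?_
          unfold heatOp
          rw [← lintegral_const_mul' _ _ ENNReal.ofReal_ne_top]
          refine lintegral_mono fun w => ?_
          rw [← mul_assoc (ENNReal.ofReal _)]
          exact mul_le_mul_left (heatDensity_le_heatDensity_add hδ (le_of_lt hs) hxy) _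
      _ = ENNReal.ofReal (2 ^ ((d : ℝ) / 2) * Real.exp (r ^ 2 / (2 * δ))) *
            ∫⁻ s in Set.Ioi δ, heatOp f g (s + δ) y :=
          lintegral_const_mul' _ _ ENNReal.ofReal_ne_top
      _ ≤ _ := by
          refine mul_le_mul_right ?_ _
          rw [← lintegral_indicator measurableSet_Ioi, ← lintegral_indicator measurableSet_Ioi,
            ← lintegral_add_right_eq_self ((Set.Ioi 0).indicator fun s => heatOp f g s y) δ]
          refine lintegral_mono fun s => ?_
          by_cases hs : s ∈ Set.Ioi δ
          · rw [Set.indicator_of_mem hs, Set.indicator_of_mem]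
            exact add_pos (hδ.trans hs) hδ
          · simp [Set.indicator_of_notMem hs]

/-- A Harnack-type estimate: geometric bounds on the iterates at one point hold locally
uniformly. -/
lemma exists_pow_mul_greenIter_le {ρ : ℝ≥0} {C : ℝ≥0} {x₀ : EuclideanSpace ℝ (Fin d)}
    (h : ∀ j, (ρ : ℝ≥0∞) ^ j * greenIter f j x₀ ≤ C) {R' : ℝ} (hR : R ≤ R') :
    ∃ C' : ℝ≥0, ∀ x, ‖x‖ ≤ R' → ∀ j, (ρ : ℝ≥0∞) ^ j * greenIter f j x ≤ C' := by
  -- With this `δ` the short-time term is at most half of the constant being propagated.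
  obtain ⟨δ, hδ, hδ'⟩ : ∃ δ : ℝ, 0 < δ ∧ δ * (K * ρ) ≤ 1 / 2 := by
    refine ⟨1 / (2 * (K * ρ + 1)), by positivity, ?_⟩
    rw [div_mul_eq_mul_div, div_le_div_iff₀ (by positivity) (by norm_num)]
    linarith
  -- The Harnack factor for displacements up to `R' + ‖x₀‖`.
  set D : ℝ≥0 := (2 ^ ((d : ℝ) / 2) * Real.exp ((R' + ‖x₀‖) ^ 2 / (2 * δ))).toNNReal with hD
  -- The `1` covers `j = 0`, and `2 D C` closes the induction through `C' / 2 + D C ≤ C'`.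
  refine ⟨max 1 (2 * (D * C)), fun x hx j => ?_⟩
  induction j generalizing x with
  | zero => simp [greenIter]
  | succ j ih =>
    set C' : ℝ≥0 := max 1 (2 * (D * C))
    have hxx : ‖x - x₀‖ ≤ R' + ‖x₀‖ := (norm_sub_le _ _).trans (by gcongr)
    rcases eq_or_ne ρ 0 with rfl | hρ
    · simp
    have hρ' : (ρ : ℝ≥0∞) ^ j ≠ 0 := by positivity
    have hρ'' : (ρ : ℝ≥0∞) ^ j ≠ ∞ := by finiteness
    -- The induction hypothesis is needed only on the support of `f`, which lies in the ball of
    -- radius `R'`; hence the condition `R ≤ R'`.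
    have h1 := hf.greenOp_le_add hδ
      (c := C' / (ρ : ℝ≥0∞) ^ j) (fun w hw => by
        rw [ENNReal.le_div_iff_mul_le (Or.inl hρ') (Or.inl hρ''), mul_comm]
        exact ih w ((hf.supp w hw).trans hR)) hxx
    have h2 : ENNReal.ofReal δ * (K * ρ) ≤ 1 / 2 := by
      calc ENNReal.ofReal δ * (K * ρ) = ENNReal.ofReal (δ * (K * ρ)) := by
            rw [ENNReal.ofReal_mul hδ.le, ENNReal.ofReal_mul (by positivity)]
            simp
        _ ≤ ENNReal.ofReal (1 / 2) := ENNReal.ofReal_le_ofReal hδ'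
        _ = 1 / 2 := by
          rw [ENNReal.ofReal_div_of_pos two_pos]; simp
    calc (ρ : ℝ≥0∞) ^ (j + 1) * greenIter f (j + 1) x
        ≤ (ρ : ℝ≥0∞) ^ (j + 1) * (ENNReal.ofReal δ * (K * (C' / (ρ : ℝ≥0∞) ^ j)) +
          D * greenIter f (j + 1) x₀) := mul_le_mul_right h1 _
      _ = (ENNReal.ofReal δ * (K * ρ)) * (C' * ((ρ : ℝ≥0∞) ^ j / (ρ : ℝ≥0∞) ^ j)) +
          D * ((ρ : ℝ≥0∞) ^ (j + 1) * greenIter f (j + 1) x₀) := by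
          rw [pow_succ, div_eq_mul_inv, div_eq_mul_inv]; ring
      _ ≤ 1 / 2 * (C' * 1) + D * C := by
          rw [ENNReal.div_self hρ' hρ'']
          exact add_le_add (mul_le_mul_left h2 _) (mul_le_mul_right (h _) _)
      _ ≤ 1 / 2 * C' + 1 / 2 * C' := by
          rw [mul_one]
          refine add_le_add le_rfl ?_
          have : (2 * (D * C) : ℝ≥0∞) ≤ C' := by
            exact_mod_cast le_max_right 1 (2 * (D * C))
          calc (D * C : ℝ≥0∞) = 1 / 2 * (2 * (D * C)) := by
                rw [← mul_assoc, one_div, ENNReal.inv_mul_cancel (by simp) (by simp), one_mul]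
            _ ≤ _ := mul_le_mul_right this _
      _ = C' := by rw [← add_mul, ENNReal.add_halves, one_mul]

end IsPotential

end Green

/-! ### Bridge kernels: splitting, integration over the duration, and the pigeonhole bound. -/

section Bridge

variable {d : ℕ}

/-- The unnormalized iterated kernels of the bridge ending at `y`: the integral over the simplex
`0 < s₁ < ⋯ < sₖ < t` and over `z₁, …, zₖ` of `∏ f(zⱼ)` against the product of heat kernels. -/
noncomputable def bridgeIter (f : EuclideanSpace ℝ (Fin d) → ℝ≥0∞) (y : EuclideanSpace ℝ (Fin d)) :
    ℕ → ℝ → EuclideanSpace ℝ (Fin d) → ℝ≥0∞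
  | 0, t, x => heatDensity t (y - x)
  | k + 1, t, x => ∫⁻ s in Set.Ioo 0 t, heatOp f (bridgeIter f y k (t - s)) s x

/-- The limit of the normalized kernels `bridgeIter f y k t x`. -/
noncomputable def greenConv (f : EuclideanSpace ℝ (Fin d) → ℝ≥0∞) (k : ℕ)
    (x y : EuclideanSpace ℝ (Fin d)) : ℝ≥0∞ :=
  ∑ j ∈ Finset.range (k + 1), greenIter f j x * greenIter f (k - j) y

variable {f g : EuclideanSpace ℝ (Fin d) → ℝ≥0∞} {K : ℝ≥0} {R : ℝ}

lemma measurable_greenConv (hf : Measurable f) (k : ℕ) (y : EuclideanSpace ℝ (Fin d)) :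
    Measurable fun x => greenConv f k x y :=
  Finset.measurable_fun_sum _ fun j _ => (measurable_greenIter hf j).mul_const _

/-- The term `j = 0`, in which the very first gap is the long one, is set apart; in the other terms
one application of the Green operator comes off the factor at `x`. `bridgeIter_succ_split` has the
same two cases. -/
lemma greenConv_succ (hf : Measurable f) (k : ℕ) (x y : EuclideanSpace ℝ (Fin d)) :
    greenConv f (k + 1) x y = greenOp f (fun w => greenConv f k w y) x + greenIter f (k + 1) y := by
  unfold greenConv
  rw [greenOp_sum_mul hf (measurable_greenIter hf) (fun j => greenIter f (k - j) y),
    Finset.sum_range_succ']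
  simp [greenIter]

lemma measurable_bridgeIter (hf : Measurable f) (y : EuclideanSpace ℝ (Fin d)) (k : ℕ) :
    Measurable fun p : ℝ × EuclideanSpace ℝ (Fin d) => bridgeIter f y k p.1 p.2 := by
  induction k with
  | zero => unfold bridgeIter; fun_prop
  | succ k ih =>
    have h1 : Measurable fun q : ((ℝ × EuclideanSpace ℝ (Fin d)) × ℝ) ×
        EuclideanSpace ℝ (Fin d) => heatDensity q.1.2 (q.2 - q.1.1.2) *
          (f q.2 * bridgeIter f y k (q.1.1.1 - q.1.2) q.2) := by
      have : Measurable fun q : ((ℝ × EuclideanSpace ℝ (Fin d)) × ℝ) ×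
          EuclideanSpace ℝ (Fin d) => bridgeIter f y k (q.1.1.1 - q.1.2) q.2 :=
        ih.comp (by fun_prop : Measurable fun q : ((ℝ × EuclideanSpace ℝ (Fin d)) × ℝ) ×
          EuclideanSpace ℝ (Fin d) => (q.1.1.1 - q.1.2, q.2))
      fun_prop
    have hS : MeasurableSet {p : (ℝ × EuclideanSpace ℝ (Fin d)) × ℝ | 0 < p.2 ∧ p.2 < p.1.1} :=
      (measurableSet_lt measurable_const measurable_snd).inter
        (measurableSet_lt measurable_snd (by fun_prop))
    have h2 := ((h1.lintegral_prod_right' (ν := volume)).indicator hS).lintegral_prod_right'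
      (ν := volume)
    convert! h2 using 2 with p
    rw [bridgeIter, ← lintegral_indicator measurableSet_Ioo]
    refine lintegral_congr fun s => ?_
    by_cases hs : s ∈ Set.Ioo 0 p.1
    · rw [Set.indicator_of_mem hs, Set.indicator_of_mem]
      · rfl
      · exact hs
    · rw [Set.indicator_of_notMem hs, Set.indicator_of_notMem]
      exact hs

lemma measurable_bridgeIter_right (hf : Measurable f) (y : EuclideanSpace ℝ (Fin d)) (k : ℕ)
    (t : ℝ) : Measurable (bridgeIter f y k t) :=
  (measurable_bridgeIter hf y k).comp measurable_prodMk_left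

lemma setLIntegral_Ico_flip (F : ℝ → ℝ≥0∞) (a t : ℝ) :
    ∫⁻ s in Set.Ico a t, F s = ∫⁻ r in Set.Ioc 0 (t - a), F (t - r) := by
  rw [← lintegral_indicator measurableSet_Ico, ← lintegral_indicator measurableSet_Ioc,
    ← lintegral_sub_left_eq_self _ t]
  refine lintegral_congr fun r => ?_
  by_cases hr : r ∈ Set.Ioc 0 (t - a)
  · rw [Set.indicator_of_mem hr, Set.indicator_of_mem]
    exact ⟨by linarith [hr.2], by linarith [hr.1]⟩
  · rw [Set.indicator_of_notMem hr, Set.indicator_of_notMem]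
    exact fun h => hr ⟨by linarith [h.2], by linarith [h.1]⟩

/-- Either the first gap is shorter than `a`, or it is at least `a`; the second case is parametrized
by the remaining time `r = t - s`. -/
lemma bridgeIter_succ_split {a t : ℝ} (ha : 0 < a) (hat : a ≤ t) (k : ℕ)
    (x y : EuclideanSpace ℝ (Fin d)) :
    bridgeIter f y (k + 1) t x = (∫⁻ s in Set.Ioo 0 a, heatOp f (bridgeIter f y k (t - s)) s x) +
      ∫⁻ r in Set.Ioc 0 (t - a), heatOp f (bridgeIter f y k r) (t - r) x := by
  rw [bridgeIter, ← Set.Ioo_union_Ico_eq_Ioo ha hat,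
    lintegral_union measurableSet_Ico, setLIntegral_Ico_flip]
  · simp
  · exact Set.disjoint_left.2 fun s h1 h2 => absurd h1.2 (not_lt.2 h2.1)

-- Integrating over the total duration removes the constraint that the gaps add up to `t`, so all
-- gaps become free and the integral factors into Green operators. Symmetry of the heat kernel lets
-- the chain be read backwards from `y`. The function `g` is arbitrary because each induction step
-- replaces it by `greenOp f g`.
set_option maxHeartbeats 1000000 in
lemma lintegral_mul_bridgeIter (hf : Measurable f) (hg : Measurable g)
    (y : EuclideanSpace ℝ (Fin d)) (k : ℕ) :
    ∫⁻ t in Set.Ioi (0 : ℝ), ∫⁻ x, f x * g x * bridgeIter f y k t x =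
      (greenOp f)^[k + 1] g y := by
  induction k generalizing g with
  | zero =>
    simp only [zero_add, Function.iterate_one, greenOp, heatOp, bridgeIter]
    refine setLIntegral_congr_fun measurableSet_Ioi fun t _ => lintegral_congr fun x => ?_
    rw [heatDensity_sub_comm, mul_comm]
  | succ k ih =>
    rw [Function.iterate_succ_apply, ← ih (measurable_greenOp hf hg)]
    have hA := measurable_bridgeIter hf y k
    -- Here `s` is the first gap and `r` the remaining time; both sides turn out to be integrals of
    -- `Φ` over the quadrant.
    let Φ : ℝ → ℝ → ℝ≥0∞ := fun s r => ∫⁻ x, ∫⁻ w, f x * g x *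
      (heatDensity s (w - x) * (f w * bridgeIter f y k r w))
    have hΦ0 : Measurable fun q : ((ℝ × ℝ) × EuclideanSpace ℝ (Fin d)) ×
        EuclideanSpace ℝ (Fin d) => f q.1.2 * g q.1.2 * (heatDensity q.1.1.1 (q.2 - q.1.2) *
          (f q.2 * bridgeIter f y k q.1.1.2 q.2)) := by
      have : Measurable fun q : ((ℝ × ℝ) × EuclideanSpace ℝ (Fin d)) ×
        EuclideanSpace ℝ (Fin d) => bridgeIter f y k q.1.1.2 q.2 :=
        hA.comp (by fun_prop : Measurable fun q : ((ℝ × ℝ) × EuclideanSpace ℝ (Fin d)) ×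
          EuclideanSpace ℝ (Fin d) => (q.1.1.2, q.2))
      fun_prop
    have hΦ : Measurable (Function.uncurry Φ) :=
      hΦ0.lintegral_prod_right'.lintegral_prod_right'
    have hL : ∀ t, ∫⁻ x, f x * g x * bridgeIter f y (k + 1) t x =
        ∫⁻ s in Set.Ioo 0 t, Φ s (t - s) := fun t => by
      have h1 : ∀ x, f x * g x * bridgeIter f y (k + 1) t x = ∫⁻ s in Set.Ioo 0 t,
          ∫⁻ w, f x * g x * (heatDensity s (w - x) * (f w * bridgeIter f y k (t - s) w)) :=
        fun x => by
          have h2 : Measurable fun q : ℝ × EuclideanSpace ℝ (Fin d) =>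
              heatDensity q.1 (q.2 - x) * (f q.2 * bridgeIter f y k (t - q.1) q.2) := by
            have : Measurable fun q : ℝ × EuclideanSpace ℝ (Fin d) =>
                bridgeIter f y k (t - q.1) q.2 :=
              hA.comp (by fun_prop : Measurable fun q : ℝ × EuclideanSpace ℝ (Fin d) =>
                (t - q.1, q.2))
            fun_prop
          rw [bridgeIter, ← lintegral_const_mul]
          · refine lintegral_congr fun s => ?_
            rw [heatOp, ← lintegral_const_mul]
            exact h2.comp measurable_prodMk_left
          · exact h2.lintegral_prod_right'
      simp_rw [h1]
      rw [lintegral_lintegral_swap]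
      have h3 : Measurable fun q : (EuclideanSpace ℝ (Fin d) × ℝ) × EuclideanSpace ℝ (Fin d) =>
          f q.1.1 * g q.1.1 * (heatDensity q.1.2 (q.2 - q.1.1) *
            (f q.2 * bridgeIter f y k (t - q.1.2) q.2)) :=
        hΦ0.comp (by fun_prop : Measurable
          fun q : (EuclideanSpace ℝ (Fin d) × ℝ) × EuclideanSpace ℝ (Fin d) =>
            (((q.1.2, t - q.1.2), q.1.1), q.2))
      exact h3.lintegral_prod_right'.aemeasurable
    have hRr : ∀ r, ∫⁻ w, f w * greenOp f g w * bridgeIter f y k r w =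
        ∫⁻ s in Set.Ioi 0, Φ s r := fun r => by
      have h1 : ∀ w, f w * greenOp f g w * bridgeIter f y k r w = ∫⁻ s in Set.Ioi 0,
          ∫⁻ x, f x * g x * (heatDensity s (w - x) * (f w * bridgeIter f y k r w)) :=
        fun w => by
          rw [mul_right_comm, greenOp, ← lintegral_const_mul]
          · refine lintegral_congr fun s => ?_
            rw [heatOp, ← lintegral_const_mul]
            · refine lintegral_congr fun x => ?_
              rw [heatDensity_sub_comm]
              ring
            · fun_prop
          · exact (measurable_heatOp hf hg).comp measurable_prodMk_right
      simp_rw [h1]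
      have h3 : Measurable fun q : (EuclideanSpace ℝ (Fin d) × ℝ) × EuclideanSpace ℝ (Fin d) =>
          f q.2 * g q.2 * (heatDensity q.1.2 (q.1.1 - q.2) *
            (f q.1.1 * bridgeIter f y k r q.1.1)) :=
        hΦ0.comp (by fun_prop : Measurable
          fun q : (EuclideanSpace ℝ (Fin d) × ℝ) × EuclideanSpace ℝ (Fin d) =>
            (((q.1.2, r), q.2), q.1.1))
      rw [lintegral_lintegral_swap h3.lintegral_prod_right'.aemeasurable]
      refine lintegral_congr fun s => ?_
      rw [lintegral_lintegral_swap]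
      exact (hΦ0.comp (by fun_prop : Measurable
          fun q : EuclideanSpace ℝ (Fin d) × EuclideanSpace ℝ (Fin d) =>
            (((s, r), q.2), q.1))).aemeasurable
    simp_rw [hL, hRr]
    have hS : MeasurableSet {p : ℝ × ℝ | 0 < p.2 ∧ p.2 < p.1} :=
      (measurableSet_lt measurable_const measurable_snd).inter
        (measurableSet_lt measurable_snd measurable_fst)
    -- `Φ` in the coordinates `t = s + r` and `s`, extended by zero outside the wedge `0 < s < t`;
    -- after exchanging the integrals, translation by `s` returns to the quadrant.
    let Ψ : ℝ → ℝ → ℝ≥0∞ := fun t s =>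
      {p : ℝ × ℝ | 0 < p.2 ∧ p.2 < p.1}.indicator (fun p => Φ p.2 (p.1 - p.2)) (t, s)
    have hΨ : Measurable (Function.uncurry Ψ) :=
      (hΦ.comp (by fun_prop : Measurable fun p : ℝ × ℝ => (p.2, p.1 - p.2))).indicator hS
    calc ∫⁻ t in Set.Ioi (0 : ℝ), ∫⁻ s in Set.Ioo 0 t, Φ s (t - s)
        = ∫⁻ t, ∫⁻ s, Ψ t s := by
          rw [← lintegral_indicator measurableSet_Ioi]
          refine lintegral_congr fun t => ?_
          by_cases ht : t ∈ Set.Ioi (0 : ℝ)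
          · rw [Set.indicator_of_mem ht, ← lintegral_indicator measurableSet_Ioo]
            rfl
          · rw [Set.indicator_of_notMem ht]
            refine (lintegral_eq_zero_of_ae_eq_zero (ae_of_all _ fun s => ?_)).symm
            exact Set.indicator_of_notMem (fun h => ht (h.1.trans h.2)) _
      _ = ∫⁻ s, ∫⁻ t, Ψ t s := lintegral_lintegral_swap hΨ.aemeasurable
      _ = ∫⁻ s in Set.Ioi (0 : ℝ), ∫⁻ r in Set.Ioi (0 : ℝ), Φ s r := by
          rw [← lintegral_indicator measurableSet_Ioi]
          refine lintegral_congr fun s => ?_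
          rw [← lintegral_add_right_eq_self _ s]
          by_cases hs : s ∈ Set.Ioi (0 : ℝ)
          · rw [Set.indicator_of_mem hs, ← lintegral_indicator measurableSet_Ioi]
            refine lintegral_congr fun r => ?_
            by_cases hr : r ∈ Set.Ioi (0 : ℝ)
            · rw [Set.indicator_of_mem hr]
              have : (r + s, s) ∈ {p : ℝ × ℝ | 0 < p.2 ∧ p.2 < p.1} :=
                ⟨hs, lt_add_of_pos_left s hr⟩
              simp only [Ψ, Set.indicator_of_mem this, add_sub_cancel_right]
            · rw [Set.indicator_of_notMem hr]
              refine Set.indicator_of_notMem (fun h => hr ?_) _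
              exact (pos_of_lt_add_left h.2 : 0 < r)
          · rw [Set.indicator_of_notMem hs]
            refine lintegral_eq_zero_of_ae_eq_zero (ae_of_all _ fun r => ?_)
            exact Set.indicator_of_notMem (fun h => hs h.1) _
      _ = ∫⁻ r in Set.Ioi (0 : ℝ), ∫⁻ s in Set.Ioi (0 : ℝ), Φ s r :=
          lintegral_lintegral_swap hΦ.aemeasurable

lemma greenIter_eq_iterate (k : ℕ) : greenIter f k = (greenOp f)^[k] fun _ => 1 := by
  induction k with
  | zero => rfl
  | succ k ih => rw [Function.iterate_succ_apply', ← ih]; rfl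

lemma lintegral_bridgeIter (hf : Measurable f) (y : EuclideanSpace ℝ (Fin d)) (k : ℕ) :
    ∫⁻ t in Set.Ioi (0 : ℝ), ∫⁻ x, f x * bridgeIter f y k t x = greenIter f (k + 1) y := by
  rw [greenIter_eq_iterate, ← lintegral_mul_bridgeIter hf measurable_const y k]
  simp

/-- Pigeonhole: among `k + 1` gaps of total length `t` one has length at least `t / (k + 1)`. Its
kernel is bounded by the peak at that time, and releasing the other gaps leaves Green iterates from
the two ends. -/
lemma bridgeIter_le (hf : Measurable f) (k : ℕ) {t : ℝ} (ht : 0 < t)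
    (x y : EuclideanSpace ℝ (Fin d)) :
    bridgeIter f y k t x ≤ heatPeak d (t / (k + 1)) * greenConv f k x y := by
  induction k generalizing t x with
  | zero => simpa [bridgeIter, greenConv, greenIter] using heatDensity_le ht _
  | succ k ih =>
    have hk : (0 : ℝ) < k + 1 := by positivity
    have ha : 0 < t / (k + 2) := by positivity
    have hat : t / (k + 2) ≤ t := div_le_self ht.le (by linarith)
    rw [bridgeIter_succ_split ha hat, greenConv_succ hf, mul_add]
    have hk2 : ((k + 1 : ℕ) : ℝ) + 1 = k + 2 := by push_cast; ring
    rw [hk2]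
    refine add_le_add ?_ ?_
    · calc _ ≤ ∫⁻ s in Set.Ioo 0 (t / (k + 2)),
            heatPeak d (t / (k + 2)) * heatOp f (fun w => greenConv f k w y) s x := by
            refine setLIntegral_mono' measurableSet_Ioo fun s hs => ?_
            unfold heatOp
            rw [← lintegral_const_mul' _ _ (heatPeak_ne_top _)]
            refine lintegral_mono fun w => ?_
            -- If the first gap is below the average `t / (k + 2)`, the average of the other `k + 1`
            -- gaps is above it, so one threshold serves throughout the induction.
            have h1 : t / (k + 2) ≤ (t - s) / (k + 1) := by
              have := hs.2
              rw [lt_div_iff₀ (by positivity)] at this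
              rw [div_le_div_iff₀ (by positivity) hk]
              linarith
            have h2 : 0 < t - s := by linarith [hs.2]
            calc _ ≤ heatDensity s (w - x) *
                  (f w * (heatPeak d (t / (k + 2)) * greenConv f k w y)) := by
                  gcongr
                  exact (ih h2 w).trans (mul_le_mul_left (heatPeak_antitone ha h1) _)
              _ = _ := by ring
        _ ≤ _ := by
            rw [lintegral_const_mul' _ _ (heatPeak_ne_top _)]
            refine mul_le_mul_right ?_ _
            exact lintegral_mono_set fun s hs => hs.1
    · calc _ ≤ ∫⁻ r in Set.Ioc 0 (t - t / (k + 2)),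
            heatPeak d (t / (k + 2)) * ∫⁻ w, f w * bridgeIter f y k r w := by
            refine setLIntegral_mono' measurableSet_Ioc fun r hr => ?_
            have h1 : t / (k + 2) ≤ t - r := by linarith [hr.2]
            exact (heatOp_le_heatPeak (ha.trans_le h1) x).trans
              (mul_le_mul_left (heatPeak_antitone ha h1) _)
        _ ≤ _ := by
            rw [lintegral_const_mul' _ _ (heatPeak_ne_top _), ← lintegral_bridgeIter hf]
            refine mul_le_mul_right ?_ _
            exact lintegral_mono_set fun s hs => hs.1

end Bridge

/-! ### Convergence of the normalized bridge kernels. -/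

section Asymptotics

variable {d : ℕ} {f g : EuclideanSpace ℝ (Fin d) → ℝ≥0∞} {K : ℝ≥0} {R : ℝ}

lemma greenOp_const_mul {c : ℝ≥0∞} (hc : c ≠ ∞) (x : EuclideanSpace ℝ (Fin d)) :
    greenOp f (fun w => c * g w) x = c * greenOp f g x := by
  unfold greenOp heatOp
  rw [← lintegral_const_mul' _ _ hc]
  refine lintegral_congr fun s => ?_
  rw [← lintegral_const_mul' _ _ hc]
  refine lintegral_congr fun w => ?_
  ring

lemma greenOp_add (hf : Measurable f) (hg : Measurable g)
    (h : EuclideanSpace ℝ (Fin d) → ℝ≥0∞) (x : EuclideanSpace ℝ (Fin d)) :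
    greenOp f (fun w => g w + h w) x = greenOp f g x + greenOp f h x := by
  unfold greenOp
  simp_rw [heatOp_add hf hg h]
  exact lintegral_add_left ((measurable_heatOp hf hg).comp measurable_prodMk_right) _

namespace IsPotential

variable (hf : IsPotential f K R)
include hf

lemma exists_greenConv_le (hd : 3 ≤ d) (k : ℕ) :
    ∃ C : ℝ≥0, (∀ x y, greenConv f k x y ≤ C) ∧ ∀ y, greenIter f k y ≤ C := by
  obtain ⟨M, hM1, hM, -⟩ := hf.exists_greenIter_le hd
  refine ⟨(k + 1) * M ^ k, fun x y => ?_, fun y => ?_⟩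
  · unfold greenConv
    calc _ ≤ ∑ j ∈ Finset.range (k + 1), (M : ℝ≥0∞) ^ k := by
          refine Finset.sum_le_sum fun j hj => ?_
          refine (mul_le_mul' (hM j x) (hM (k - j) y)).trans ?_
          rw [← pow_add, Nat.add_sub_cancel' (Nat.lt_succ_iff.1 (Finset.mem_range.1 hj))]
      _ = _ := by simp
  · refine (hM k y).trans ?_
    have : M ^ k ≤ (k + 1) * M ^ k := le_mul_of_one_le_left' (by simp)
    exact_mod_cast this

/-- Controls the tail of the integral in `lintegral_bridgeIter`, uniformly in `y`: `bridgeIter_le`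
reduces it to the tail of the peak. -/
lemma exists_lintegral_Ici_bridgeIter_le (hd : 3 ≤ d) (k : ℕ) : ∃ D : ℝ≥0, ∀ y, ∀ S : ℝ, 0 < S →
    ∫⁻ r in Set.Ici S, ∫⁻ w, f w * bridgeIter f y k r w ≤
      D * ∫⁻ r in Set.Ici S, heatPeak d r := by
  obtain ⟨C, hC, -⟩ := hf.exists_greenConv_le hd k
  have hk : (0 : ℝ) < 1 / (k + 1) := by positivity
  refine ⟨(ENNReal.ofReal ((1 / (k + 1 : ℝ)) ^ (-(d : ℝ) / 2)) * C * ∫⁻ w, f w).toNNReal,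
    fun y S hS => ?_⟩
  rw [ENNReal.coe_toNNReal
    (ENNReal.mul_lt_top (by finiteness) hf.lintegral_lt_top).ne,
    ← lintegral_const_mul _ measurable_heatPeak]
  refine setLIntegral_mono' measurableSet_Ici fun r hr => ?_
  have hr0 : 0 < r := hS.trans_le hr
  calc _ ≤ ∫⁻ w, f w * (ENNReal.ofReal ((1 / (k + 1 : ℝ)) ^ (-(d : ℝ) / 2)) * heatPeak d r * C) := by
        gcongr with w
        refine (bridgeIter_le hf.meas k hr0 w y).trans (mul_le_mul' ?_ (hC w y))
        rw [← heatPeak_mul hk hr0, one_div_mul_eq_div]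
    _ = _ := by
        rw [lintegral_mul_const _ hf.meas]
        ring

lemma bridgeIter_succ_le {k : ℕ} {t η : ℝ} (ht : 0 < t) (hη : 0 < η) (hη2 : η ≤ 1 / 2)
    {ε : ℝ≥0} {y : EuclideanSpace ℝ (Fin d)}
    (ih : ∀ s, t / 2 ≤ s → ∀ w, ‖w‖ ≤ R →
      bridgeIter f y k s w ≤ heatPeak d s * (greenConv f k w y + ε))
    (x : EuclideanSpace ℝ (Fin d)) :
    bridgeIter f y (k + 1) t x ≤
      heatPeak d ((1 - η) * t) * (greenConv f (k + 1) x y + ε * greenOp f (fun _ => 1) x) +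
      heatPeak d (η * t) *
        ∫⁻ r in Set.Ici (η * t), ∫⁻ w, f w * bridgeIter f y k r w := by
  have hηt : 0 < η * t := by positivity
  have hηt2 : η * t ≤ t / 2 := by nlinarith
  have h1η : 0 < (1 - η) * t := by nlinarith
  rw [bridgeIter_succ_split hηt (by linarith)]
  have hpart1 : ∫⁻ s in Set.Ioo 0 (η * t), heatOp f (bridgeIter f y k (t - s)) s x ≤
      heatPeak d ((1 - η) * t) *
        (greenOp f (fun w => greenConv f k w y) x + ε * greenOp f (fun _ => 1) x) := by
    have h2 : greenOp f (fun _ => (ε : ℝ≥0∞)) x = ε * greenOp f (fun _ => 1) x := by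
      rw [← greenOp_const_mul (by simp)]; simp
    rw [← h2, ← greenOp_add hf.meas (measurable_greenConv hf.meas k y),
      ← greenOp_const_mul (heatPeak_ne_top _)]
    unfold greenOp
    refine (setLIntegral_mono' measurableSet_Ioo fun s hs => ?_).trans
      (lintegral_mono_set Set.Ioo_subset_Ioi_self)
    refine heatOp_mono (fun w hw => ?_) s x
    refine (ih (t - s) (by linarith [hs.2]) w (hf.supp w hw)).trans (mul_le_mul_left ?_ _)
    exact heatPeak_antitone h1η (by linarith [hs.2])
  have hpart2 : ∫⁻ r in Set.Ioc 0 (t - η * t), heatOp f (bridgeIter f y k r) (t - r) x ≤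
      heatPeak d ((1 - η) * t) * greenIter f (k + 1) y +
      heatPeak d (η * t) * ∫⁻ r in Set.Ici (η * t), ∫⁻ w, f w * bridgeIter f y k r w := by
    rw [← Set.Ioo_union_Icc_eq_Ioc hηt (by linarith : η * t ≤ t - η * t)]
    refine (lintegral_union_le _ _ _).trans (add_le_add ?_ ?_)
    · rw [← lintegral_bridgeIter hf.meas, ← lintegral_const_mul' _ _ (heatPeak_ne_top _)]
      refine (setLIntegral_mono' measurableSet_Ioo fun r hr => ?_).trans
        (lintegral_mono_set Set.Ioo_subset_Ioi_self)
      refine (heatOp_le_heatPeak (by linarith [hr.2]) x).trans (mul_le_mul_left ?_ _)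
      exact heatPeak_antitone h1η (by linarith [hr.2])
    · rw [← lintegral_const_mul' _ _ (heatPeak_ne_top _)]
      refine (setLIntegral_mono' measurableSet_Icc fun r hr => ?_).trans
        (lintegral_mono_set Set.Icc_subset_Ici_self)
      refine (heatOp_le_heatPeak (by linarith [hr.2]) x).trans (mul_le_mul_left ?_ _)
      exact heatPeak_antitone hηt (by linarith [hr.2])
  rw [greenConv_succ hf.meas]
  calc _ ≤ _ := add_le_add hpart1 hpart2
    _ = _ := by ring

/-- For the lower bound a split at `t / 2` is enough, since the peak at `t` is below the peak at any
shorter time. The added terms are the induction error, the Gaussian factor of the long gap over a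
displacement of at most `2 R'`, and the parts of the two Green integrals beyond `t / 2`. -/
lemma heatPeak_mul_greenConv_succ_le {k : ℕ} {t : ℝ} (ht : 0 < t) {ε C : ℝ≥0} {R' : ℝ}
    (hR : R ≤ R') {x y : EuclideanSpace ℝ (Fin d)} (hx : ‖x‖ ≤ R')
    (hC : ∀ w, greenConv f k w y ≤ C)
    (ih : ∀ s, t / 2 ≤ s → ∀ w, ‖w‖ ≤ R →
      heatPeak d s * greenConv f k w y ≤ bridgeIter f y k s w + heatPeak d s * ε) :
    heatPeak d t * greenConv f (k + 1) x y ≤ bridgeIter f y (k + 1) t x +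
      heatPeak d (t / 2) * (ε * greenOp f (fun _ => 1) x +
        ENNReal.ofReal ((2 * R') ^ 2 / t) * greenIter f (k + 1) y) +
      heatPeak d t * ((C * ∫⁻ w, f w) * (∫⁻ s in Set.Ici (t / 2), heatPeak d s) +
        ∫⁻ r in Set.Ici (t / 2), ∫⁻ w, f w * bridgeIter f y k r w) := by
  have ht2 : 0 < t / 2 := by positivity
  have hcov : ∀ F : ℝ → ℝ≥0∞, ∫⁻ s in Set.Ioi 0, F s ≤
      (∫⁻ s in Set.Ioo 0 (t / 2), F s) + ∫⁻ s in Set.Ici (t / 2), F s := fun F => by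
    rw [← Set.Ioo_union_Ici_eq_Ioi ht2]
    exact lintegral_union_le _ _ _
  have hm := hf.meas
  have hpart1 : heatPeak d t * ∫⁻ s in Set.Ioo 0 (t / 2),
        heatOp f (fun w => greenConv f k w y) s x ≤
      (∫⁻ s in Set.Ioo 0 (t / 2), heatOp f (bridgeIter f y k (t - s)) s x) +
        heatPeak d (t / 2) * (ε * greenOp f (fun _ => 1) x) := by
    have h2 : heatPeak d (t / 2) * (ε * greenOp f (fun _ => 1) x) =
        ∫⁻ s in Set.Ioi 0, heatOp f (fun _ => heatPeak d (t / 2) * ε) s x := by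
      rw [← mul_assoc, ← greenOp_const_mul (ENNReal.mul_ne_top (heatPeak_ne_top _) (by simp))]
      simp [greenOp]
    rw [h2, ← lintegral_const_mul' _ _ (heatPeak_ne_top _)]
    refine le_trans ?_ (add_le_add_right (lintegral_mono_set
      (Set.Ioo_subset_Ioi_self : Set.Ioo 0 (t / 2) ⊆ _)) _)
    have hmeas : Measurable fun s => heatOp f (fun _ => heatPeak d (t / 2) * ε) s x :=
      (measurable_heatOp hm measurable_const).comp measurable_prodMk_right
    rw [← lintegral_add_right _ hmeas]
    refine setLIntegral_mono' measurableSet_Ioo fun s hs => ?_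
    rw [← heatOp_add hm (measurable_bridgeIter_right hm y k _)]
    unfold heatOp
    rw [← lintegral_const_mul' _ _ (heatPeak_ne_top _)]
    refine lintegral_mono fun w => ?_
    by_cases hw : f w = 0
    · simp [hw]
    calc _ = heatDensity s (w - x) * (f w * (heatPeak d t * greenConv f k w y)) := by ring
      _ ≤ _ := by
        gcongr
        calc _ ≤ heatPeak d (t - s) * greenConv f k w y :=
              mul_le_mul_left (heatPeak_antitone (by linarith [hs.2]) (by linarith [hs.1])) _
          _ ≤ _ := ih (t - s) (by linarith [hs.2]) w (hf.supp w hw)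
          _ ≤ _ := add_le_add le_rfl
            (mul_le_mul_left (heatPeak_antitone ht2 (by linarith [hs.2])) _)
  have htail1 : ∫⁻ s in Set.Ici (t / 2), heatOp f (fun w => greenConv f k w y) s x ≤
      (C * ∫⁻ w, f w) * (∫⁻ s in Set.Ici (t / 2), heatPeak d s) := by
    rw [← lintegral_const_mul _ measurable_heatPeak]
    refine setLIntegral_mono' measurableSet_Ici fun s hs => ?_
    calc _ ≤ _ := heatOp_le_heatPeak (ht2.trans_le hs) x
      _ ≤ heatPeak d s * ∫⁻ w, f w * C := by
        gcongr with w
        exact hC w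
      _ = _ := by
        rw [lintegral_mul_const _ hm]
        ring
  have hpart2 : heatPeak d t *
        ∫⁻ r in Set.Ioo 0 (t / 2), ∫⁻ w, f w * bridgeIter f y k r w ≤
      (∫⁻ r in Set.Ioc 0 (t - t / 2), heatOp f (bridgeIter f y k r) (t - r) x) +
        heatPeak d (t / 2) * (ENNReal.ofReal ((2 * R') ^ 2 / t) * greenIter f (k + 1) y) := by
    have hA := measurable_bridgeIter hm y k
    have hG : Measurable fun r => ∫⁻ w, f w * bridgeIter f y k r w :=
      Measurable.lintegral_prod_right'
        (f := fun q : ℝ × EuclideanSpace ℝ (Fin d) => f q.2 * bridgeIter f y k q.1 q.2)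
        (by fun_prop)
    rw [← lintegral_bridgeIter hm, ← mul_assoc,
      ← lintegral_const_mul' _ _ (heatPeak_ne_top _), ← lintegral_const_mul _ hG]
    have hsub : Set.Ioo 0 (t / 2) ⊆ Set.Ioc 0 (t - t / 2) :=
      fun s hs => ⟨hs.1, by linarith [hs.2]⟩
    refine le_trans ?_ (add_le_add (lintegral_mono_set hsub)
      (lintegral_mono_set (Set.Ioo_subset_Ioi_self : Set.Ioo 0 (t / 2) ⊆ _)))
    rw [← lintegral_add_right _ (hG.const_mul _)]
    refine setLIntegral_mono' measurableSet_Ioo fun r hr => ?_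
    have hAr := measurable_bridgeIter_right hm y k r
    unfold heatOp
    rw [← lintegral_const_mul' _ _ (heatPeak_ne_top _), ← lintegral_const_mul _ (by fun_prop),
      ← lintegral_add_right _ (by fun_prop)]
    refine lintegral_mono fun w => ?_
    by_cases hw : f w = 0
    · simp [hw]
    rw [← add_mul]
    refine mul_le_mul_left ?_ _
    have hwx : ‖w - x‖ ≤ 2 * R' := (norm_sub_le _ _).trans (by linarith [hf.supp w hw])
    have htr : t / 2 ≤ t - r := by linarith [hr.2]
    have htr0 : 0 < t - r := ht2.trans_le htr
    calc heatPeak d t ≤ heatPeak d (t - r) := heatPeak_antitone htr0 (by linarith [hr.1])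
      _ ≤ _ := heatPeak_le_heatDensity_add htr0 hwx
      _ ≤ _ := by
        gcongr
        · exact heatPeak_antitone ht2 htr
        · linarith
  have htail2 : greenIter f (k + 1) y ≤
      (∫⁻ r in Set.Ioo 0 (t / 2), ∫⁻ w, f w * bridgeIter f y k r w) +
        ∫⁻ r in Set.Ici (t / 2), ∫⁻ w, f w * bridgeIter f y k r w := by
    rw [← lintegral_bridgeIter hm]
    exact hcov _
  have hT := (hcov fun s => heatOp f (fun w => greenConv f k w y) s x).trans
    (add_le_add_right htail1 _)
  rw [greenConv_succ hm, bridgeIter_succ_split ht2 (by linarith : t / 2 ≤ t)]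
  calc _ ≤ heatPeak d t * (((∫⁻ s in Set.Ioo 0 (t / 2),
            heatOp f (fun w => greenConv f k w y) s x) +
          (C * ∫⁻ w, f w) * (∫⁻ s in Set.Ici (t / 2), heatPeak d s)) +
        ((∫⁻ r in Set.Ioo 0 (t / 2), ∫⁻ w, f w * bridgeIter f y k r w) +
          ∫⁻ r in Set.Ici (t / 2), ∫⁻ w, f w * bridgeIter f y k r w)) :=
        mul_le_mul_right (add_le_add hT htail2) _
    _ = heatPeak d t * (∫⁻ s in Set.Ioo 0 (t / 2),
            heatOp f (fun w => greenConv f k w y) s x) +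
        heatPeak d t * (∫⁻ r in Set.Ioo 0 (t / 2), ∫⁻ w, f w * bridgeIter f y k r w) +
        heatPeak d t * ((C * ∫⁻ w, f w) * (∫⁻ s in Set.Ici (t / 2), heatPeak d s) +
          ∫⁻ r in Set.Ici (t / 2), ∫⁻ w, f w * bridgeIter f y k r w) := by ring
    _ ≤ _ := add_le_add_left (add_le_add hpart1 hpart2) _
    _ = _ := by ring

/-- The normalized kernels `bridgeIter f y k t x / heatPeak d t` converge to `greenConv f k x y`
as `t → ∞`, uniformly for `x` and `y` in bounded sets. -/
lemma eventually_bridgeIter_approx (hd : 3 ≤ d) {R' : ℝ} (hR : R ≤ R') (k : ℕ) :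
    ∀ ε : ℝ≥0, 0 < ε → ∃ t₀ : ℝ, 0 < t₀ ∧ ∀ t, t₀ ≤ t → ∀ x y : EuclideanSpace ℝ (Fin d),
      ‖x‖ ≤ R' → ‖y‖ ≤ R' →
      bridgeIter f y k t x ≤ heatPeak d t * (greenConv f k x y + ε) ∧
      heatPeak d t * greenConv f k x y ≤ bridgeIter f y k t x + heatPeak d t * ε := by
  induction k with
  | zero =>
    intro ε hε
    have hε' : (0 : ℝ) < ε := hε
    -- For `k = 0` the error is the Gaussian exponent, at most `(2 R')² / (2t)`.
    refine ⟨(2 * R') ^ 2 / ε + 1, by positivity, fun t ht x y hx hy => ?_⟩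
    have ht0 : 0 < t := lt_of_lt_of_le (by positivity) ht
    have hyx : ‖y - x‖ ≤ 2 * R' := (norm_sub_le _ _).trans (by linarith)
    have hconv : greenConv f 0 x y = 1 := by simp [greenConv, greenIter]
    rw [hconv, mul_one]
    refine ⟨(heatDensity_le ht0 _).trans (le_mul_of_one_le_right' le_self_add), ?_⟩
    refine (heatPeak_le_heatDensity_add ht0 hyx).trans ?_
    refine add_le_add le_rfl (mul_le_mul_right ?_ _)
    rw [← ENNReal.ofReal_coe_nnreal]
    refine ENNReal.ofReal_le_ofReal ?_
    have h1 : (2 * R') ^ 2 / ε ≤ t := by linarith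
    rw [div_le_iff₀ hε'] at h1
    rw [div_le_iff₀ (by positivity)]
    nlinarith [mul_pos hε' ht0]
  | succ k ih =>
    intro ε hε
    obtain ⟨M, hM1, -, hM⟩ := hf.exists_greenIter_le hd
    have hM' : ∀ x, greenOp f (fun _ => 1) x ≤ M := fun x => by
      simpa using hM (fun _ => 1) 1 (fun _ _ => le_rfl) x
    obtain ⟨C, hC, -⟩ := hf.exists_greenConv_le hd k
    obtain ⟨C', hC', hCG⟩ := hf.exists_greenConv_le hd (k + 1)
    obtain ⟨D, hD⟩ := hf.exists_lintegral_Ici_bridgeIter_le hd k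
    -- `c` is the ratio of the peaks at `t / 2` and at `t`.
    obtain ⟨c, hc⟩ : ∃ c : ℝ≥0, (c : ℝ≥0∞) = ENNReal.ofReal ((1 / 2 : ℝ) ^ (-(d : ℝ) / 2)) :=
      ⟨_, rfl⟩
    obtain ⟨lam, hlam⟩ : ∃ c : ℝ≥0, (c : ℝ≥0∞) = ∫⁻ w, f w :=
      ⟨_, ENNReal.coe_toNNReal hf.lintegral_lt_top.ne⟩
    -- The error `ε` is divided into quarters. `ε'` is the accuracy asked of the induction
    -- hypothesis; it is amplified by at most `M` in the upper bound and `c M` in the lower one.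
    obtain ⟨ε', hε', hε'M, hcε'M⟩ : ∃ ε' : ℝ≥0, 0 < ε' ∧ ε' * M ≤ ε / 4 ∧
        c * (ε' * M) ≤ ε / 4 := by
      have h1 : ε / (4 * M * (c + 1)) * M = ε / 4 * (c + 1)⁻¹ := by
        have : M ≠ 0 := (zero_lt_one.trans_le hM1).ne'
        field_simp
      have h2 : (c + 1)⁻¹ ≤ 1 := inv_le_one_of_one_le₀ (by simp)
      have hM0 := zero_lt_one.trans_le hM1
      refine ⟨ε / (4 * M * (c + 1)), by positivity, ?_, ?_⟩
      · rw [h1]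
        exact mul_le_of_le_one_right' h2
      · rw [h1, mul_left_comm]
        refine mul_le_of_le_one_right' ?_
        rw [← div_eq_mul_inv]
        exact div_le_one_of_le₀ (by simp) (by simp)
    obtain ⟨δ, hδ, hδ1, hδC⟩ : ∃ δ : ℝ≥0, 0 < δ ∧ δ ≤ 1 ∧ δ * C' ≤ ε / 4 := by
      refine ⟨min 1 (ε / 4 / (C' + 1)), by positivity, min_le_left _ _, ?_⟩
      calc _ ≤ ε / 4 / (C' + 1) * (C' + 1) := by
            gcongr
            · exact min_le_right _ _
            · simp
        _ = ε / 4 := div_mul_cancel₀ _ (by positivity)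
    -- `η` is fixed before `t`, so that the ratio of the peaks at `(1 - η) t` and `t` is at most `1
    -- + δ`; the large factor `η^(-d/2)` then multiplies a tail that vanishes as `t → ∞`.
    obtain ⟨η, hη, hη2, hηδ⟩ : ∃ η : ℝ, 0 < η ∧ η ≤ 1 / 2 ∧
        ENNReal.ofReal ((1 - η) ^ (-(d : ℝ) / 2)) ≤ 1 + δ := by
      have h1 : Tendsto (fun η : ℝ => (1 - η) ^ (-(d : ℝ) / 2)) (𝓝[>] 0) (𝓝 1) := by
        have : ContinuousAt (fun η : ℝ => (1 - η) ^ (-(d : ℝ) / 2)) 0 :=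
          ContinuousAt.rpow_const (by fun_prop) (Or.inl (by norm_num))
        have h2 := this.tendsto
        simp only [sub_zero, Real.one_rpow] at h2
        exact h2.mono_left nhdsWithin_le_nhds
      have h3 : (1 : ℝ) < 1 + δ := lt_add_of_pos_right _ hδ
      obtain ⟨η, h4, h5, h6⟩ := ((h1.eventually (gt_mem_nhds h3)).and
        (Ioo_mem_nhdsGT (by norm_num : (0 : ℝ) < 1 / 2))).exists
      refine ⟨η, h5, h6.le, ?_⟩
      calc _ ≤ ENNReal.ofReal (1 + δ) := ENNReal.ofReal_le_ofReal h4.le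
        _ = 1 + δ := by
          rw [ENNReal.ofReal_add zero_le_one δ.coe_nonneg]
          simp
    obtain ⟨t₁, ht₁, h₁⟩ := ih ε' hε'
    have hε4 : (0 : ℝ≥0∞) < (ε / 4 : ℝ≥0) := by
      have : 0 < ε / 4 := by positivity
      exact_mod_cast this
    have hTail : ∀ (a : ℝ≥0) (b : ℝ), 0 < b → ∀ᶠ t : ℝ in atTop,
        a * ∫⁻ r in Set.Ici (b * t), heatPeak d r ≤ (ε / 4 : ℝ≥0) := fun a b hb => by
      have h1 : Tendsto (fun t : ℝ => a * ∫⁻ r in Set.Ici (b * t), heatPeak d r) atTop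
          (𝓝 (a * 0)) :=
        ENNReal.Tendsto.const_mul
          ((tendsto_lintegral_Ici_heatPeak hd).comp (tendsto_id.const_mul_atTop hb))
          (Or.inr (by simp))
      rw [mul_zero] at h1
      exact (h1.eventually (gt_mem_nhds hε4)).mono fun t ht => ht.le
    have hU : ∀ᶠ t : ℝ in atTop,
        c * (ENNReal.ofReal ((2 * R') ^ 2 / t) * C') ≤ (ε / 4 : ℝ≥0) := by
      have h1 : Tendsto (fun t : ℝ => (2 * R') ^ 2 / t) atTop (𝓝 0) :=
        tendsto_const_nhds.div_atTop tendsto_id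
      have h2 := (ENNReal.continuous_ofReal.tendsto 0).comp h1
      have h3 : Tendsto (fun t : ℝ => (c : ℝ≥0∞) * (ENNReal.ofReal ((2 * R') ^ 2 / t) * C'))
          atTop (𝓝 (c * (ENNReal.ofReal 0 * C'))) :=
        ENNReal.Tendsto.const_mul (ENNReal.Tendsto.mul_const h2 (Or.inr (by simp)))
          (Or.inr (by simp))
      simp only [ENNReal.ofReal_zero, zero_mul, mul_zero] at h3
      exact (h3.eventually (gt_mem_nhds hε4)).mono fun t ht => ht.le
    obtain ⟨t₂, ht₂⟩ := eventually_atTop.1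
      ((hTail ((ENNReal.ofReal (η ^ (-(d : ℝ) / 2))).toNNReal * D) η hη).and
        ((hTail (C * lam + D) (1 / 2) (by norm_num)).and hU))
    -- The induction hypothesis is applied at times down to `t / 2`, whence `2 * t₁`.
    refine ⟨max (2 * t₁) t₂, lt_max_of_lt_left (by positivity), fun t ht x y hx hy => ?_⟩
    obtain ⟨htail, htail', hu⟩ := ht₂ t ((le_max_right _ _).trans ht)
    have htt₁ : 2 * t₁ ≤ t := (le_max_left _ _).trans ht
    have ht0 : 0 < t := by linarith
    have hsum : (ε : ℝ≥0∞) = (ε / 4 : ℝ≥0) + (ε / 4 : ℝ≥0) + (ε / 4 : ℝ≥0) + (ε / 4 : ℝ≥0) := by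
      norm_cast
      ring
    constructor
    · refine (hf.bridgeIter_succ_le ht0 hη hη2 (ε := ε') (fun s hs w hw =>
        (h₁ s (by linarith) w y (hw.trans hR) hy).1) x).trans ?_
      rw [heatPeak_mul (by linarith) ht0, heatPeak_mul hη ht0, mul_comm _ (heatPeak d t),
        mul_comm _ (heatPeak d t), mul_assoc, mul_assoc, ← mul_add]
      refine mul_le_mul_right ?_ _
      have hb : ENNReal.ofReal (η ^ (-(d : ℝ) / 2)) *
          ∫⁻ r in Set.Ici (η * t), ∫⁻ w, f w * bridgeIter f y k r w ≤ (ε / 4 : ℝ≥0) := by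
        refine le_trans ?_ htail
        rw [ENNReal.coe_mul, mul_assoc]
        exact mul_le_mul_right (hD y _ (by positivity)) _
      have hεM : (ε' : ℝ≥0∞) * greenOp f (fun _ => 1) x ≤ (ε / 4 : ℝ≥0) := by
        refine (mul_le_mul_right (hM' x) _).trans ?_
        exact_mod_cast hε'M
      have hδL : (δ : ℝ≥0∞) * greenConv f (k + 1) x y ≤ (ε / 4 : ℝ≥0) := by
        refine (mul_le_mul_right (hC' x y) _).trans ?_
        exact_mod_cast hδC
      have hδε : (δ : ℝ≥0∞) * (ε' * greenOp f (fun _ => 1) x) ≤ (ε / 4 : ℝ≥0) :=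
        (mul_le_of_le_one_left' (by exact_mod_cast hδ1)).trans hεM
      calc _ ≤ (1 + δ) * (greenConv f (k + 1) x y + ε' * greenOp f (fun _ => 1) x) +
            (ε / 4 : ℝ≥0) := add_le_add (mul_le_mul_left hηδ _) hb
        _ = greenConv f (k + 1) x y + (ε' * greenOp f (fun _ => 1) x +
            δ * greenConv f (k + 1) x y + δ * (ε' * greenOp f (fun _ => 1) x) +
            (ε / 4 : ℝ≥0)) := by ring
        _ ≤ _ := by
          rw [hsum]
          gcongr
    · have ht2 : t / 2 = 1 / 2 * t := by ring
      refine (hf.heatPeak_mul_greenConv_succ_le ht0 hR hx (hC · y) (ε := ε') (fun s hs w hw =>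
        (h₁ s (by linarith) w y (hw.trans hR) hy).2)).trans ?_
      rw [ht2, heatPeak_mul (by norm_num) ht0, ← hc, add_assoc, mul_comm (c : ℝ≥0∞), mul_assoc,
        ← mul_add, ← hlam]
      refine add_le_add_right (mul_le_mul_right ?_ _) _
      have hb : (C * lam) * (∫⁻ s in Set.Ici (1 / 2 * t), heatPeak d s) +
          ∫⁻ r in Set.Ici (1 / 2 * t), ∫⁻ w, f w * bridgeIter f y k r w ≤ (ε / 4 : ℝ≥0) := by
        refine le_trans ?_ htail'
        rw [ENNReal.coe_add, ENNReal.coe_mul, add_mul]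
        exact add_le_add_right (hD y _ (by positivity)) _
      have hεM : (c : ℝ≥0∞) * (ε' * greenOp f (fun _ => 1) x) ≤ (ε / 4 : ℝ≥0) := by
        refine (mul_le_mul_right (mul_le_mul_right (hM' x) _) _).trans ?_
        exact_mod_cast hcε'M
      have hu' : c * (ENNReal.ofReal ((2 * R') ^ 2 / t) * greenIter f (k + 1) y) ≤
          (ε / 4 : ℝ≥0) :=
        (mul_le_mul_right (mul_le_mul_right (hCG y) _) _).trans hu
      calc _ ≤ ((ε / 4 : ℝ≥0) + (ε / 4 : ℝ≥0) + (ε / 4 : ℝ≥0) : ℝ≥0∞) := by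
            rw [mul_add]
            exact add_le_add (add_le_add hεM hu') hb
        _ ≤ _ := by
          rw [hsum]
          exact le_self_add

end IsPotential

end Asymptotics

/-! ### Integrals over increasing tuples of times. -/

section OrderedTuples

/-- The strictly increasing `k`-tuples with entries in `I`. -/
def orderedTuples (k : ℕ) (I : Set ℝ) : Set (Fin k → ℝ) :=
  {s | StrictMono s ∧ ∀ i, s i ∈ I}

lemma measurableSet_orderedTuples (k : ℕ) {I : Set ℝ} (hI : MeasurableSet I) :
    MeasurableSet (orderedTuples k I) := by
  have h1 : orderedTuples k I = (⋂ (i : Fin k) (j : Fin k) (_ : i < j), {s | s i < s j}) ∩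
      ⋂ i : Fin k, {s | s i ∈ I} := by
    ext s
    simp [orderedTuples, StrictMono]
  rw [h1]
  refine MeasurableSet.inter ?_ (MeasurableSet.iInter fun i => measurable_pi_apply i hI)
  exact MeasurableSet.iInter fun i => MeasurableSet.iInter fun j => MeasurableSet.iInter fun _ =>
    measurableSet_lt (measurable_pi_apply i) (measurable_pi_apply j)

lemma lintegral_pi_fin_succ {α : Type*} [MeasurableSpace α] {k : ℕ} (μ : Fin (k + 1) → Measure α)
    [∀ i, SigmaFinite (μ i)] {F : (Fin (k + 1) → α) → ℝ≥0∞} (hF : Measurable F) :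
    ∫⁻ s, F s ∂Measure.pi μ =
      ∫⁻ a, ∫⁻ s : Fin k → α, F (Fin.cons a s) ∂(Measure.pi fun j => μ j.succ) ∂μ 0 := by
  have h := (measurePreserving_piFinSuccAbove μ 0).symm
  rw [← h.lintegral_comp hF]
  refine (lintegral_prod (μ := μ 0) (ν := Measure.pi fun j => μ (Fin.succAbove 0 j)) _
    (hF.comp h.measurable).aemeasurable).trans ?_
  simp [MeasurableEquiv.piFinSuccAbove, Fin.consEquiv]

lemma lintegral_fin_succ {k : ℕ} {F : (Fin (k + 1) → ℝ) → ℝ≥0∞} (hF : Measurable F) :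
    ∫⁻ s, F s = ∫⁻ a : ℝ, ∫⁻ s : Fin k → ℝ, F (Fin.cons a s) :=
  lintegral_pi_fin_succ (fun _ => volume) hF

lemma volume_univ_fin_zero : volume (Set.univ : Set (Fin 0 → ℝ)) = 1 := by
  rw [volume_pi, Measure.pi_empty_univ]

lemma lintegral_prod_eq_pow {g : ℝ → ℝ≥0∞} (hg : Measurable g) (k : ℕ) :
    ∫⁻ s : Fin k → ℝ, ∏ i, g (s i) = (∫⁻ s, g s) ^ k := by
  induction k with
  | zero => simp [volume_univ_fin_zero]
  | succ k ih =>
    rw [lintegral_fin_succ (by fun_prop)]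
    simp_rw [Fin.prod_univ_succ, Fin.cons_zero, Fin.cons_succ]
    have h : ∀ a, ∫⁻ s : Fin k → ℝ, g a * ∏ i, g (s i) = g a * (∫⁻ s, g s) ^ k := fun a => by
      rw [lintegral_const_mul _ (by fun_prop), ih]
    simp_rw [h]
    rw [lintegral_mul_const _ hg, pow_succ']

/-- Writing the time set as `Set.Ioi a ∩ D` lets only the lower end move as entries are removed; `D`
is later everything for Brownian motion and `Set.Iio t` for the bridge. -/
lemma orderedTuples_cons {k : ℕ} {a u : ℝ} {D : Set ℝ} {s : Fin k → ℝ} :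
    (Fin.cons u s : Fin (k + 1) → ℝ) ∈ orderedTuples (k + 1) (Set.Ioi a ∩ D) ↔
      u ∈ Set.Ioi a ∩ D ∧ s ∈ orderedTuples k (Set.Ioi u ∩ D) := by
  simp only [orderedTuples, Set.mem_ofPred_eq, Fin.strictMono_cons, Fin.forall_fin_succ,
    Fin.cons_zero, Fin.cons_succ, Set.mem_inter_iff, Set.mem_Ioi]
  constructor
  · rintro ⟨⟨h1, h2⟩, ⟨h3, h4⟩, h5⟩
    exact ⟨⟨h3, h4⟩, h2, fun i => ⟨h1 i, (h5 i).2⟩⟩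
  · rintro ⟨⟨h3, h4⟩, h2, h5⟩
    exact ⟨⟨fun i => (h5 i).1, h2⟩, ⟨h3, h4⟩, fun i => ⟨h3.trans (h5 i).1, (h5 i).2⟩⟩

lemma setLIntegral_orderedTuples_succ {k : ℕ} (a : ℝ) {D : Set ℝ} (hD : MeasurableSet D)
    {F : (Fin (k + 1) → ℝ) → ℝ≥0∞} (hF : Measurable F) :
    ∫⁻ s in orderedTuples (k + 1) (Set.Ioi a ∩ D), F s =
      ∫⁻ u in Set.Ioi a ∩ D, ∫⁻ s in orderedTuples k (Set.Ioi u ∩ D), F (Fin.cons u s) := by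
  have hI : ∀ b, MeasurableSet (Set.Ioi b ∩ D) := fun b => measurableSet_Ioi.inter hD
  rw [← lintegral_indicator (measurableSet_orderedTuples _ (hI a)),
    lintegral_fin_succ (hF.indicator (measurableSet_orderedTuples _ (hI a))),
    ← lintegral_indicator (hI a)]
  refine lintegral_congr fun u => ?_
  by_cases hu : u ∈ Set.Ioi a ∩ D
  · rw [Set.indicator_of_mem hu, ← lintegral_indicator (measurableSet_orderedTuples _ (hI u))]
    refine lintegral_congr fun s => ?_
    have h := orderedTuples_cons (k := k) (a := a) (u := u) (D := D) (s := s)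
    simp only [hu, true_and] at h
    by_cases hs : s ∈ orderedTuples k (Set.Ioi u ∩ D)
    · rw [Set.indicator_of_mem hs, Set.indicator_of_mem (h.2 hs)]
    · rw [Set.indicator_of_notMem hs, Set.indicator_of_notMem (mt h.1 hs)]
  · rw [Set.indicator_of_notMem hu]
    refine lintegral_eq_zero_of_ae_eq_zero (ae_of_all _ fun s => ?_)
    exact Set.indicator_of_notMem (fun h => hu (orderedTuples_cons.1 h).1) _

/-- Each coincidence `s i = s j` is a proper linear subspace, hence null. -/
lemma ae_injective (k : ℕ) : ∀ᵐ s : Fin k → ℝ, Function.Injective s := by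
  have h : ∀ i j : Fin k, i ≠ j → ∀ᵐ s : Fin k → ℝ, s i ≠ s j := fun i j hij => by
    let L : (Fin k → ℝ) →ₗ[ℝ] ℝ :=
      (LinearMap.proj i : (Fin k → ℝ) →ₗ[ℝ] ℝ) - LinearMap.proj j
    have h1 : LinearMap.ker L ≠ ⊤ := fun h2 => by
      have h3 : (Pi.single i 1 : Fin k → ℝ) ∈ LinearMap.ker L := h2 ▸ Submodule.mem_top
      simp [L, hij.symm] at h3
    have h4 := Measure.addHaar_submodule volume _ h1
    refine (measure_eq_zero_iff_ae_notMem.1 h4).mono fun s hs h5 => hs ?_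
    simp [L, h5]
  have h2 : ∀ᵐ s : Fin k → ℝ, ∀ i j : Fin k, i ≠ j → s i ≠ s j := by
    rw [ae_all_iff]; intro i
    rw [ae_all_iff]; intro j
    by_cases hij : i = j
    · simp [hij]
    · simpa [hij] using h i j hij
  exact h2.mono fun s hs i j hij => by_contra fun hne => hs i j hne hij

lemma lintegral_comp_perm {k : ℕ} (σ : Equiv.Perm (Fin k)) {F : (Fin k → ℝ) → ℝ≥0∞}
    (hF : Measurable F) : ∫⁻ s : Fin k → ℝ, F (s ∘ σ) = ∫⁻ s, F s := by
  have h := volume_measurePreserving_piCongrLeft (fun _ : Fin k => ℝ) σ.symm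
  rw [← h.lintegral_comp hF]
  refine lintegral_congr fun s => congrArg F (funext fun i => ?_)
  have := Equiv.piCongrLeft_apply_apply (P := fun _ : Fin k => ℝ) σ.symm s (σ i)
  rw [Equiv.symm_apply_apply] at this
  exact this.symm

lemma existsUnique_perm_strictMono {k : ℕ} {s : Fin k → ℝ} (hs : Function.Injective s) :
    ∃! σ : Equiv.Perm (Fin k), StrictMono (s ∘ σ) := by
  refine ⟨Tuple.sort s, (Tuple.monotone_sort s).strictMono_of_injective
    (hs.comp (Tuple.sort s).injective), fun σ hσ => ?_⟩
  refine Tuple.eq_sort_iff.2 ⟨hσ.monotone, fun i j hij h => ?_⟩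
  exact absurd h (hσ hij).ne

/-- The integral of a symmetric function is `k!` times its integral over increasing tuples. -/
lemma lintegral_eq_factorial_mul {k : ℕ} {F : (Fin k → ℝ) → ℝ≥0∞} (hF : Measurable F)
    (hsymm : ∀ (σ : Equiv.Perm (Fin k)) s, F (s ∘ σ) = F s) :
    ∫⁻ s, F s = (k.factorial : ℝ≥0∞) * ∫⁻ s in {s | StrictMono s}, F s := by
  have hM : MeasurableSet {s : Fin k → ℝ | StrictMono s} := by
    simpa [orderedTuples] using measurableSet_orderedTuples k MeasurableSet.univ
  -- Almost every tuple is sorted by exactly one permutation, so exactly one summand is nonzero, and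
  -- symmetry makes it `F s`.
  have h1 : ∀ᵐ s : Fin k → ℝ, F s =
      ∑ σ : Equiv.Perm (Fin k), {s : Fin k → ℝ | StrictMono s}.indicator F (s ∘ σ) := by
    filter_upwards [ae_injective k] with s hs
    obtain ⟨σ, hσ, huniq⟩ := existsUnique_perm_strictMono hs
    rw [Finset.sum_eq_single σ]
    · rw [Set.indicator_of_mem hσ, hsymm]
    · intro τ _ hτ
      exact Set.indicator_of_notMem (fun h => hτ (huniq τ h)) _
    · simp
  have hm : ∀ σ : Equiv.Perm (Fin k), Measurable fun s : Fin k → ℝ =>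
      {s : Fin k → ℝ | StrictMono s}.indicator F (s ∘ σ) := fun σ =>
    (hF.indicator hM).comp (measurable_pi_lambda _ fun i => measurable_pi_apply (σ i))
  rw [lintegral_congr_ae h1, lintegral_finsetSum _ fun σ _ => hm σ]
  simp_rw [lintegral_comp_perm _ (hF.indicator hM), lintegral_indicator hM]
  simp [Fintype.card_perm]

/-- The `k`-th moment of an occupation integral as an integral over increasing tuples of times. -/
lemma lintegral_pow_occupation {Ω E : Type*} [MeasurableSpace Ω] [MeasurableSpace E]
    (P : Measure Ω) [SFinite P] {X : ℝ → Ω → E} (hX : Measurable (Function.uncurry X))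
    {f : E → ℝ≥0∞} (hf : Measurable f) {I : Set ℝ} (hI : MeasurableSet I) (k : ℕ) :
    ∫⁻ ω, (∫⁻ s in I, f (X s ω)) ^ k ∂P =
      (k.factorial : ℝ≥0∞) * ∫⁻ s in orderedTuples k I, ∫⁻ ω, ∏ i, f (X (s i) ω) ∂P := by
  have hXs : ∀ ω, Measurable fun s => f (X s ω) := fun ω =>
    hf.comp (hX.comp measurable_prodMk_right)
  have h1 : ∀ ω, (∫⁻ s in I, f (X s ω)) ^ k =
      ∫⁻ s : Fin k → ℝ, ∏ i, I.indicator (fun s => f (X s ω)) (s i) := fun ω => by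
    rw [lintegral_prod_eq_pow ((hXs ω).indicator hI), lintegral_indicator hI]
  have hm : Measurable fun p : Ω × (Fin k → ℝ) =>
      ∏ i, I.indicator (fun s => f (X s p.1)) (p.2 i) := by
    refine Finset.measurable_fun_prod _ fun i _ => ?_
    have h2 : Measurable fun q : ℝ × Ω => (I ×ˢ Set.univ).indicator
        (fun q : ℝ × Ω => f (X q.1 q.2)) q := (hf.comp hX).indicator (hI.prod MeasurableSet.univ)
    have h3 := h2.comp (by fun_prop : Measurable fun p : Ω × (Fin k → ℝ) => (p.2 i, p.1))
    convert! h3 using 2 with p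
    by_cases hp : p.2 i ∈ I <;> simp [hp]
  simp_rw [h1]
  rw [lintegral_lintegral_swap hm.aemeasurable,
    lintegral_eq_factorial_mul hm.lintegral_prod_left']
  · congr 1
    have hM : MeasurableSet {s : Fin k → ℝ | StrictMono s} := by
      simpa [orderedTuples] using measurableSet_orderedTuples k MeasurableSet.univ
    rw [← lintegral_indicator hM, ← lintegral_indicator (measurableSet_orderedTuples k hI)]
    refine lintegral_congr fun s => ?_
    by_cases hs : StrictMono s
    · by_cases hsI : ∀ i, s i ∈ I
      · rw [Set.indicator_of_mem (show s ∈ {s | StrictMono s} from hs),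
          Set.indicator_of_mem (show s ∈ orderedTuples k I from ⟨hs, hsI⟩)]
        refine lintegral_congr fun ω => Finset.prod_congr rfl fun i _ => ?_
        rw [Set.indicator_of_mem (hsI i)]
      · rw [Set.indicator_of_mem (show s ∈ {s | StrictMono s} from hs),
          Set.indicator_of_notMem (show s ∉ orderedTuples k I from fun h => hsI h.2)]
        push Not at hsI
        obtain ⟨i, hi⟩ := hsI
        refine lintegral_eq_zero_of_ae_eq_zero (ae_of_all _ fun ω => ?_)
        exact Finset.prod_eq_zero (Finset.mem_univ i) (Set.indicator_of_notMem hi _)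
    · rw [Set.indicator_of_notMem (show s ∉ {s | StrictMono s} from hs),
        Set.indicator_of_notMem (show s ∉ orderedTuples k I from fun h => hs h.1)]
  · intro σ s
    refine lintegral_congr fun ω => ?_
    exact Equiv.prod_comp σ fun i => I.indicator (fun s => f (X s ω)) (s i)

end OrderedTuples

/-! ### Chains of heat kernels integrated over increasing times. -/

section Chains

variable {d : ℕ} {f : EuclideanSpace ℝ (Fin d) → ℝ≥0∞}

/-- The iterated integral of `f` along the chain of heat kernels from `x` at time `a` through the
successive times `s`, with a terminal factor `e` evaluated at the last time and position. -/
noncomputable def heatChain (f : EuclideanSpace ℝ (Fin d) → ℝ≥0∞)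
    (e : ℝ → EuclideanSpace ℝ (Fin d) → ℝ≥0∞) :
    (k : ℕ) → (Fin k → ℝ) → ℝ → EuclideanSpace ℝ (Fin d) → ℝ≥0∞
  | 0, _, a, x => e a x
  | k + 1, s, a, x => heatOp f (heatChain f e k (Fin.tail s) (s 0)) (s 0 - a) x

variable {e : ℝ → EuclideanSpace ℝ (Fin d) → ℝ≥0∞}

lemma measurable_heatChain (hf : Measurable f) (he : Measurable (Function.uncurry e)) (k : ℕ) :
    Measurable fun p : (Fin k → ℝ) × ℝ × EuclideanSpace ℝ (Fin d) =>
      heatChain f e k p.1 p.2.1 p.2.2 := by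
  induction k with
  | zero => exact he.comp measurable_snd
  | succ k ih =>
    have h1 : Measurable fun q : ((Fin (k + 1) → ℝ) × ℝ × EuclideanSpace ℝ (Fin d)) ×
        EuclideanSpace ℝ (Fin d) => heatChain f e k (Fin.tail q.1.1) (q.1.1 0) q.2 :=
      ih.comp (by
        unfold Fin.tail
        fun_prop : Measurable fun q : ((Fin (k + 1) → ℝ) × ℝ × EuclideanSpace ℝ (Fin d)) ×
        EuclideanSpace ℝ (Fin d) => (Fin.tail q.1.1, q.1.1 0, q.2))
    have h2 : Measurable fun q : ((Fin (k + 1) → ℝ) × ℝ × EuclideanSpace ℝ (Fin d)) ×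
        EuclideanSpace ℝ (Fin d) => heatDensity (q.1.1 0 - q.1.2.1) (q.2 - q.1.2.2) *
          (f q.2 * heatChain f e k (Fin.tail q.1.1) (q.1.1 0) q.2) := by fun_prop
    exact h2.lintegral_prod_right'

lemma measurable_heatChain_left (hf : Measurable f) (he : Measurable (Function.uncurry e)) (k : ℕ)
    (a : ℝ) (x : EuclideanSpace ℝ (Fin d)) : Measurable fun s => heatChain f e k s a x :=
  (measurable_heatChain hf he k).comp (by fun_prop : Measurable fun s : Fin k → ℝ => (s, a, x))

lemma setLIntegral_heatChain_succ (hf : Measurable f) (he : Measurable (Function.uncurry e))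
    {k : ℕ} (a : ℝ) {D : Set ℝ} (hD : MeasurableSet D) (x : EuclideanSpace ℝ (Fin d)) :
    ∫⁻ s in orderedTuples (k + 1) (Set.Ioi a ∩ D), heatChain f e (k + 1) s a x =
      ∫⁻ u in Set.Ioi a ∩ D, heatOp f
        (fun w => ∫⁻ s in orderedTuples k (Set.Ioi u ∩ D), heatChain f e k s u w) (u - a) x := by
  rw [setLIntegral_orderedTuples_succ a hD (measurable_heatChain_left hf he (k + 1) a x)]
  refine lintegral_congr fun u => ?_
  have hc := measurable_heatChain hf he k
  have h1 : Measurable fun q : (Fin k → ℝ) × EuclideanSpace ℝ (Fin d) =>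
      heatChain f e k q.1 u q.2 :=
    hc.comp (by fun_prop : Measurable fun q : (Fin k → ℝ) × EuclideanSpace ℝ (Fin d) =>
      (q.1, u, q.2))
  simp only [heatChain, Fin.tail_cons, Fin.cons_zero]
  unfold heatOp
  rw [lintegral_lintegral_swap]
  · refine lintegral_congr fun w => ?_
    have h2 : Measurable fun s => heatChain f e k s u w := h1.comp measurable_prodMk_right
    rw [lintegral_const_mul _ (h2.const_mul _), lintegral_const_mul _ h2]
  · have h3 : Measurable fun q : (Fin k → ℝ) × EuclideanSpace ℝ (Fin d) =>
        heatDensity (u - a) (q.2 - x) * (f q.2 * heatChain f e k q.1 u q.2) :=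
      (by fun_prop : Measurable fun q : (Fin k → ℝ) × EuclideanSpace ℝ (Fin d) =>
        heatDensity (u - a) (q.2 - x)).mul ((hf.comp measurable_snd).mul h1)
    exact h3.aemeasurable

/-- The initial time `a` is arbitrary because the tail of a chain starts at its own first time;
translation invariance in time removes `a` from the answer. `setLIntegral_heatChain_bridge` follows
the same scheme with a terminal kernel. -/
lemma setLIntegral_heatChain_one (hf : Measurable f) (k : ℕ) (a : ℝ)
    (x : EuclideanSpace ℝ (Fin d)) :
    ∫⁻ s in orderedTuples k (Set.Ioi a ∩ Set.univ), heatChain f (fun _ _ => 1) k s a x =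
      greenIter f k x := by
  induction k generalizing a x with
  | zero =>
    have : orderedTuples 0 (Set.Ioi a ∩ Set.univ) = Set.univ := by
      ext s
      simp [orderedTuples, Subsingleton.strictMono]
    rw [this]
    simp [heatChain, greenIter, volume_univ_fin_zero]
  | succ k ih =>
    rw [setLIntegral_heatChain_succ hf measurable_const a MeasurableSet.univ]
    simp_rw [ih]
    rw [Set.inter_univ, greenIter, greenOp, ← lintegral_indicator measurableSet_Ioi,
      ← lintegral_indicator measurableSet_Ioi, ← lintegral_sub_right_eq_self
        ((Set.Ioi 0).indicator _) a]
    refine lintegral_congr fun u => ?_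
    simp [Set.indicator]

lemma setLIntegral_heatChain_bridge (hf : Measurable f) (k : ℕ) (a t : ℝ)
    (x y : EuclideanSpace ℝ (Fin d)) :
    ∫⁻ s in orderedTuples k (Set.Ioi a ∩ Set.Iio t),
      heatChain f (fun u w => heatDensity (t - u) (y - w)) k s a x =
      bridgeIter f y k (t - a) x := by
  induction k generalizing a x with
  | zero =>
    have : orderedTuples 0 (Set.Ioi a ∩ Set.Iio t) = Set.univ := by
      ext s
      simp [orderedTuples, Subsingleton.strictMono]
    rw [this]
    simp [heatChain, bridgeIter, volume_univ_fin_zero]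
  | succ k ih =>
    rw [setLIntegral_heatChain_succ hf (by unfold Function.uncurry; fun_prop) a measurableSet_Iio]
    simp_rw [ih]
    rw [bridgeIter, Set.Ioi_inter_Iio, ← lintegral_indicator measurableSet_Ioo,
      ← lintegral_indicator measurableSet_Ioo, ← lintegral_sub_right_eq_self
        ((Set.Ioo 0 (t - a)).indicator _) a]
    refine lintegral_congr fun u => ?_
    simp [Set.indicator]

end Chains

/-! ### Moment formulas for Brownian motion and for the bridge. -/

section Processes

variable {d : ℕ} {f : EuclideanSpace ℝ (Fin d) → ℝ≥0∞}

/-- Joint measurability is what allows time integrals and expectations to be exchanged. Paths are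
kept on a measurable set of full measure where they are continuous and agree with measurable
versions at a dense sequence of indices, and are set to zero elsewhere. -/
lemma exists_measurable_modification {ι Ω E : Type*} [TopologicalSpace ι]
    [TopologicalSpace.MetrizableSpace ι] [SecondCountableTopology ι] [Nonempty ι]
    [MeasurableSpace ι] [OpensMeasurableSpace ι] [MeasurableSpace Ω] {P : Measure Ω}
    [TopologicalSpace E] [TopologicalSpace.PseudoMetrizableSpace E] [MeasurableSpace E]
    [BorelSpace E] [Zero E] {X : ι → Ω → E} (hX : ∀ i, AEMeasurable (X i) P)
    (hc : ∀ᵐ ω ∂P, Continuous fun i => X i ω) :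
    ∃ X' : ι → Ω → E, Measurable (Function.uncurry X') ∧ ∀ᵐ ω ∂P, ∀ i, X' i ω = X i ω := by
  let D := TopologicalSpace.denseSeq ι
  have h1 : ∀ᵐ ω ∂P, (∀ n, X (D n) ω = (hX (D n)).mk _ ω) ∧ Continuous fun i => X i ω :=
    (ae_all_iff.2 fun n => (hX (D n)).ae_eq_mk).and hc
  obtain ⟨G, hG, hGm, hGp⟩ := h1.exists_measurable_mem
  refine ⟨fun i => G.indicator (X i), ?_, ?_⟩
  · refine measurable_uncurry_of_continuous_of_measurable (fun ω => ?_) fun i => ?_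
    · by_cases hω : ω ∈ G
      · simpa [hω] using (hGp ω hω).2
      · simpa [hω] using continuous_const
    · have hi : i ∈ closure (Set.range D) := TopologicalSpace.denseRange_denseSeq ι i
      obtain ⟨u, hu, hui⟩ := mem_closure_iff_seq_limit.1 hi
      choose n hn using hu
      refine measurable_of_tendsto_metrizable
        (f := fun m => G.indicator ((hX (D (n m))).mk _))
        (fun m => (hX (D (n m))).measurable_mk.indicator hGm) ?_
      rw [tendsto_pi_nhds]
      intro ω
      by_cases hω : ω ∈ G
      · simp only [Set.indicator_of_mem hω]
        simp_rw [← (hGp ω hω).1, hn]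
        exact ((hGp ω hω).2.tendsto i).comp hui
      · simpa only [Set.indicator_of_notMem hω] using tendsto_const_nhds
  · filter_upwards [hG] with ω hω i
    simp [Set.indicator_of_mem hω]

lemma measurable_finPartialSum {k : ℕ} (i : Fin (k + 1)) :
    Measurable fun D : Fin k → EuclideanSpace ℝ (Fin d) => Fin.partialSum D i := by
  induction i using Fin.induction with
  | zero => simp
  | succ i ih =>
    simp_rw [Fin.partialSum_succ]
    exact ih.add (measurable_pi_apply i)

instance sigmaFinite_withDensity_heatDensity (t : ℝ) :
    SigmaFinite ((volume : Measure (EuclideanSpace ℝ (Fin d))).withDensity (heatDensity t)) :=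
  SigmaFinite.withDensity_ofReal (heatKernel t)

/-- Positions are partial sums of increments. Peeling off the first increment moves the starting
point to `x + w`, and translating by `x` turns the increment variable into the position variable of
`heatOp`. -/
lemma lintegral_pi_increments (hf : Measurable f) (k : ℕ) (s : Fin k → ℝ) (a : ℝ)
    (x : EuclideanSpace ℝ (Fin d)) :
    ∫⁻ D : Fin k → EuclideanSpace ℝ (Fin d), ∏ i : Fin k, f (x + Fin.partialSum D i.succ)
      ∂(Measure.pi fun i : Fin k => volume.withDensity
        (heatDensity ((Fin.cons a s : Fin (k + 1) → ℝ) i.succ -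
          (Fin.cons a s : Fin (k + 1) → ℝ) i.castSucc))) =
      heatChain f (fun _ _ => 1) k s a x := by
  induction k generalizing a x with
  | zero => simp [heatChain, Measure.pi_empty_univ]
  | succ k ih =>
    have hm : ∀ (n : ℕ) (z : EuclideanSpace ℝ (Fin d)),
        Measurable fun D : Fin n → EuclideanSpace ℝ (Fin d) =>
          ∏ i : Fin n, f (z + Fin.partialSum D i.succ) := fun n z =>
      Finset.measurable_fun_prod _ fun i _ =>
        hf.comp ((measurable_finPartialSum i.succ).const_add z)
    rw [lintegral_pi_fin_succ _ (hm _ _)]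
    have hμ : (fun j : Fin k => (volume : Measure (EuclideanSpace ℝ (Fin d))).withDensity
        (heatDensity ((Fin.cons a s : Fin (k + 2) → ℝ) j.succ.succ -
          (Fin.cons a s : Fin (k + 2) → ℝ) j.succ.castSucc))) =
        fun j : Fin k => volume.withDensity
        (heatDensity ((Fin.cons (s 0) (Fin.tail s) : Fin (k + 1) → ℝ) j.succ -
          (Fin.cons (s 0) (Fin.tail s) : Fin (k + 1) → ℝ) j.castSucc)) := by
      ext1 j
      rw [← Fin.succ_castSucc, Fin.cons_succ, Fin.cons_succ, Fin.cons_self_tail]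
    have h1 : ∀ w (D : Fin k → EuclideanSpace ℝ (Fin d)),
        ∏ i : Fin (k + 1), f (x + Fin.partialSum (Fin.cons w D : Fin (k + 1) → _) i.succ) =
          f (x + w) * ∏ i : Fin k, f ((x + w) + Fin.partialSum D i.succ) := fun w D => by
      rw [Fin.prod_univ_succ]
      simp_rw [Fin.partialSum_succ', Fin.cons_zero, Fin.tail_cons, Fin.partialSum_zero, add_zero,
        add_assoc]
    simp_rw [h1]
    rw [hμ]
    have h2 : ∀ w, ∫⁻ D : Fin k → EuclideanSpace ℝ (Fin d),
        f (x + w) * ∏ i : Fin k, f ((x + w) + Fin.partialSum D i.succ)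
        ∂(Measure.pi fun j : Fin k => volume.withDensity
        (heatDensity ((Fin.cons (s 0) (Fin.tail s) : Fin (k + 1) → ℝ) j.succ -
          (Fin.cons (s 0) (Fin.tail s) : Fin (k + 1) → ℝ) j.castSucc))) =
        f (x + w) * heatChain f (fun _ _ => 1) k (Fin.tail s) (s 0) (x + w) := fun w => by
      rw [lintegral_const_mul _ (hm _ _), ih]
    simp_rw [h2]
    have hcm : Measurable fun w => heatChain f (fun _ _ => 1) k (Fin.tail s) (s 0) w :=
      (measurable_heatChain hf (e := fun _ _ => 1) measurable_const k).comp
        (by fun_prop : Measurable fun w : EuclideanSpace ℝ (Fin d) => (Fin.tail s, s 0, w))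
    have hgm : Measurable fun w => f (x + w) *
        heatChain f (fun _ _ => 1) k (Fin.tail s) (s 0) (x + w) :=
      (hf.mul hcm).comp (measurable_const_add x)
    rw [lintegral_withDensity_eq_lintegral_mul _ (by fun_prop) hgm]
    have h3 : (Fin.cons a s : Fin (k + 2) → ℝ) (Fin.succ 0) -
        (Fin.cons a s : Fin (k + 2) → ℝ) (Fin.castSucc 0) = s 0 - a := by
      rw [Fin.cons_succ, Fin.castSucc_zero, Fin.cons_zero]
    rw [h3, heatChain, heatOp, ← lintegral_sub_right_eq_self _ x]
    refine lintegral_congr fun w => ?_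
    simp

namespace IsBrownianMotionFrom

variable {Ω : Type*} [MeasurableSpace Ω] {P : Measure Ω} [IsProbabilityMeasure P]
  {x : EuclideanSpace ℝ (Fin d)} {W : ℝ≥0 → Ω → EuclideanSpace ℝ (Fin d)}
  (hW : IsBrownianMotionFrom x W P)
include hW

omit [IsProbabilityMeasure P] in
lemma aemeasurable (t : ℝ≥0) : AEMeasurable (W t) P := by
  have h0 : AEMeasurable (W 0) P := (aemeasurable_const (b := x)).congr (by
    filter_upwards [hW.start] with ω hω using hω.symm)
  rcases eq_or_ne t 0 with rfl | ht
  · exact h0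
  · have h := (hW.increments 0 t (pos_iff_ne_zero.2 ht)).aemeasurable.add h0
    refine h.congr (ae_of_all _ fun ω => ?_)
    simp

omit [IsProbabilityMeasure P] in
lemma exists_measurable : ∃ X : ℝ → Ω → EuclideanSpace ℝ (Fin d),
    Measurable (Function.uncurry X) ∧ ∀ᵐ ω ∂P, ∀ s, X s ω = W s.toNNReal ω := by
  obtain ⟨X, hX, hXW⟩ := exists_measurable_modification hW.aemeasurable hW.cont
  refine ⟨fun s => X s.toNNReal, ?_, ?_⟩
  · exact hX.comp (by fun_prop : Measurable fun p : ℝ × Ω => (p.1.toNNReal, p.2))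
  · filter_upwards [hXW] with ω hω s using hω _

omit [IsProbabilityMeasure P] in
lemma lintegral_prod_eq (hf : Measurable f) {k : ℕ} {s : Fin k → ℝ}
    (hs : s ∈ orderedTuples k (Set.Ioi 0 ∩ Set.univ)) :
    ∫⁻ ω, ∏ i, f (W (s i).toNNReal ω) ∂P = heatChain f (fun _ _ => 1) k s 0 x := by
  -- Time `0` is prepended so that the first increment starts from the known value `x`.
  let S : Fin (k + 1) → ℝ := Fin.cons 0 s
  have hS : StrictMono S := Fin.strictMono_cons.2 ⟨fun i => (hs.2 i).1, hs.1⟩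
  have hS0 : ∀ i, 0 ≤ S i := fun i => hS.monotone (Fin.zero_le i)
  let τ : Fin (k + 1) → ℝ≥0 := fun i => (S i).toNNReal
  have hlt : ∀ i : Fin k, τ i.castSucc < τ i.succ := fun i =>
    (Real.toNNReal_lt_toNNReal_iff ((hS0 _).trans_lt (hS (Fin.castSucc_lt_succ (i := i))))).2
      (hS (Fin.castSucc_lt_succ (i := i)))
  have hτ : Monotone τ := fun i j hij => Real.toNNReal_le_toNNReal (hS.monotone hij)
  have hlaw := iIndepFun.hasLaw_pi (fun i : Fin k => hW.increments _ _ (hlt i))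
    (hW.indep k τ hτ)
  have hcoe : ∀ i, ((τ i : ℝ≥0) : ℝ) = S i := fun i => Real.coe_toNNReal _ (hS0 i)
  simp only [hcoe] at hlaw
  have hm : Measurable fun D : Fin k → EuclideanSpace ℝ (Fin d) =>
      ∏ i : Fin k, f (x + Fin.partialSum D i.succ) :=
    Finset.measurable_fun_prod _ fun i _ =>
      hf.comp ((measurable_finPartialSum i.succ).const_add x)
  have h1 := hlaw.lintegral_comp (f := fun D => ∏ i : Fin k, f (x + Fin.partialSum D i.succ))
    hm.aemeasurable
  rw [← lintegral_pi_increments hf k s 0 x]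
  refine Eq.trans (lintegral_congr_ae ?_) h1
  filter_upwards [hW.start] with ω hω
  have h2 : ∀ j : Fin (k + 1), W (τ j) ω =
      x + Fin.partialSum (fun i : Fin k => W (τ i.succ) ω - W (τ i.castSucc) ω) j := fun j => by
    induction j using Fin.induction with
    | zero => simp [τ, S, hω]
    | succ j ih =>
      rw [Fin.partialSum_succ, ← add_assoc, ← ih]
      simp
  refine Finset.prod_congr rfl fun i _ => ?_
  rw [← h2]
  simp [τ, S]

/-- Kac's moment formula: the factor `k!` counts the orderings of the times, and each increasing
tuple contributes a chain of heat kernels. -/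
lemma lintegral_pow_eq (hf : Measurable f) (k : ℕ) :
    ∫⁻ ω, (∫⁻ s in Set.Ioi (0 : ℝ), f (W s.toNNReal ω)) ^ k ∂P =
      (k.factorial : ℝ≥0∞) * greenIter f k x := by
  obtain ⟨X, hX, hXW⟩ := hW.exists_measurable
  have h1 : ∫⁻ ω, (∫⁻ s in Set.Ioi (0 : ℝ), f (W s.toNNReal ω)) ^ k ∂P =
      ∫⁻ ω, (∫⁻ s in Set.Ioi (0 : ℝ) ∩ Set.univ, f (X s ω)) ^ k ∂P := by
    refine lintegral_congr_ae ?_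
    filter_upwards [hXW] with ω hω
    simp [hω]
  rw [h1, lintegral_pow_occupation P hX hf (measurableSet_Ioi.inter MeasurableSet.univ),
    ← setLIntegral_heatChain_one hf k 0 x]
  congr 1
  refine setLIntegral_congr_fun
    (measurableSet_orderedTuples k (measurableSet_Ioi.inter MeasurableSet.univ)) fun s hs => ?_
  rw [← hW.lintegral_prod_eq hf hs]
  refine lintegral_congr_ae ?_
  filter_upwards [hXW] with ω hω
  simp [hω]

end IsBrownianMotionFrom

/-- The product of the heat kernels along a path with prescribed endpoints. -/
noncomputable def chainDensity {k : ℕ} (a : ℝ) (s : Fin k → ℝ) (t : ℝ)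
    (x : EuclideanSpace ℝ (Fin d)) (z : Fin k → EuclideanSpace ℝ (Fin d))
    (y : EuclideanSpace ℝ (Fin d)) : ℝ≥0∞ :=
  ∏ j : Fin (k + 1), heatDensity
    ((Fin.cons a (Fin.snoc s t : Fin (k + 1) → ℝ) : Fin (k + 2) → ℝ) j.succ -
      (Fin.cons a (Fin.snoc s t : Fin (k + 1) → ℝ) : Fin (k + 2) → ℝ) j.castSucc)
    ((Fin.cons x (Fin.snoc z y : Fin (k + 1) → EuclideanSpace ℝ (Fin d)) :
      Fin (k + 2) → EuclideanSpace ℝ (Fin d)) j.succ -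
      (Fin.cons x (Fin.snoc z y : Fin (k + 1) → EuclideanSpace ℝ (Fin d)) :
      Fin (k + 2) → EuclideanSpace ℝ (Fin d)) j.castSucc)

lemma chainDensity_cons {k : ℕ} (a : ℝ) (s : Fin (k + 1) → ℝ) (t : ℝ)
    (x w : EuclideanSpace ℝ (Fin d)) (z : Fin k → EuclideanSpace ℝ (Fin d))
    (y : EuclideanSpace ℝ (Fin d)) :
    chainDensity a s t x (Fin.cons w z : Fin (k + 1) → EuclideanSpace ℝ (Fin d)) y =
      heatDensity (s 0 - a) (w - x) * chainDensity (s 0) (Fin.tail s) t w z y := by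
  obtain ⟨u, s, rfl⟩ : ∃ u s', s = Fin.cons u s' := ⟨_, _, (Fin.cons_self_tail s).symm⟩
  unfold chainDensity
  rw [Fin.prod_univ_succ]
  simp only [← Fin.cons_snoc_eq_snoc_cons, Fin.tail_cons, Fin.cons_zero, Fin.cons_succ,
    Fin.castSucc_zero, ← Fin.succ_castSucc]

lemma chainDensity_zero (a : ℝ) (s : Fin 0 → ℝ) (t : ℝ) (x y : EuclideanSpace ℝ (Fin d))
    (z : Fin 0 → EuclideanSpace ℝ (Fin d)) :
    chainDensity a s t x z y = heatDensity (t - a) (y - x) := by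
  simp [chainDensity, Fin.snoc]

lemma measurable_chainDensity {k : ℕ} (a : ℝ) (s : Fin k → ℝ) (t : ℝ)
    (x y : EuclideanSpace ℝ (Fin d)) : Measurable fun z => chainDensity a s t x z y := by
  have h1 : ∀ j : Fin (k + 1), Measurable fun z : Fin k → EuclideanSpace ℝ (Fin d) =>
      (Fin.snoc z y : Fin (k + 1) → EuclideanSpace ℝ (Fin d)) j := fun j => by
    refine Fin.lastCases ?_ (fun i => ?_) j
    · simp
    · simpa using measurable_pi_apply i
  have h2 : ∀ j : Fin (k + 2), Measurable fun z : Fin k → EuclideanSpace ℝ (Fin d) =>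
      (Fin.cons x (Fin.snoc z y : Fin (k + 1) → EuclideanSpace ℝ (Fin d)) :
        Fin (k + 2) → EuclideanSpace ℝ (Fin d)) j := fun j => by
    refine Fin.cases ?_ (fun i => ?_) j
    · simp
    · simpa using h1 i
  exact Finset.measurable_fun_prod _ fun j _ =>
    measurable_const.heatDensity ((h2 j.succ).sub (h2 j.castSucc))

lemma lintegral_chainDensity (hf : Measurable f) (k : ℕ) (s : Fin k → ℝ) (a t : ℝ)
    (x y : EuclideanSpace ℝ (Fin d)) :
    ∫⁻ z : Fin k → EuclideanSpace ℝ (Fin d), chainDensity a s t x z y * ∏ i, f (z i) =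
      heatChain f (fun u w => heatDensity (t - u) (y - w)) k s a x := by
  induction k generalizing a x with
  | zero =>
    have : volume (Set.univ : Set (Fin 0 → EuclideanSpace ℝ (Fin d))) = 1 := by
      rw [volume_pi, Measure.pi_empty_univ]
    simp [chainDensity_zero, heatChain, this]
  | succ k ih =>
    have hm : ∀ (n : ℕ) (s : Fin n → ℝ) (b : ℝ) (w : EuclideanSpace ℝ (Fin d)),
        Measurable fun z : Fin n → EuclideanSpace ℝ (Fin d) =>
          chainDensity b s t w z y * ∏ i, f (z i) := fun n s b w =>
      (measurable_chainDensity b s t w y).mul (by fun_prop)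
    rw [volume_pi, lintegral_pi_fin_succ _ (hm _ _ _ _), heatChain, heatOp]
    refine lintegral_congr fun w => ?_
    rw [← ih, ← volume_pi, ← mul_assoc, ← lintegral_const_mul _ (hm _ _ _ _)]
    refine lintegral_congr fun z => ?_
    rw [chainDensity_cons, Fin.prod_univ_succ]
    simp only [Fin.cons_zero, Fin.cons_succ]
    ring

namespace IsBrownianBridge

variable {Ω : Type*} [MeasurableSpace Ω] {P : Measure Ω} [IsProbabilityMeasure P] {t : ℝ}
  {x y : EuclideanSpace ℝ (Fin d)} {X : ℝ → Ω → EuclideanSpace ℝ (Fin d)}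

omit [IsProbabilityMeasure P] in
lemma aemeasurable (hX : IsBrownianBridge t x y X P) {s : ℝ} (hs : s ∈ Set.Icc 0 t) :
    AEMeasurable (X s) P := by
  rcases eq_or_ne s 0 with rfl | h0
  · refine (aemeasurable_const (b := x)).congr ?_
    filter_upwards [hX.start] with ω hω using hω.symm
  rcases eq_or_ne s t with rfl | h1
  · refine (aemeasurable_const (b := y)).congr ?_
    filter_upwards [hX.finish] with ω hω using hω.symm
  have h := (hX.fdd 1 (fun _ => s) (Subsingleton.strictMono _) fun _ =>
    ⟨lt_of_le_of_ne hs.1 h0.symm, lt_of_le_of_ne hs.2 h1⟩).aemeasurable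
  exact aemeasurable_pi_iff.1 h 0

omit [IsProbabilityMeasure P] in
lemma exists_measurable (hX : IsBrownianBridge t x y X P) (ht : 0 < t) :
    ∃ X' : ℝ → Ω → EuclideanSpace ℝ (Fin d),
    Measurable (Function.uncurry X') ∧ ∀ᵐ ω ∂P, ∀ s ∈ Set.Icc 0 t, X' s ω = X s ω := by
  have : Nonempty (Set.Icc 0 t) := ⟨⟨0, le_rfl, ht.le⟩⟩
  obtain ⟨X', hX', hXX⟩ := exists_measurable_modification (ι := Set.Icc 0 t)
    (X := fun s => X s) (P := P) (fun s => hX.aemeasurable s.2) (by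
      filter_upwards [hX.cont] with ω hω using hω.domRestrict)
  -- Projecting time onto the interval freezes the path outside it, where its values do not matter.
  refine ⟨fun s => X' (Set.projIcc 0 t ht.le s), ?_, ?_⟩
  · exact hX'.comp (((continuous_projIcc (h := ht.le)).measurable.comp measurable_fst).prodMk measurable_snd)
  · filter_upwards [hXX] with ω hω s hs
    rw [hω, Set.projIcc_of_mem _ hs]

omit [IsProbabilityMeasure P] in
lemma lintegral_prod_eq (hX : IsBrownianBridge t x y X P) (ht : 0 < t) (hf : Measurable f) {k : ℕ}
    {s : Fin k → ℝ} (hs : s ∈ orderedTuples k (Set.Ioi 0 ∩ Set.Iio t)) :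
    ∫⁻ ω, ∏ i, f (X (s i) ω) ∂P =
      (heatDensity t (y - x))⁻¹ *
        heatChain f (fun u w => heatDensity (t - u) (y - w)) k s 0 x := by
  have hlaw := hX.fdd k s hs.1 hs.2
  have hpos : ∀ {u : ℝ} (z : EuclideanSpace ℝ (Fin d)), 0 ≤ u → 0 ≤ heatKernel u z :=
    fun z hu => by unfold heatKernel; positivity
  -- Increasing times give nonnegative gaps. This matters because the real power in `heatKernel` can
  -- be negative at negative times, and `ENNReal.ofReal` is multiplicative only on nonnegative
  -- factors.
  have hS : StrictMono (Fin.cons 0 (Fin.snoc s t : Fin (k + 1) → ℝ) : Fin (k + 2) → ℝ) := by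
    rw [Fin.strictMono_cons]
    constructor
    · intro j
      refine Fin.lastCases ?_ (fun i => ?_) j
      · simpa using ht
      · simpa using (hs.2 i).1
    · intro i j
      refine Fin.lastCases ?_ (fun i => ?_) i <;> refine Fin.lastCases ?_ (fun j => ?_) j
      · simp
      · intro h
        exact absurd h (not_lt.2 (Fin.le_last _))
      · intro _
        simpa using (hs.2 i).2
      · intro h
        simpa using hs.1 (Fin.castSucc_lt_castSucc_iff.1 h)
  have hden : ∀ z, ENNReal.ofReal (bridgeDensity t x y s z) =
      (heatDensity t (y - x))⁻¹ * chainDensity 0 s t x z y := fun z => by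
    unfold bridgeDensity
    have hk : 0 < heatKernel t (y - x) := by unfold heatKernel; positivity
    rw [ENNReal.ofReal_div_of_pos hk, ENNReal.ofReal_prod_of_nonneg, div_eq_mul_inv, mul_comm]
    · rfl
    · exact fun j _ => hpos _ (sub_nonneg.2 (hS (Fin.castSucc_lt_succ (i := j))).le)
  simp_rw [hden] at hlaw
  have hm := measurable_chainDensity 0 s t x y
  have hp : Measurable fun z : Fin k → EuclideanSpace ℝ (Fin d) => ∏ i, f (z i) := by fun_prop
  have h1 := hlaw.lintegral_comp (f := fun z => ∏ i, f (z i)) hp.aemeasurable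
  rw [h1, lintegral_withDensity_eq_lintegral_mul _ (hm.const_mul _) hp,
    ← lintegral_chainDensity hf,
    ← lintegral_const_mul' _ _ (ENNReal.inv_ne_top.2 (heatDensity_ne_zero ht _))]
  refine lintegral_congr fun z => ?_
  simp [mul_assoc]

lemma lintegral_pow_eq (hX : IsBrownianBridge t x y X P) (ht : 0 < t) (hf : Measurable f) (k : ℕ) :
    ∫⁻ ω, (∫⁻ s in Set.Ioo 0 t, f (X s ω)) ^ k ∂P =
      (k.factorial : ℝ≥0∞) * ((heatDensity t (y - x))⁻¹ * bridgeIter f y k t x) := by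
  obtain ⟨X', hX', hXX⟩ := hX.exists_measurable ht
  have hI : MeasurableSet (Set.Ioi 0 ∩ Set.Iio t) := measurableSet_Ioi.inter measurableSet_Iio
  have h1 : ∫⁻ ω, (∫⁻ s in Set.Ioo 0 t, f (X s ω)) ^ k ∂P =
      ∫⁻ ω, (∫⁻ s in Set.Ioi 0 ∩ Set.Iio t, f (X' s ω)) ^ k ∂P := by
    refine lintegral_congr_ae ?_
    filter_upwards [hXX] with ω hω
    rw [Set.Ioi_inter_Iio]
    congr 1
    exact setLIntegral_congr_fun measurableSet_Ioo fun s hs => by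
      simp only [hω s (Set.Ioo_subset_Icc_self hs)]
  have h2 : ∫⁻ s in orderedTuples k (Set.Ioi 0 ∩ Set.Iio t), ∫⁻ ω, ∏ i, f (X' (s i) ω) ∂P =
      ∫⁻ s in orderedTuples k (Set.Ioi 0 ∩ Set.Iio t), (heatDensity t (y - x))⁻¹ *
        heatChain f (fun u w => heatDensity (t - u) (y - w)) k s 0 x := by
    refine setLIntegral_congr_fun (measurableSet_orderedTuples k hI) fun s hs => ?_
    rw [← hX.lintegral_prod_eq ht hf hs]
    refine lintegral_congr_ae ?_
    filter_upwards [hXX] with ω hω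
    exact Finset.prod_congr rfl fun i _ => by
      rw [hω (s i) ⟨(hs.2 i).1.le, (hs.2 i).2.le⟩]
  rw [h1, lintegral_pow_occupation P hX' hf hI, h2,
    lintegral_const_mul' _ _ (ENNReal.inv_ne_top.2 (heatDensity_ne_zero ht _)),
    setLIntegral_heatChain_bridge hf, sub_zero]

end IsBrownianBridge

end Processes

/-! ### Dividing by the endpoint kernel: limits and uniform geometric bounds. -/

section Normalized

variable {d : ℕ} {f : EuclideanSpace ℝ (Fin d) → ℝ≥0∞} {K : ℝ≥0} {R : ℝ}
  {x y : ℝ → EuclideanSpace ℝ (Fin d)} {x₀ y₀ : EuclideanSpace ℝ (Fin d)}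

lemma inv_heatDensity {t : ℝ} (ht : 0 < t) (z : EuclideanSpace ℝ (Fin d)) :
    (heatDensity t z)⁻¹ =
      ENNReal.ofReal (Real.exp (‖z‖ ^ 2 / (2 * t))) * (heatPeak d t)⁻¹ := by
  rw [heatDensity_eq ht, ENNReal.mul_inv (Or.inl (heatPeak_ne_zero ht))
    (Or.inl (heatPeak_ne_top t)), ← ENNReal.ofReal_inv_of_pos (Real.exp_pos _), ← Real.exp_neg,
    mul_comm, neg_div, neg_neg]

lemma tendsto_exp_norm_sub (hx : Tendsto x atTop (𝓝 x₀)) (hy : Tendsto y atTop (𝓝 y₀)) :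
    Tendsto (fun t : ℝ => ENNReal.ofReal (Real.exp (‖y t - x t‖ ^ 2 / (2 * t)))) atTop (𝓝 1) := by
  have h1 : Tendsto (fun t : ℝ => ‖y t - x t‖ ^ 2 / (2 * t)) atTop (𝓝 0) :=
    ((hy.sub hx).norm.pow 2).div_atTop (tendsto_id.const_mul_atTop two_pos)
  have h2 := (ENNReal.continuous_ofReal.tendsto _).comp ((Real.continuous_exp.tendsto _).comp h1)
  simpa [Function.comp_def] using h2

namespace IsPotential

variable (hf : IsPotential f K R)
include hf

lemma tendsto_greenConv (hd : 3 ≤ d) (hx : Tendsto x atTop (𝓝 x₀)) (hy : Tendsto y atTop (𝓝 y₀))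
    (k : ℕ) : Tendsto (fun t => greenConv f k (x t) (y t)) atTop (𝓝 (greenConv f k x₀ y₀)) := by
  obtain ⟨M, -, hM, -⟩ := hf.exists_greenIter_le hd
  have hne : ∀ j z, greenIter f j z ≠ ∞ := fun j z => ((hM j z).trans_lt (by finiteness)).ne
  refine tendsto_finsetSum _ fun j _ => ENNReal.Tendsto.mul ?_ (Or.inr (hne _ _)) ?_
    (Or.inr (hne _ _))
  · exact ((hf.continuous_greenIter hd j).tendsto x₀).comp hx
  · exact ((hf.continuous_greenIter hd (k - j)).tendsto y₀).comp hy

lemma tendsto_bridgeIter (hd : 3 ≤ d) (hx : Tendsto x atTop (𝓝 x₀)) (hy : Tendsto y atTop (𝓝 y₀))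
    (k : ℕ) : Tendsto (fun t => (heatDensity t (y t - x t))⁻¹ * bridgeIter f (y t) k t (x t)) atTop
      (𝓝 (greenConv f k x₀ y₀)) := by
  have hL := hf.tendsto_greenConv hd hx hy k
  obtain ⟨C, hC, -⟩ := hf.exists_greenConv_le hd k
  have hne : greenConv f k x₀ y₀ ≠ ∞ := ((hC _ _).trans_lt (by finiteness)).ne
  -- The asymptotics are available relative to the peak; passing to `heatDensity t (y t - x t)`
  -- costs a factor tending to `1`.
  have hmain : Tendsto (fun t => (heatPeak d t)⁻¹ * bridgeIter f (y t) k t (x t)) atTop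
      (𝓝 (greenConv f k x₀ y₀)) := by
    rw [ENNReal.tendsto_nhds hne]
    intro ε hε
    -- One `δ` is spent on the approximation at time `t`, the other on moving the endpoints to their
    -- limits.
    obtain ⟨δ, hδ, hδε⟩ : ∃ δ : ℝ≥0, 0 < δ ∧ (δ : ℝ≥0∞) + δ ≤ ε := by
      rcases eq_or_ne ε ∞ with rfl | hε'
      · exact ⟨1, one_pos, le_top⟩
      · lift ε to ℝ≥0 using hε'
        refine ⟨ε / 2, half_pos (by exact_mod_cast hε), ?_⟩
        rw [← ENNReal.coe_add, add_halves]
    have h1 := (ENNReal.tendsto_nhds hne).1 hL δ (by exact_mod_cast hδ)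
    set R' := max R (max (‖x₀‖ + 1) (‖y₀‖ + 1)) with hR'
    obtain ⟨t₀, ht₀, happ⟩ := hf.eventually_bridgeIter_approx hd (le_max_left R _ : R ≤ R') k δ hδ
    have hxR : ∀ᶠ t in atTop, ‖x t‖ ≤ R' := by
      filter_upwards [hx.norm.eventually (gt_mem_nhds (lt_add_one ‖x₀‖))] with t ht
      exact ht.le.trans ((le_max_left _ _).trans (le_max_right _ _))
    have hyR : ∀ᶠ t in atTop, ‖y t‖ ≤ R' := by
      filter_upwards [hy.norm.eventually (gt_mem_nhds (lt_add_one ‖y₀‖))] with t ht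
      exact ht.le.trans ((le_max_right _ _).trans (le_max_right _ _))
    filter_upwards [h1, hxR, hyR, eventually_ge_atTop t₀] with t h2 hxt hyt htt
    have ht : 0 < t := ht₀.trans_le htt
    obtain ⟨h3, h4⟩ := happ t htt (x t) (y t) hxt hyt
    have hk0 := heatPeak_ne_zero (d := d) ht
    have hkt := heatPeak_ne_top (d := d) t
    have hcancel : ∀ a : ℝ≥0∞, (heatPeak d t)⁻¹ * (heatPeak d t * a) = a := fun a => by
      rw [← mul_assoc, ENNReal.inv_mul_cancel hk0 hkt, one_mul]
    constructor
    · have h5 := mul_le_mul_right h4 (heatPeak d t)⁻¹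
      rw [mul_add, hcancel, hcancel] at h5
      rw [tsub_le_iff_right]
      calc greenConv f k x₀ y₀ ≤ greenConv f k (x t) (y t) + δ := tsub_le_iff_right.1 h2.1
        _ ≤ (heatPeak d t)⁻¹ * bridgeIter f (y t) k t (x t) + δ + δ := by gcongr
        _ ≤ _ := by
          rw [add_assoc]
          gcongr
    · have h5 := mul_le_mul_right h3 (heatPeak d t)⁻¹
      rw [hcancel] at h5
      calc _ ≤ greenConv f k (x t) (y t) + δ := h5
        _ ≤ greenConv f k x₀ y₀ + δ + δ := by
          gcongr
          exact h2.2
        _ ≤ _ := by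
          rw [add_assoc]
          gcongr
  have hprod := ENNReal.Tendsto.mul (tendsto_exp_norm_sub hx hy) (Or.inl one_ne_zero) hmain
    (Or.inr ENNReal.one_ne_top)
  rw [one_mul] at hprod
  refine hprod.congr' ?_
  filter_upwards [eventually_gt_atTop 0] with t ht
  rw [inv_heatDensity ht, mul_assoc]

/-- `bridgeIter_le` loses `(k + 1)^(d/2)` and the sum `greenConv` has `k + 1` terms. Both losses are
polynomial and disappear when `ρ` is lowered to `ρ'`. A bound at `x₀` alone suffices, because the
Harnack estimate spreads it over a ball containing the support and eventually both endpoints. -/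
lemma exists_pow_mul_bridgeIter_le {ρ ρ' C : ℝ≥0} (hρ : ρ' < ρ)
    (hCx : ∀ j, (ρ : ℝ≥0∞) ^ j * greenIter f j x₀ ≤ C)
    (hx : Tendsto x atTop (𝓝 x₀)) (hy : Tendsto y atTop (𝓝 y₀)) :
    ∃ C' : ℝ≥0, ∀ᶠ t in atTop, ∀ k, (ρ' : ℝ≥0∞) ^ k *
      ((heatDensity t (y t - x t))⁻¹ * bridgeIter f (y t) k t (x t)) ≤ C' := by
  set R' := max R (max (‖x₀‖ + 1) (‖y₀‖ + 1)) with hR'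
  obtain ⟨B, hB⟩ := hf.exists_pow_mul_greenIter_le hCx (le_max_left R _ : R ≤ R')
  have hxR : ∀ᶠ t in atTop, ‖x t‖ ≤ R' := by
    filter_upwards [hx.norm.eventually (gt_mem_nhds (lt_add_one ‖x₀‖))] with t ht
    exact ht.le.trans ((le_max_left _ _).trans (le_max_right _ _))
  have hyR : ∀ᶠ t in atTop, ‖y t‖ ≤ R' := by
    filter_upwards [hy.norm.eventually (gt_mem_nhds (lt_add_one ‖y₀‖))] with t ht
    exact ht.le.trans ((le_max_right _ _).trans (le_max_right _ _))
  have hρ0 : 0 < ρ := hρ.bot_lt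
  set q : ℝ≥0 := ρ' / ρ with hq
  have hq1 : q < 1 := (div_lt_one hρ0).2 hρ
  obtain ⟨b, hb⟩ : ∃ b : ℝ≥0, ∀ k : ℕ, (k + 1 : ℝ≥0) ^ (d + 1) * q ^ k ≤ b := by
    have h1 := tendsto_pow_const_mul_const_pow_of_abs_lt_one (d + 1) (r := (q : ℝ))
      (by rw [abs_of_nonneg q.coe_nonneg]; exact_mod_cast hq1)
    rcases eq_or_ne q 0 with h0 | h0
    · refine ⟨1, fun k => ?_⟩
      rcases k with _ | k
      · simp
      · simp [h0]
    · obtain ⟨b, hb⟩ := h1.bddAbove_range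
      -- The bounded sequence is `n^(d+1) qⁿ`; taking `n = k + 1` produces one extra factor `q`,
      -- which is divided out.
      refine ⟨(b / q).toNNReal, fun k => ?_⟩
      rw [← NNReal.coe_le_coe]
      refine le_trans ?_ (Real.le_coe_toNNReal _)
      have h2 := hb (Set.mem_range_self (k + 1))
      have h3 : (0 : ℝ) < q := by positivity
      rw [le_div_iff₀ h3]
      push_cast at h2 ⊢
      rw [pow_succ (q : ℝ)] at h2
      linarith
  refine ⟨2 * (b * B ^ 2), ?_⟩
  have h2 : ∀ᶠ t in atTop, ENNReal.ofReal (Real.exp (‖y t - x t‖ ^ 2 / (2 * t))) ≤ 2 :=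
    ((tendsto_exp_norm_sub hx hy).eventually (gt_mem_nhds ENNReal.one_lt_two)).mono
      fun t ht => ht.le
  filter_upwards [hxR, hyR, h2, eventually_gt_atTop 0] with t hxt hyt h2t ht k
  have hk0 := heatPeak_ne_zero (d := d) ht
  have hkt := heatPeak_ne_top (d := d) t
  have hL : (ρ : ℝ≥0∞) ^ k * greenConv f k (x t) (y t) ≤ (k + 1) * B ^ 2 := by
    unfold greenConv
    rw [Finset.mul_sum]
    calc _ ≤ ∑ j ∈ Finset.range (k + 1), (B : ℝ≥0∞) ^ 2 := by
          refine Finset.sum_le_sum fun j hj => ?_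
          have hjk : j + (k - j) = k :=
            Nat.add_sub_cancel' (Nat.lt_succ_iff.1 (Finset.mem_range.1 hj))
          calc _ = (ρ : ℝ≥0∞) ^ (j + (k - j)) *
                (greenIter f j (x t) * greenIter f (k - j) (y t)) := by rw [hjk]
            _ = ((ρ : ℝ≥0∞) ^ j * greenIter f j (x t)) *
                ((ρ : ℝ≥0∞) ^ (k - j) * greenIter f (k - j) (y t)) := by
              rw [pow_add]; ring
            _ ≤ B * B := mul_le_mul' (hB _ hxt j) (hB _ hyt _)
            _ = _ := (sq _).symm
      _ = _ := by simp
  -- The exponent `d / 2` is rounded up to `d` to work with natural powers.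
  have hpow : ENNReal.ofReal ((1 / (k + 1 : ℝ)) ^ (-(d : ℝ) / 2)) ≤ (k + 1) ^ d := by
    have h3 : (1 / (k + 1 : ℝ)) ^ (-(d : ℝ) / 2) ≤ (k + 1 : ℝ) ^ d := by
      rw [one_div, Real.inv_rpow (by positivity), ← Real.rpow_neg (by positivity),
        ← Real.rpow_natCast]
      refine Real.rpow_le_rpow_of_exponent_le (by linarith [(Nat.cast_nonneg k : (0 : ℝ) ≤ k)]) ?_
      have : (0 : ℝ) ≤ d := Nat.cast_nonneg d
      linarith
    refine (ENNReal.ofReal_le_ofReal h3).trans (le_of_eq ?_)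
    rw [ENNReal.ofReal_pow (by positivity), ENNReal.ofReal_add (by positivity) zero_le_one]
    simp
  have hA : bridgeIter f (y t) k t (x t) ≤
      (k + 1) ^ d * (heatPeak d t * greenConv f k (x t) (y t)) := by
    refine (bridgeIter_le hf.meas k ht (x t) (y t)).trans ?_
    rw [show t / (k + 1) = 1 / (k + 1) * t by ring, heatPeak_mul (by positivity) ht, mul_assoc]
    exact mul_le_mul_left hpow _
  have hρρ : (ρ' : ℝ≥0∞) ^ k = (q : ℝ≥0∞) ^ k * (ρ : ℝ≥0∞) ^ k := by
    rw [← mul_pow, ← ENNReal.coe_mul, hq, div_mul_cancel₀ _ hρ0.ne']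
  calc _ ≤ (ρ' : ℝ≥0∞) ^ k * ((2 * (heatPeak d t)⁻¹) *
        ((k + 1) ^ d * (heatPeak d t * greenConv f k (x t) (y t)))) := by
        rw [inv_heatDensity ht]
        gcongr
    _ = 2 * (((heatPeak d t)⁻¹ * heatPeak d t) * ((k + 1) ^ d * (q : ℝ≥0∞) ^ k *
        ((ρ : ℝ≥0∞) ^ k * greenConv f k (x t) (y t)))) := by
      rw [hρρ]; ring
    _ ≤ 2 * (1 * ((k + 1) ^ d * (q : ℝ≥0∞) ^ k * ((k + 1) * B ^ 2))) := by
      rw [ENNReal.inv_mul_cancel hk0 hkt]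
      gcongr
    _ = 2 * (((k + 1) ^ (d + 1) * (q : ℝ≥0∞) ^ k) * B ^ 2) := by
      rw [pow_succ]; ring
    _ ≤ 2 * (b * B ^ 2) := by
      gcongr
      exact_mod_cast hb k
    _ = _ := by push_cast; rfl

end IsPotential

end Normalized

/-! ### From convergence of moments to convergence of exponential moments. -/

section Series

lemma summable_factorial_ratio (m : ℕ) {r : ℝ} (hr0 : 0 ≤ r) (hr : r < 1) :
    Summable fun j : ℕ => ((m + j).factorial : ℝ) / j.factorial * r ^ j := by
  have h1 : Summable fun j : ℕ => ((m + j : ℕ) : ℝ) ^ m * r ^ j := by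
    rcases hr0.eq_or_lt with rfl | hr0
    · exact summable_of_ne_finset_zero (s := {0}) fun j hj => by
        simp only [Finset.mem_singleton] at hj
        simp [hj]
    have h2 := (summable_nat_add_iff m).2
      (summable_pow_mul_geometric_of_norm_lt_one (R := ℝ) m (r := r)
        (by rwa [Real.norm_of_nonneg hr0.le]))
    have h3 := h2.mul_right ((r ^ m)⁻¹)
    refine h3.congr fun j => ?_
    rw [pow_add, add_comm j m]
    field_simp
  refine Summable.of_nonneg_of_le (fun j => by positivity) (fun j => ?_) h1
  gcongr
  rw [div_le_iff₀ (by positivity), mul_comm]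
  -- The ratio `(m + j)! / j!` has `m` factors, each at most `m + j`.
  have h4 : (m + j).factorial ≤ j.factorial * (m + j) ^ m := by
    rw [add_comm m j, ← Nat.factorial_mul_ascFactorial]
    exact Nat.mul_le_mul_left _ (Nat.ascFactorial_le_pow_add j m)
  exact_mod_cast h4

/-- The exponentially weighted moments as a series of moments. -/
lemma hasSum_integral_pow_mul_exp {Ω : Type*} [MeasurableSpace Ω] {P : Measure Ω} {Z w : Ω → ℝ}
    (hw : ∀ ω, 0 ≤ w ω) {C ρ h : ℝ} (hρ : |h| < ρ)
    (hint : ∀ k : ℕ, Integrable (fun ω => Z ω ^ k * w ω) P)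
    (hbd : ∀ k : ℕ, ∫ ω, |Z ω| ^ k * w ω ∂P ≤ C * k.factorial / ρ ^ k) (m : ℕ) :
    HasSum (fun j : ℕ => h ^ j / j.factorial * ∫ ω, Z ω ^ (m + j) * w ω ∂P)
      (∫ ω, Z ω ^ m * (Real.exp (h * Z ω) * w ω) ∂P) := by
  have hρ0 : 0 < ρ := (abs_nonneg h).trans_lt hρ
  let F : ℕ → Ω → ℝ := fun j ω => h ^ j / j.factorial * (Z ω ^ (m + j) * w ω)
  have hF : ∀ j, Integrable (F j) P := fun j => (hint (m + j)).const_mul _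
  have hnorm : ∀ j, ∫ ω, ‖F j ω‖ ∂P ≤
      C / ρ ^ m * (((m + j).factorial : ℝ) / j.factorial * (|h| / ρ) ^ j) := fun j => by
    have h1 : ∀ ω, ‖F j ω‖ = |h| ^ j / j.factorial * (|Z ω| ^ (m + j) * w ω) := fun ω => by
      simp only [F, norm_mul, norm_div, norm_pow, Real.norm_eq_abs, abs_of_nonneg (hw ω),
        Nat.abs_cast]
    simp_rw [h1]
    rw [integral_const_mul]
    calc _ ≤ |h| ^ j / j.factorial * (C * (m + j).factorial / ρ ^ (m + j)) := by
          gcongr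
          exact hbd (m + j)
      _ = _ := by
          rw [pow_add, div_pow]
          field_simp
  have hsum : Summable fun j => ∫ ω, ‖F j ω‖ ∂P := by
    refine Summable.of_nonneg_of_le (fun j => integral_nonneg fun ω => norm_nonneg _) hnorm ?_
    exact (summable_factorial_ratio m (by positivity) ((div_lt_one hρ0).2 hρ)).mul_left _
  have h2 := hasSum_integral_of_summable_integral_norm hF hsum
  have h3 : ∀ j, ∫ ω, F j ω ∂P = h ^ j / j.factorial * ∫ ω, Z ω ^ (m + j) * w ω ∂P := fun j =>
    integral_const_mul _ _
  have h4 : ∀ ω, ∑' j, F j ω = Z ω ^ m * (Real.exp (h * Z ω) * w ω) := fun ω => by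
    have h5 : HasSum (fun j : ℕ => (h * Z ω) ^ j / j.factorial) (Real.exp (h * Z ω)) := by
      rw [Real.exp_eq_exp_ℝ]
      exact NormedSpace.expSeries_div_hasSum_exp (h * Z ω)
    have h6 := h5.mul_left (Z ω ^ m * w ω)
    rw [show Z ω ^ m * (Real.exp (h * Z ω) * w ω) = Z ω ^ m * w ω * Real.exp (h * Z ω) by ring,
      ← h6.tsum_eq]
    refine tsum_congr fun j => ?_
    simp only [F]
    rw [mul_pow, pow_add]
    ring
  simp_rw [h3, h4] at h2
  exact h2

/-- Convergence of weighted moments with geometric bounds gives convergence of the exponentially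
tilted weighted moments. -/
lemma tendsto_integral_pow_mul_exp {ι : Type*} {l : Filter ι} {Ω : ι → Type*}
    [∀ t, MeasurableSpace (Ω t)] {Q : ∀ t, Measure (Ω t)} {Z w : ∀ t, Ω t → ℝ}
    {Ω₀ : Type*} [MeasurableSpace Ω₀] {P : Measure Ω₀} {S w₀ : Ω₀ → ℝ} {C ρ h : ℝ}
    (hρ : |h| < ρ) (hw : ∀ t ω, 0 ≤ w t ω) (hw₀ : ∀ ω, 0 ≤ w₀ ω)
    (hint : ∀ᶠ t in l, ∀ k : ℕ, Integrable (fun ω => Z t ω ^ k * w t ω) (Q t))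
    (hbd : ∀ᶠ t in l, ∀ k : ℕ, ∫ ω, |Z t ω| ^ k * w t ω ∂(Q t) ≤ C * k.factorial / ρ ^ k)
    (hint₀ : ∀ k : ℕ, Integrable (fun ω => S ω ^ k * w₀ ω) P)
    (hbd₀ : ∀ k : ℕ, ∫ ω, |S ω| ^ k * w₀ ω ∂P ≤ C * k.factorial / ρ ^ k)
    (hlim : ∀ k : ℕ, Tendsto (fun t => ∫ ω, Z t ω ^ k * w t ω ∂(Q t)) l
      (𝓝 (∫ ω, S ω ^ k * w₀ ω ∂P))) (m : ℕ) :
    Tendsto (fun t => ∫ ω, Z t ω ^ m * (Real.exp (h * Z t ω) * w t ω) ∂(Q t)) l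
      (𝓝 (∫ ω, S ω ^ m * (Real.exp (h * S ω) * w₀ ω) ∂P)) := by
  have hρ0 : 0 < ρ := (abs_nonneg h).trans_lt hρ
  rw [← (hasSum_integral_pow_mul_exp hw₀ hρ hint₀ hbd₀ m).tsum_eq]
  have h1 : Tendsto (fun t => ∑' j : ℕ, h ^ j / j.factorial * ∫ ω, Z t ω ^ (m + j) * w t ω ∂(Q t)) l
      (𝓝 (∑' j : ℕ, h ^ j / j.factorial * ∫ ω, S ω ^ (m + j) * w₀ ω ∂P)) := by
    -- Tannery's theorem: the moment bounds give one summable majorant for all `t` in an eventual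
    -- set.
    refine tendsto_tsum_of_dominated_convergence
      (bound := fun j => C / ρ ^ m * (((m + j).factorial : ℝ) / j.factorial * (|h| / ρ) ^ j))
      ((summable_factorial_ratio m (by positivity) ((div_lt_one hρ0).2 hρ)).mul_left _)
      (fun j => (hlim (m + j)).const_mul _) ?_
    filter_upwards [hbd] with t hb j
    rw [norm_mul, norm_div, norm_pow, Real.norm_eq_abs, Real.norm_natCast]
    calc _ ≤ |h| ^ j / j.factorial * (C * (m + j).factorial / ρ ^ (m + j)) := by
          gcongr
          refine le_trans (norm_integral_le_integral_norm _) (le_trans (le_of_eq ?_) (hb (m + j)))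
          refine integral_congr_ae (ae_of_all _ fun ω => ?_)
          simp only [norm_mul, norm_pow, Real.norm_eq_abs, abs_of_nonneg (hw t ω)]
      _ = _ := by
          rw [pow_add, div_pow]
          field_simp
  refine h1.congr' ?_
  filter_upwards [hint, hbd] with t hi hb
  exact (hasSum_integral_pow_mul_exp (hw t) hρ hi hb m).tsum_eq

/-- From `(βz)ᵏ / k! ≤ e^(βz)`. The bound holds for every nonnegative variable, so after weighting
by `e^(-βZ)` a series of radius `β` is available without any assumption on moments. The factor `1`
matches the constant `C` of `tendsto_integral_pow_mul_exp`. -/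
lemma integral_pow_mul_exp_neg_le {Ω : Type*} [MeasurableSpace Ω] {P : Measure Ω}
    [IsProbabilityMeasure P] {Z : Ω → ℝ} {β : ℝ} (hβ : 0 < β) (hZ : ∀ ω, 0 ≤ Z ω)
    (hm : AEStronglyMeasurable Z P) (k : ℕ) :
    Integrable (fun ω => Z ω ^ k * Real.exp (-β * Z ω)) P ∧
      ∫ ω, |Z ω| ^ k * Real.exp (-β * Z ω) ∂P ≤ 1 * k.factorial / β ^ k := by
  have hb : ∀ ω, Z ω ^ k * Real.exp (-β * Z ω) ≤ k.factorial / β ^ k := fun ω => by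
    have h1 := Real.pow_div_factorial_le_exp (β * Z ω) (mul_nonneg hβ.le (hZ ω)) k
    rw [div_le_iff₀ (by positivity), mul_pow] at h1
    rw [le_div_iff₀ (by positivity), neg_mul, Real.exp_neg]
    have h2 := Real.exp_pos (β * Z ω)
    rw [mul_assoc, inv_mul_eq_div, mul_div_assoc', div_le_iff₀ h2]
    linarith
  have hi : Integrable (fun ω => Z ω ^ k * Real.exp (-β * Z ω)) P := by
    refine Integrable.of_bound (C := k.factorial / β ^ k) ?_ (ae_of_all _ fun ω => ?_)
    · exact (hm.pow k).mul (Real.continuous_exp.comp_aestronglyMeasurable (hm.const_mul (-β)))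
    · rw [Real.norm_of_nonneg (mul_nonneg (pow_nonneg (hZ ω) _) (Real.exp_pos _).le)]
      exact hb ω
  refine ⟨hi, ?_⟩
  simp_rw [fun ω => abs_of_nonneg (hZ ω)]
  refine (integral_mono hi (integrable_const _) hb).trans (le_of_eq ?_)
  simp

/-- For nonnegative random variables, convergence of the moments with a geometric bound gives
convergence of the Laplace transforms on the whole negative half-line. -/
lemma tendsto_integral_exp_of_nonneg {ι : Type*} {l : Filter ι} {Ω : ι → Type*}
    [∀ t, MeasurableSpace (Ω t)] {Q : ∀ t, Measure (Ω t)} [∀ t, IsProbabilityMeasure (Q t)]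
    {Z : ∀ t, Ω t → ℝ} {Ω₀ : Type*} [MeasurableSpace Ω₀] {P : Measure Ω₀}
    [IsProbabilityMeasure P] {S : Ω₀ → ℝ} {C ρ : ℝ} (hρ : 0 < ρ)
    (hZ : ∀ᶠ t in l, ∀ ω, 0 ≤ Z t ω) (hS : ∀ ω, 0 ≤ S ω)
    (hZm : ∀ᶠ t in l, AEStronglyMeasurable (Z t) (Q t)) (hSm : AEStronglyMeasurable S P)
    (hint : ∀ᶠ t in l, ∀ k : ℕ, Integrable (fun ω => Z t ω ^ k) (Q t))
    (hbd : ∀ᶠ t in l, ∀ k : ℕ, ∫ ω, Z t ω ^ k ∂(Q t) ≤ C * k.factorial / ρ ^ k)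
    (hint₀ : ∀ k : ℕ, Integrable (fun ω => S ω ^ k) P)
    (hbd₀ : ∀ k : ℕ, ∫ ω, S ω ^ k ∂P ≤ C * k.factorial / ρ ^ k)
    (hlim : ∀ k : ℕ, Tendsto (fun t => ∫ ω, Z t ω ^ k ∂(Q t)) l (𝓝 (∫ ω, S ω ^ k ∂P)))
    {γ : ℝ} (hγ : 0 < γ) :
    Tendsto (fun t => ∫ ω, Real.exp (-γ * Z t ω) ∂(Q t)) l
      (𝓝 (∫ ω, Real.exp (-γ * S ω) ∂P)) := by
  -- Inside the radius `ρ` the unweighted series at `0` applies.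
  have base : ∀ β, 0 < β → β < ρ → ∀ m : ℕ,
      Tendsto (fun t => ∫ ω, Z t ω ^ m * Real.exp (-β * Z t ω) ∂(Q t)) l
      (𝓝 (∫ ω, S ω ^ m * Real.exp (-β * S ω) ∂P)) := fun β hβ hβρ m => by
    have h := tendsto_integral_pow_mul_exp (l := l) (Q := Q) (Z := Z) (w := fun _ _ => 1)
      (P := P) (S := S) (w₀ := fun _ => 1) (C := C) (ρ := ρ) (h := -β)
      (by rwa [abs_neg, abs_of_pos hβ]) (fun _ _ => zero_le_one) (fun _ => zero_le_one)
      (by simpa using hint)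
      (by
        filter_upwards [hbd, hZ] with t ht hz k
        simpa [abs_of_nonneg (hz _)] using ht k)
      (by simpa using hint₀) (by simpa [abs_of_nonneg (hS _)] using hbd₀) (by simpa using hlim) m
    simpa using h
  -- Recentring at `-2β/3` gives radius `2β/3`, which exceeds the distance `β/3` to `-β`; thus each
  -- step enlarges the range by the factor `3/2`. All powers `m` are carried along, since the next
  -- step needs every weighted moment to converge.
  have step : ∀ n : ℕ, ∀ β, 0 < β → β ≤ ρ / 2 * (3 / 2) ^ n → ∀ m : ℕ,
      Tendsto (fun t => ∫ ω, Z t ω ^ m * Real.exp (-β * Z t ω) ∂(Q t)) l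
      (𝓝 (∫ ω, S ω ^ m * Real.exp (-β * S ω) ∂P)) := by
    intro n
    induction n with
    | zero => exact fun β hβ hβρ m => base β hβ (by simp at hβρ; linarith) m
    | succ n ih =>
      intro β hβ hβn m
      have hβ' : 0 < 2 * β / 3 := by positivity
      have h1 := ih (2 * β / 3) hβ' (by rw [pow_succ] at hβn; linarith)
      have h := tendsto_integral_pow_mul_exp (l := l) (Q := Q) (Z := Z)
        (w := fun t ω => Real.exp (-(2 * β / 3) * Z t ω))
        (P := P) (S := S) (w₀ := fun ω => Real.exp (-(2 * β / 3) * S ω)) (C := 1)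
        (ρ := 2 * β / 3) (h := -(β / 3))
        (by rw [abs_neg, abs_of_pos (by positivity)]; linarith)
        (fun _ _ => (Real.exp_pos _).le) (fun _ => (Real.exp_pos _).le)
        (by
          filter_upwards [hZ, hZm] with t hz hzm k
          exact (integral_pow_mul_exp_neg_le hβ' hz hzm k).1)
        (by
          filter_upwards [hZ, hZm] with t hz hzm k
          exact (integral_pow_mul_exp_neg_le hβ' hz hzm k).2)
        (fun k => (integral_pow_mul_exp_neg_le hβ' hS hSm k).1) (fun k => (integral_pow_mul_exp_neg_le hβ' hS hSm k).2) h1 m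
      have h2 : ∀ z : ℝ, Real.exp (-(β / 3) * z) * Real.exp (-(2 * β / 3) * z) =
          Real.exp (-β * z) := fun z => by
        rw [← Real.exp_add]
        ring_nf
      simpa only [h2] using h
  obtain ⟨n, hn⟩ := pow_unbounded_of_one_lt (γ / (ρ / 2)) (by norm_num : (1 : ℝ) < 3 / 2)
  have h := step n γ hγ (by rw [div_lt_iff₀ (by positivity)] at hn; linarith) 0
  simpa using h

end Series

/-! ### Powers of differences by interpolation. -/

section Interpolation

/-- A homogeneous difference power is a fixed linear combination of powers of sums. -/
lemma exists_sub_pow_eq_sum (k : ℕ) : ∃ c : ℕ → ℝ, ∀ a b : ℝ,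
    (a - b) ^ k = ∑ i ∈ Finset.range (k + 1), c i * (a + i * b) ^ k := by
  classical
  -- The polynomial `(a + bX)ᵏ` has degree at most `k`, so its value at `-1` is determined by its
  -- values at `0, …, k`; the coefficients are the Lagrange basis polynomials at `-1` and do not
  -- depend on `a` and `b`.
  refine ⟨fun i => (Lagrange.basis (Finset.range (k + 1)) (fun n : ℕ => (n : ℝ)) i).eval (-1),
    fun a b => ?_⟩
  let p : Polynomial ℝ := (Polynomial.C a + Polynomial.C b * Polynomial.X) ^ k
  have hp : p.degree < (Finset.range (k + 1)).card := by
    rw [Finset.card_range]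
    have h1 : p.natDegree ≤ k := by
      refine (Polynomial.natDegree_pow_le).trans ?_
      have : (Polynomial.C a + Polynomial.C b * Polynomial.X).natDegree ≤ 1 := by compute_degree
      nlinarith
    exact lt_of_le_of_lt (Polynomial.degree_le_of_natDegree_le h1)
      (by exact_mod_cast Nat.lt_succ_self k)
  have h := Lagrange.eq_interpolate (s := Finset.range (k + 1)) (v := fun n : ℕ => (n : ℝ))
    (fun i _ j _ hij => Nat.cast_injective hij) hp
  have h2 := congrArg (Polynomial.eval (-1)) h
  rw [Lagrange.interpolate_apply, Polynomial.eval_finsetSum] at h2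
  have h3 : p.eval (-1) = (a - b) ^ k := by
    simp [p, sub_eq_add_neg]
  rw [← h3, h2]
  refine Finset.sum_congr rfl fun i _ => ?_
  simp only [p, Polynomial.eval_mul, Polynomial.eval_C, Polynomial.eval_pow, Polynomial.eval_add,
    Polynomial.eval_X]
  ring

end Interpolation

/-! ### The nonnegative potentials `v⁺ + i v⁻`. -/

section Tilt

/-- The nonnegative function `v⁺ + i v⁻`. -/
def tilt {E : Type*} (v : E → ℝ) (i : ℕ) (z : E) : ℝ := max (v z) 0 + i * max (-v z) 0

variable {E : Type*} {v : E → ℝ}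

lemma tilt_nonneg (i : ℕ) (z : E) : 0 ≤ tilt v i z := by
  unfold tilt
  positivity

lemma tilt_one : tilt v 1 = fun z => |v z| := by
  ext z
  unfold tilt
  rcases le_total 0 (v z) with h | h
  · simp [h, abs_of_nonneg]
  · simp [h, abs_of_nonpos]

lemma measurable_tilt [MeasurableSpace E] (hv : Measurable v) (i : ℕ) : Measurable (tilt v i) := by
  unfold tilt
  fun_prop

lemma tilt_le (i : ℕ) (z : E) : tilt v i z ≤ (1 + i) * |v z| := by
  unfold tilt
  have h1 : max (v z) 0 ≤ |v z| := max_le (le_abs_self _) (abs_nonneg _)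
  have h2 : max (-v z) 0 ≤ |v z| := max_le (neg_le_abs _) (abs_nonneg _)
  have h3 : (i : ℝ) * max (-v z) 0 ≤ i * |v z| := by gcongr
  linarith

lemma isPotential_tilt {d : ℕ} {v : EuclideanSpace ℝ (Fin d) → ℝ} (hv : Measurable v) {K R : ℝ}
    (hK : ∀ z, |v z| ≤ K) (hR : ∀ z, v z ≠ 0 → ‖z‖ ≤ R) (i : ℕ) :
    IsPotential (fun z => ENNReal.ofReal (tilt v i z)) ((1 + i) * K).toNNReal R where
  meas := (measurable_tilt hv i).ennreal_ofReal
  le z := by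
    refine ENNReal.ofReal_le_ofReal ((tilt_le i z).trans ?_)
    have := hK z
    gcongr
  supp z hz := by
    refine hR z fun h0 => hz ?_
    simp [tilt, h0]

end Tilt

/-! ### Real-valued occupation integrals and their measurability. -/

section Occupation

variable {Ω E : Type*} [MeasurableSpace Ω] [MeasurableSpace E] {P : Measure Ω}

/-- The occupation integral of `u` along the process `X` during `I`. -/
noncomputable def occupation (u : E → ℝ) (X : ℝ → Ω → E) (I : Set ℝ) (ω : Ω) : ℝ :=
  ∫ s in I, u (X s ω)

/-- Almost surely, `X` agrees on `I` with a jointly measurable process. -/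
def HasMeasurableModification (X : ℝ → Ω → E) (I : Set ℝ) (P : Measure Ω) : Prop :=
  ∃ X' : ℝ → Ω → E, Measurable (Function.uncurry X') ∧ ∀ᵐ ω ∂P, ∀ s ∈ I, X' s ω = X s ω

variable {X : ℝ → Ω → E} {I : Set ℝ} {u v : E → ℝ}

omit [MeasurableSpace Ω] [MeasurableSpace E] in
lemma occupation_nonneg (hu : ∀ z, 0 ≤ u z) (ω : Ω) : 0 ≤ occupation u X I ω :=
  integral_nonneg fun _ => hu _

omit [MeasurableSpace Ω] [MeasurableSpace E] in
lemma abs_occupation_le (ω : Ω) : |occupation v X I ω| ≤ occupation (tilt v 1) X I ω := by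
  rw [tilt_one]
  exact abs_integral_le_integral_abs

namespace HasMeasurableModification

variable (hX : HasMeasurableModification X I P) (hI : MeasurableSet I)
include hX hI

lemma aestronglyMeasurable_occupation (hu : Measurable u) :
    AEStronglyMeasurable (occupation u X I) P := by
  obtain ⟨X', hm, hXX⟩ := hX
  have h1 : StronglyMeasurable fun ω => ∫ s in I, u (X' s ω) :=
    StronglyMeasurable.integral_prod_right' (f := fun p : Ω × ℝ => u (X' p.2 p.1))
      (hu.comp (hm.comp measurable_swap)).stronglyMeasurable
  refine h1.aestronglyMeasurable.congr ?_
  filter_upwards [hXX] with ω hω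
  exact setIntegral_congr_fun hI fun s hs => by simp only [hω s hs]

lemma aemeasurable_lintegral {f : E → ℝ≥0∞} (hf : Measurable f) :
    AEMeasurable (fun ω => ∫⁻ s in I, f (X s ω)) P := by
  obtain ⟨X', hm, hXX⟩ := hX
  have h1 : Measurable fun ω => ∫⁻ s in I, f (X' s ω) :=
    Measurable.lintegral_prod_right' (f := fun p : Ω × ℝ => f (X' p.2 p.1))
      (hf.comp (hm.comp measurable_swap))
  refine h1.aemeasurable.congr ?_
  filter_upwards [hXX] with ω hω
  exact setLIntegral_congr_fun hI fun s hs => by simp only [hω s hs]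

lemma ae_aestronglyMeasurable (hu : Measurable u) :
    ∀ᵐ ω ∂P, AEStronglyMeasurable (fun s => u (X s ω)) (volume.restrict I) := by
  obtain ⟨X', hm, hXX⟩ := hX
  filter_upwards [hXX] with ω hω
  have h1 : Measurable fun s => u (X' s ω) := hu.comp (hm.comp measurable_prodMk_right)
  refine h1.aestronglyMeasurable.congr ?_
  filter_upwards [ae_restrict_mem hI] with s hs
  simp only [hω s hs]

lemma ae_occupation_eq_toReal (hu : Measurable u) (hu0 : ∀ z, 0 ≤ u z) :
    ∀ᵐ ω ∂P, occupation u X I ω = (∫⁻ s in I, ENNReal.ofReal (u (X s ω))).toReal := by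
  filter_upwards [hX.ae_aestronglyMeasurable hI hu] with ω hω
  exact integral_eq_lintegral_of_nonneg_ae (ae_of_all _ fun s => hu0 _) hω

omit hX hI in
lemma ae_lt_top_of_lintegral_pow_one {N : Ω → ℝ≥0∞} (hN : AEMeasurable N P)
    (h : ∫⁻ ω, N ω ^ 1 ∂P ≠ ∞) : ∀ᵐ ω ∂P, N ω < ∞ :=
  ae_lt_top' hN (by simpa using h)

lemma integrable_and_integral_pow (hu : Measurable u) (hu0 : ∀ z, 0 ≤ u z)
    (hfin : ∀ k : ℕ, ∫⁻ ω, (∫⁻ s in I, ENNReal.ofReal (u (X s ω))) ^ k ∂P ≠ ∞) (k : ℕ) :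
    Integrable (fun ω => occupation u X I ω ^ k) P ∧
      ∫ ω, occupation u X I ω ^ k ∂P =
        (∫⁻ ω, (∫⁻ s in I, ENNReal.ofReal (u (X s ω))) ^ k ∂P).toReal := by
  have hN := hX.aemeasurable_lintegral hI (f := fun z => ENNReal.ofReal (u z)) hu.ennreal_ofReal
  have h1 : (fun ω => ((∫⁻ s in I, ENNReal.ofReal (u (X s ω))) ^ k).toReal) =ᵐ[P]
      fun ω => occupation u X I ω ^ k := by
    filter_upwards [hX.ae_occupation_eq_toReal hI hu hu0] with ω hω
    rw [hω, ENNReal.toReal_pow]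
  have hlt : ∀ᵐ ω ∂P, (∫⁻ s in I, ENNReal.ofReal (u (X s ω))) ^ k < ∞ :=
    ae_lt_top' (hN.pow_const k) (hfin k)
  exact ⟨(integrable_toReal_of_lintegral_ne_top (hN.pow_const k) (hfin k)).congr h1,
    by rw [← integral_congr_ae h1, integral_toReal (hN.pow_const k) hlt]⟩

lemma ae_integrableOn (hv : Measurable v)
    (hfin : ∫⁻ ω, (∫⁻ s in I, ENNReal.ofReal (tilt v 1 (X s ω))) ^ 1 ∂P ≠ ∞) :
    ∀ᵐ ω ∂P, IntegrableOn (fun s => v (X s ω)) I := by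
  have hN := hX.aemeasurable_lintegral hI (f := fun z => ENNReal.ofReal (tilt v 1 z))
    (measurable_tilt hv 1).ennreal_ofReal
  filter_upwards [ae_lt_top_of_lintegral_pow_one hN hfin, hX.ae_aestronglyMeasurable hI hv]
    with ω h1 h2
  refine ⟨h2, ?_⟩
  rw [hasFiniteIntegral_iff_norm]
  simpa [tilt_one] using h1

/-- The numbers are the occupations of `v⁺` and `v⁻`. What matters for the interpolation is that one
pair serves all `i` at once. -/
lemma ae_exists_decomposition (hv : Measurable v)
    (hfin : ∫⁻ ω, (∫⁻ s in I, ENNReal.ofReal (tilt v 1 (X s ω))) ^ 1 ∂P ≠ ∞) :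
    ∀ᵐ ω ∂P, ∃ a b : ℝ, occupation v X I ω = a - b ∧
      ∀ i : ℕ, occupation (tilt v i) X I ω = a + i * b := by
  filter_upwards [hX.ae_integrableOn hI hv hfin] with ω hω
  have h1 : IntegrableOn (fun s => max (v (X s ω)) 0) I := hω.pos_part
  have h2 : IntegrableOn (fun s => max (-v (X s ω)) 0) I := hω.neg_part
  refine ⟨∫ s in I, max (v (X s ω)) 0, ∫ s in I, max (-v (X s ω)) 0, ?_, fun i => ?_⟩
  · rw [← integral_sub h1 h2]
    refine integral_congr_ae (ae_of_all _ fun s => ?_)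
    rcases le_total 0 (v (X s ω)) with h | h <;> simp [h]
  · rw [← integral_const_mul, ← integral_add h1 (h2.const_mul _)]
    rfl

lemma integrable_pow (hv : Measurable v)
    (hfin : ∀ k : ℕ, ∫⁻ ω, (∫⁻ s in I, ENNReal.ofReal (tilt v 1 (X s ω))) ^ k ∂P ≠ ∞) (k : ℕ) :
    Integrable (fun ω => occupation v X I ω ^ k) P := by
  have h := (hX.integrable_and_integral_pow hI (measurable_tilt hv 1) (tilt_nonneg 1) hfin k).1
  refine h.mono' ((hX.aestronglyMeasurable_occupation hI hv).pow k) (ae_of_all _ fun ω => ?_)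
  rw [norm_pow, Real.norm_eq_abs]
  exact pow_le_pow_left₀ (abs_nonneg _) (abs_occupation_le ω) k

end HasMeasurableModification

end Occupation

/-! ### Moments of the path integrals of nonnegative potentials. -/

section PathIntegrals

variable {d : ℕ} {Ω : Type*} [MeasurableSpace Ω] {P : Measure Ω} {x y : EuclideanSpace ℝ (Fin d)}

omit [MeasurableSpace Ω] in
lemma pathIntegral_eq_occupation (v : EuclideanSpace ℝ (Fin d) → ℝ)
    (X : ℝ → Ω → EuclideanSpace ℝ (Fin d)) {t : ℝ} (ht : 0 < t) :
    pathIntegral v X t = occupation v X (Set.Ioo 0 t) := by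
  ext ω
  rw [pathIntegral, occupation, intervalIntegral.integral_of_le ht.le, integral_Ioc_eq_integral_Ioo]

lemma IsBrownianMotionFrom.hasMeasurableModification {W : ℝ≥0 → Ω → EuclideanSpace ℝ (Fin d)}
    (hW : IsBrownianMotionFrom x W P) :
    HasMeasurableModification (fun s => W s.toNNReal) (Set.Ioi 0) P := by
  obtain ⟨X, hX, h⟩ := hW.exists_measurable
  exact ⟨X, hX, h.mono fun ω hω s _ => hω s⟩

lemma IsBrownianBridge.hasMeasurableModification {X : ℝ → Ω → EuclideanSpace ℝ (Fin d)} {t : ℝ}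
    (hX : IsBrownianBridge t x y X P) (ht : 0 < t) :
    HasMeasurableModification X (Set.Ioo 0 t) P := by
  obtain ⟨X', hX', h⟩ := hX.exists_measurable ht
  exact ⟨X', hX', h.mono fun ω hω s hs => hω s (Set.Ioo_subset_Icc_self hs)⟩

lemma IsPotential.greenIter_ne_top {f : EuclideanSpace ℝ (Fin d) → ℝ≥0∞} {K : ℝ≥0} {R : ℝ}
    (hf : IsPotential f K R) (hd : 3 ≤ d) (k : ℕ) (z : EuclideanSpace ℝ (Fin d)) :
    greenIter f k z ≠ ∞ := by
  obtain ⟨M, -, hM, -⟩ := hf.exists_greenIter_le hd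
  exact ((hM k z).trans_lt (by finiteness)).ne

lemma IsPotential.greenConv_ne_top {f : EuclideanSpace ℝ (Fin d) → ℝ≥0∞} {K : ℝ≥0} {R : ℝ}
    (hf : IsPotential f K R) (hd : 3 ≤ d) (k : ℕ) (z w : EuclideanSpace ℝ (Fin d)) :
    greenConv f k z w ≠ ∞ := by
  obtain ⟨C, hC, -⟩ := hf.exists_greenConv_le hd k
  exact ((hC z w).trans_lt (by finiteness)).ne

lemma IsPotential.inv_mul_bridgeIter_ne_top {f : EuclideanSpace ℝ (Fin d) → ℝ≥0∞} {K : ℝ≥0}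
    {R : ℝ} (hf : IsPotential f K R) (hd : 3 ≤ d) (k : ℕ) {t : ℝ} (ht : 0 < t)
    (z w : EuclideanSpace ℝ (Fin d)) :
    (heatDensity t (w - z))⁻¹ * bridgeIter f w k t z ≠ ∞ := by
  refine ENNReal.mul_ne_top (ENNReal.inv_ne_top.2 (heatDensity_ne_zero ht _)) ?_
  refine ((bridgeIter_le hf.meas k ht z w).trans_lt ?_).ne
  exact ENNReal.mul_lt_top (heatPeak_ne_top _).lt_top (hf.greenConv_ne_top hd k z w).lt_top

section Moments

variable {u : EuclideanSpace ℝ (Fin d) → ℝ} {K : ℝ≥0} {R : ℝ} [IsProbabilityMeasure P]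

lemma IsBrownianMotionFrom.lintegral_pow_ne_top {W : ℝ≥0 → Ω → EuclideanSpace ℝ (Fin d)}
    (hW : IsBrownianMotionFrom x W P) (hd : 3 ≤ d)
    (hu : IsPotential (fun z => ENNReal.ofReal (u z)) K R) (k : ℕ) :
    ∫⁻ ω, (∫⁻ s in Set.Ioi (0 : ℝ), ENNReal.ofReal (u (W s.toNNReal ω))) ^ k ∂P ≠ ∞ := by
  rw [hW.lintegral_pow_eq hu.meas k]
  exact ENNReal.mul_ne_top (by simp) (hu.greenIter_ne_top hd k x)

lemma IsBrownianMotionFrom.moment_totalPathIntegral {W : ℝ≥0 → Ω → EuclideanSpace ℝ (Fin d)}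
    (hW : IsBrownianMotionFrom x W P) (hd : 3 ≤ d) (hum : Measurable u) (hu0 : ∀ z, 0 ≤ u z)
    (hu : IsPotential (fun z => ENNReal.ofReal (u z)) K R) (k : ℕ) :
    Integrable (fun ω => totalPathIntegral u W ω ^ k) P ∧
      ∫ ω, totalPathIntegral u W ω ^ k ∂P =
        k.factorial * (greenIter (fun z => ENNReal.ofReal (u z)) k x).toReal := by
  have h := hW.hasMeasurableModification.integrable_and_integral_pow measurableSet_Ioi hum hu0
    (hW.lintegral_pow_ne_top hd hu) k
  rw [hW.lintegral_pow_eq hu.meas k, ENNReal.toReal_mul, ENNReal.toReal_natCast] at h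
  exact h

lemma IsBrownianBridge.lintegral_pow_ne_top {X : ℝ → Ω → EuclideanSpace ℝ (Fin d)} {t : ℝ}
    (hX : IsBrownianBridge t x y X P) (ht : 0 < t) (hd : 3 ≤ d)
    (hu : IsPotential (fun z => ENNReal.ofReal (u z)) K R) (k : ℕ) :
    ∫⁻ ω, (∫⁻ s in Set.Ioo 0 t, ENNReal.ofReal (u (X s ω))) ^ k ∂P ≠ ∞ := by
  rw [hX.lintegral_pow_eq ht hu.meas k]
  exact ENNReal.mul_ne_top (by simp) (hu.inv_mul_bridgeIter_ne_top hd k ht x y)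

lemma IsBrownianBridge.moment_pathIntegral {X : ℝ → Ω → EuclideanSpace ℝ (Fin d)} {t : ℝ}
    (hX : IsBrownianBridge t x y X P) (ht : 0 < t) (hd : 3 ≤ d) (hum : Measurable u)
    (hu0 : ∀ z, 0 ≤ u z) (hu : IsPotential (fun z => ENNReal.ofReal (u z)) K R) (k : ℕ) :
    Integrable (fun ω => pathIntegral u X t ω ^ k) P ∧
      ∫ ω, pathIntegral u X t ω ^ k ∂P = k.factorial * ((heatDensity t (y - x))⁻¹ *
        bridgeIter (fun z => ENNReal.ofReal (u z)) y k t x).toReal := by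
  have h := (hX.hasMeasurableModification ht).integrable_and_integral_pow measurableSet_Ioo hum hu0
    (hX.lintegral_pow_ne_top ht hd hu) k
  rw [hX.lintegral_pow_eq ht hu.meas k, ENNReal.toReal_mul, ENNReal.toReal_natCast,
    ← pathIntegral_eq_occupation u X ht] at h
  exact h

end Moments

end PathIntegrals

/-! ### The limiting sum on the product space, signed potentials and exponential integrability. -/

section PairSum

variable {d : ℕ} {Ω : Type*} [MeasurableSpace Ω] {P : Measure Ω} {x y : EuclideanSpace ℝ (Fin d)}

/-- The sum of the total path integrals of `u` along two processes on the factors of `Ω × Ω`. -/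
noncomputable def pairSum (u : EuclideanSpace ℝ (Fin d) → ℝ)
    (W W' : ℝ≥0 → Ω → EuclideanSpace ℝ (Fin d)) (p : Ω × Ω) : ℝ :=
  totalPathIntegral u W p.1 + totalPathIntegral u W' p.2

variable {u v : EuclideanSpace ℝ (Fin d) → ℝ} {W W' : ℝ≥0 → Ω → EuclideanSpace ℝ (Fin d)}

omit [MeasurableSpace Ω] in
lemma totalPathIntegral_nonneg (hu : ∀ z, 0 ≤ u z) (ω : Ω) : 0 ≤ totalPathIntegral u W ω :=
  integral_nonneg fun _ => hu _

omit [MeasurableSpace Ω] in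
lemma abs_totalPathIntegral_le (ω : Ω) :
    |totalPathIntegral v W ω| ≤ totalPathIntegral (tilt v 1) W ω :=
  abs_occupation_le (X := fun s : ℝ => W s.toNNReal) ω

omit [MeasurableSpace Ω] in
lemma pairSum_nonneg (hu : ∀ z, 0 ≤ u z) (p : Ω × Ω) : 0 ≤ pairSum u W W' p :=
  add_nonneg (totalPathIntegral_nonneg hu _) (totalPathIntegral_nonneg hu _)

omit [MeasurableSpace Ω] in
lemma abs_pairSum_le (p : Ω × Ω) : |pairSum v W W' p| ≤ pairSum (tilt v 1) W W' p :=
  (abs_add_le _ _).trans (add_le_add (abs_totalPathIntegral_le _) (abs_totalPathIntegral_le _))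

lemma IsBrownianMotionFrom.aestronglyMeasurable_totalPathIntegral
    (hW : IsBrownianMotionFrom x W P) (hu : Measurable u) :
    AEStronglyMeasurable (totalPathIntegral u W) P :=
  hW.hasMeasurableModification.aestronglyMeasurable_occupation measurableSet_Ioi hu

lemma aestronglyMeasurable_pairSum [SFinite P] (hW : IsBrownianMotionFrom x W P)
    (hW' : IsBrownianMotionFrom y W' P) (hu : Measurable u) :
    AEStronglyMeasurable (pairSum u W W') (P.prod P) :=
  (hW.aestronglyMeasurable_totalPathIntegral hu).comp_fst.add
    (hW'.aestronglyMeasurable_totalPathIntegral hu).comp_snd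

variable [IsProbabilityMeasure P]

/-- On the product space the two summands are independent, and in the binomial expansion `choose k m
* m! * (k - m)!` collapses to `k!`. -/
lemma moment_pairSum {K : ℝ≥0} {R : ℝ} (hW : IsBrownianMotionFrom x W P)
    (hW' : IsBrownianMotionFrom y W' P) (hd : 3 ≤ d) (hum : Measurable u) (hu0 : ∀ z, 0 ≤ u z)
    (hu : IsPotential (fun z => ENNReal.ofReal (u z)) K R) (k : ℕ) :
    Integrable (fun p => pairSum u W W' p ^ k) (P.prod P) ∧
      ∫ p, pairSum u W W' p ^ k ∂(P.prod P) =
        k.factorial * (greenConv (fun z => ENNReal.ofReal (u z)) k x y).toReal := by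
  have h1 := hW.moment_totalPathIntegral hd hum hu0 hu
  have h2 := hW'.moment_totalPathIntegral hd hum hu0 hu
  have h3 : ∀ m ∈ Finset.range (k + 1), Integrable (fun p : Ω × Ω =>
      totalPathIntegral u W p.1 ^ m * totalPathIntegral u W' p.2 ^ (k - m) * (k.choose m : ℝ))
      (P.prod P) := fun m _ => ((h1 m).1.mul_prod (h2 (k - m)).1).mul_const _
  simp only [pairSum, add_pow]
  refine ⟨integrable_finsetSum _ h3, ?_⟩
  rw [integral_finsetSum _ h3, greenConv, ENNReal.toReal_sum
    (fun j _ => ENNReal.mul_ne_top (hu.greenIter_ne_top hd _ _) (hu.greenIter_ne_top hd _ _)),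
    Finset.mul_sum]
  refine Finset.sum_congr rfl fun m hm => ?_
  rw [integral_mul_const, integral_prod_mul (fun ω => totalPathIntegral u W ω ^ m)
    (fun ω => totalPathIntegral u W' ω ^ (k - m)), (h1 m).2, (h2 (k - m)).2, ENNReal.toReal_mul]
  have h4 := Nat.choose_mul_factorial_mul_factorial (Nat.lt_succ_iff.1 (Finset.mem_range.1 hm))
  have h5 : (k.factorial : ℝ) = k.choose m * m.factorial * (k - m).factorial := by
    exact_mod_cast h4.symm
  rw [h5]
  ring

section Signed

variable {K R : ℝ} (hd : 3 ≤ d) (hv : Measurable v) (hK : ∀ z, |v z| ≤ K)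
  (hR : ∀ z, v z ≠ 0 → ‖z‖ ≤ R)
include hd hv hK hR

lemma IsBrownianMotionFrom.ae_integrableOn (hW : IsBrownianMotionFrom x W P) :
    ∀ᵐ ω ∂P, IntegrableOn (fun s : ℝ => v (W s.toNNReal ω)) (Set.Ioi 0) :=
  hW.hasMeasurableModification.ae_integrableOn measurableSet_Ioi hv
    (hW.lintegral_pow_ne_top hd (isPotential_tilt hv hK hR 1) 1)

lemma IsBrownianMotionFrom.ae_exists_decomposition (hW : IsBrownianMotionFrom x W P) :
    ∀ᵐ ω ∂P, ∃ a b : ℝ, totalPathIntegral v W ω = a - b ∧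
      ∀ i : ℕ, totalPathIntegral (tilt v i) W ω = a + i * b :=
  hW.hasMeasurableModification.ae_exists_decomposition measurableSet_Ioi hv
    (hW.lintegral_pow_ne_top hd (isPotential_tilt hv hK hR 1) 1)

lemma ae_exists_decomposition_pairSum (hW : IsBrownianMotionFrom x W P)
    (hW' : IsBrownianMotionFrom y W' P) :
    ∀ᵐ p ∂(P.prod P), ∃ a b : ℝ, pairSum v W W' p = a - b ∧
      ∀ i : ℕ, pairSum (tilt v i) W W' p = a + i * b := by
  filter_upwards [Measure.quasiMeasurePreserving_fst.ae (hW.ae_exists_decomposition hd hv hK hR),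
    Measure.quasiMeasurePreserving_snd.ae (hW'.ae_exists_decomposition hd hv hK hR)]
    with p ⟨a, b, h1, h2⟩ ⟨a', b', h1', h2'⟩
  refine ⟨a + a', b + b', ?_, fun i => ?_⟩
  · rw [pairSum, h1, h1']
    ring
  · rw [pairSum, h2, h2']
    ring

lemma integrable_pairSum_pow (hW : IsBrownianMotionFrom x W P)
    (hW' : IsBrownianMotionFrom y W' P) (k : ℕ) :
    Integrable (fun p => pairSum v W W' p ^ k) (P.prod P) := by
  refine (moment_pairSum hW hW' hd (measurable_tilt hv 1) (tilt_nonneg 1)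
    (isPotential_tilt hv hK hR 1) k).1.mono' ((aestronglyMeasurable_pairSum hW hW' hv).pow k)
    (ae_of_all _ fun p => ?_)
  rw [norm_pow, Real.norm_eq_abs]
  exact pow_le_pow_left₀ (abs_nonneg _) (abs_pairSum_le p) k

lemma IsBrownianBridge.integrable_pathIntegral_pow {X : ℝ → Ω → EuclideanSpace ℝ (Fin d)} {t : ℝ}
    (hX : IsBrownianBridge t x y X P) (ht : 0 < t) (k : ℕ) :
    Integrable (fun ω => pathIntegral v X t ω ^ k) P := by
  rw [pathIntegral_eq_occupation v X ht]
  exact (hX.hasMeasurableModification ht).integrable_pow measurableSet_Ioo hv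
    (hX.lintegral_pow_ne_top ht hd (isPotential_tilt hv hK hR 1)) k

lemma IsBrownianBridge.ae_exists_decomposition {X : ℝ → Ω → EuclideanSpace ℝ (Fin d)} {t : ℝ}
    (hX : IsBrownianBridge t x y X P) (ht : 0 < t) :
    ∀ᵐ ω ∂P, ∃ a b : ℝ, pathIntegral v X t ω = a - b ∧
      ∀ i : ℕ, pathIntegral (tilt v i) X t ω = a + i * b := by
  simp only [pathIntegral_eq_occupation _ X ht]
  exact (hX.hasMeasurableModification ht).ae_exists_decomposition measurableSet_Ioo hv
    (hX.lintegral_pow_ne_top ht hd (isPotential_tilt hv hK hR 1) 1)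

/-- Exponential moments of the total occupation bound the iterated Green potentials. -/
lemma IsBrownianMotionFrom.exists_pow_mul_greenIter_le (hW : IsBrownianMotionFrom x W P)
    {ρ : ℝ≥0} (h : Integrable (fun ω => Real.exp (ρ * totalPathIntegral (tilt v 1) W ω)) P) :
    ∃ C : ℝ≥0, ∀ j, (ρ : ℝ≥0∞) ^ j *
      greenIter (fun z => ENNReal.ofReal (tilt v 1 z)) j x ≤ C := by
  refine ⟨(∫ ω, Real.exp (ρ * totalPathIntegral (tilt v 1) W ω) ∂P).toNNReal, fun j => ?_⟩
  have hp := isPotential_tilt hv hK hR 1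
  have h1 := hW.moment_totalPathIntegral hd (measurable_tilt hv 1) (tilt_nonneg 1) hp j
  have h2 : (ρ : ℝ) ^ j * (greenIter (fun z => ENNReal.ofReal (tilt v 1 z)) j x).toReal ≤
      ∫ ω, Real.exp (ρ * totalPathIntegral (tilt v 1) W ω) ∂P := by
    have h3 : (ρ : ℝ) ^ j * (greenIter (fun z => ENNReal.ofReal (tilt v 1 z)) j x).toReal =
        ∫ ω, (ρ : ℝ) ^ j / j.factorial * totalPathIntegral (tilt v 1) W ω ^ j ∂P := by
      rw [integral_const_mul, h1.2]
      field_simp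
    rw [h3]
    refine integral_mono (h1.1.const_mul _) h fun ω => ?_
    have h4 := Real.pow_div_factorial_le_exp (ρ * totalPathIntegral (tilt v 1) W ω)
      (mul_nonneg ρ.2 (totalPathIntegral_nonneg (tilt_nonneg 1) ω)) j
    rw [mul_pow] at h4
    refine le_trans (le_of_eq ?_) h4
    ring
  calc (ρ : ℝ≥0∞) ^ j * greenIter (fun z => ENNReal.ofReal (tilt v 1 z)) j x
      = ENNReal.ofReal ((ρ : ℝ) ^ j *
          (greenIter (fun z => ENNReal.ofReal (tilt v 1 z)) j x).toReal) := by
        rw [ENNReal.ofReal_mul (by positivity), ENNReal.ofReal_toReal (hp.greenIter_ne_top hd j x),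
          ENNReal.ofReal_pow ρ.coe_nonneg, ENNReal.ofReal_coe_nnreal]
    _ ≤ _ := ENNReal.ofReal_le_ofReal h2

/-- Khasminskii's lemma: the total occupation has exponential moments near `0`, uniformly in the
starting point. -/
lemma exists_integrable_exp_totalPathIntegral : ∃ α₀ : ℝ, 0 < α₀ ∧
    ∀ (x : EuclideanSpace ℝ (Fin d)) (W : ℝ≥0 → Ω → EuclideanSpace ℝ (Fin d)),
      IsBrownianMotionFrom x W P → ∀ α : ℝ, |α| < α₀ →
        Integrable (fun ω => Real.exp (α * totalPathIntegral (tilt v 1) W ω)) P := by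
  have hp := isPotential_tilt hv hK hR 1
  obtain ⟨M, hM1, hM, -⟩ := hp.exists_greenIter_le hd
  have hM0 : (0 : ℝ) < M := lt_of_lt_of_le one_pos (by exact_mod_cast hM1)
  -- The moments are at most `j! Mʲ` with `M` independent of the starting point, so the exponential
  -- series is dominated by the geometric series in `|α| M`.
  refine ⟨(M : ℝ)⁻¹, by positivity, fun x W hW α hα => ?_⟩
  have hmom := fun k => hW.moment_totalPathIntegral hd (measurable_tilt hv 1) (tilt_nonneg 1) hp k
  let F : ℕ → Ω → ℝ := fun j ω => α ^ j / j.factorial * totalPathIntegral (tilt v 1) W ω ^ j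
  have hF : ∀ j, Integrable (F j) P := fun j => (hmom j).1.const_mul _
  have hnorm : ∀ j, ∫ ω, ‖F j ω‖ ∂P ≤ (|α| * M) ^ j := fun j => by
    have h1 : ∀ ω, ‖F j ω‖ =
        |α| ^ j / j.factorial * totalPathIntegral (tilt v 1) W ω ^ j := fun ω => by
      simp only [F, norm_mul, norm_div, norm_pow, Real.norm_eq_abs, Nat.abs_cast,
        abs_of_nonneg (totalPathIntegral_nonneg (tilt_nonneg 1) ω)]
    simp_rw [h1]
    rw [integral_const_mul, (hmom j).2, mul_pow]
    have h2 : (greenIter (fun z => ENNReal.ofReal (tilt v 1 z)) j x).toReal ≤ (M : ℝ) ^ j := by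
      have := ENNReal.toReal_mono (by finiteness) (hM j x)
      simpa using this
    calc _ = |α| ^ j * (greenIter (fun z => ENNReal.ofReal (tilt v 1 z)) j x).toReal := by
          field_simp
      _ ≤ _ := by gcongr
  have hlt : |α| * M < 1 := by
    rwa [← lt_div_iff₀ hM0, one_div]
  have hsum : Summable fun j => ∫ ω, ‖F j ω‖ ∂P :=
    Summable.of_nonneg_of_le (fun j => integral_nonneg fun ω => norm_nonneg _) hnorm
      (summable_geometric_of_lt_one (by positivity) hlt)
  have h3 : (fun ω => Real.exp (α * totalPathIntegral (tilt v 1) W ω)) = fun ω => ∑' j, F j ω := by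
    ext ω
    rw [Real.exp_eq_exp_ℝ, NormedSpace.exp_eq_tsum_div]
    exact tsum_congr fun j => by simp only [F, mul_pow]; ring
  rw [h3]
  refine ⟨h3 ▸ Real.continuous_exp.comp_aestronglyMeasurable
    ((hW.aestronglyMeasurable_totalPathIntegral (measurable_tilt hv 1)).const_mul α), ?_⟩
  calc ∫⁻ ω, ‖∑' j, F j ω‖ₑ ∂P ≤ ∫⁻ ω, ∑' j, ‖F j ω‖ₑ ∂P :=
        lintegral_mono fun ω => enorm_tsum_le_tsum_enorm
    _ = ∑' j, ENNReal.ofReal (∫ ω, ‖F j ω‖ ∂P) := by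
        rw [lintegral_tsum fun j => (hF j).aestronglyMeasurable.enorm]
        exact tsum_congr fun j => (ofReal_integral_norm_eq_lintegral_enorm (hF j)).symm
    _ < ∞ := hsum.tsum_ofReal_lt_top

-- Over a finite duration the path integral is bounded by `K t`, so every exponent is allowed.
omit hd hR in
lemma IsBrownianBridge.integrable_exp_pathIntegral {X : ℝ → Ω → EuclideanSpace ℝ (Fin d)} {t : ℝ}
    (hX : IsBrownianBridge t x y X P) (ht : 0 < t) (α : ℝ) :
    Integrable (fun ω => Real.exp (α * pathIntegral v X t ω)) P := by
  have hm : AEStronglyMeasurable (pathIntegral v X t) P := by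
    rw [pathIntegral_eq_occupation v X ht]
    exact (hX.hasMeasurableModification ht).aestronglyMeasurable_occupation measurableSet_Ioo hv
  refine Integrable.of_bound (C := Real.exp (|α| * (K * t)))
    (Real.continuous_exp.comp_aestronglyMeasurable (hm.const_mul α)) (ae_of_all _ fun ω => ?_)
  rw [Real.norm_of_nonneg (Real.exp_pos _).le]
  refine Real.exp_le_exp.2 ((le_abs_self _).trans ?_)
  rw [abs_mul]
  gcongr
  have h := intervalIntegral.norm_integral_le_of_norm_le_const (a := 0) (b := t)
    (f := fun s => v (X s ω)) (C := K) fun s _ => hK _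
  simpa [pathIntegral, abs_of_pos ht] using h

end Signed

end PairSum

/-! ### Convergence of moments and of exponential moments for the bridge. -/

section Convergence

variable {d : ℕ} {Ω : Type*} [MeasurableSpace Ω] {P : Measure Ω} [IsProbabilityMeasure P]
  {v : EuclideanSpace ℝ (Fin d) → ℝ} {K R : ℝ} {x y : ℝ → EuclideanSpace ℝ (Fin d)}
  {x₀ y₀ : EuclideanSpace ℝ (Fin d)} {W W' : ℝ≥0 → Ω → EuclideanSpace ℝ (Fin d)}
  {Ω_br : ℝ → Type*} [∀ t, MeasurableSpace (Ω_br t)] {Q : ∀ t, Measure (Ω_br t)}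
  [∀ t, IsProbabilityMeasure (Q t)] {X : ∀ t : ℝ, ℝ → Ω_br t → EuclideanSpace ℝ (Fin d)}
  (hd : 3 ≤ d) (hv : Measurable v) (hK : ∀ z, |v z| ≤ K) (hR : ∀ z, v z ≠ 0 → ‖z‖ ≤ R)
  (hX : ∀ t, 0 < t → IsBrownianBridge t (x t) (y t) (X t) (Q t))
  (hx : Tendsto x atTop (𝓝 x₀)) (hy : Tendsto y atTop (𝓝 y₀))
  (hW : IsBrownianMotionFrom x₀ W P) (hW' : IsBrownianMotionFrom y₀ W' P)
include hd hv hK hR hX hx hy hW hW'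

lemma tendsto_integral_pathIntegral_tilt_pow (i k : ℕ) :
    Tendsto (fun t => ∫ ω, pathIntegral (tilt v i) (X t) t ω ^ k ∂(Q t)) atTop
      (𝓝 (∫ p, pairSum (tilt v i) W W' p ^ k ∂(P.prod P))) := by
  have hp := isPotential_tilt hv hK hR i
  rw [(moment_pairSum hW hW' hd (measurable_tilt hv i) (tilt_nonneg i) hp k).2]
  have h := (ENNReal.tendsto_toReal (hp.greenConv_ne_top hd k x₀ y₀)).comp
    (hp.tendsto_bridgeIter hd hx hy k)
  refine (h.const_mul (k.factorial : ℝ)).congr' ?_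
  filter_upwards [eventually_gt_atTop 0] with t ht
  exact ((hX t ht).moment_pathIntegral ht hd (measurable_tilt hv i) (tilt_nonneg i) hp k).2.symm

/-- The coefficients in `exists_sub_pow_eq_sum` depend only on `k`, so the same linear combination
expresses the bridge moments and the limiting moments through nonnegative potentials. -/
lemma tendsto_integral_pathIntegral_pow (k : ℕ) :
    Tendsto (fun t => ∫ ω, pathIntegral v (X t) t ω ^ k ∂(Q t)) atTop
      (𝓝 (∫ p, pairSum v W W' p ^ k ∂(P.prod P))) := by
  obtain ⟨c, hc⟩ := exists_sub_pow_eq_sum k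
  have h1 : ∫ p, pairSum v W W' p ^ k ∂(P.prod P) = ∑ i ∈ Finset.range (k + 1),
      c i * ∫ p, pairSum (tilt v i) W W' p ^ k ∂(P.prod P) := by
    simp_rw [← integral_const_mul]
    rw [← integral_finsetSum _ fun i _ => (moment_pairSum hW hW' hd (measurable_tilt hv i)
      (tilt_nonneg i) (isPotential_tilt hv hK hR i) k).1.const_mul _]
    refine integral_congr_ae ?_
    filter_upwards [ae_exists_decomposition_pairSum hd hv hK hR hW hW'] with p ⟨a, b, h, h'⟩
    simp only [h, hc, h']
  rw [h1]
  refine (tendsto_finsetSum _ fun i _ => (tendsto_integral_pathIntegral_tilt_pow hd hv hK hR hX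
    hx hy hW hW' i k).const_mul (c i)).congr' ?_
  filter_upwards [eventually_gt_atTop 0] with t ht
  simp_rw [← integral_const_mul]
  rw [← integral_finsetSum _ fun i _ => ((hX t ht).moment_pathIntegral ht hd (measurable_tilt hv i)
      (tilt_nonneg i) (isPotential_tilt hv hK hR i) k).1.const_mul _]
  refine integral_congr_ae ?_
  filter_upwards [(hX t ht).ae_exists_decomposition hd hv hK hR ht] with p ⟨a, b, h, h'⟩
  simp only [h, hc, h']

/-- An exponential moment of the occupation started at the limit point gives geometric bounds on
the absolute moments, uniformly for large times. -/
lemma exists_abs_moments_le {ρ ρ' : ℝ≥0} (hρ' : 0 < ρ') (hρ : ρ' < ρ)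
    (h : Integrable (fun ω => Real.exp (ρ * totalPathIntegral (tilt v 1) W ω)) P) :
    ∃ C : ℝ, (∀ᶠ t in atTop, ∀ k : ℕ,
        ∫ ω, |pathIntegral v (X t) t ω| ^ k ∂(Q t) ≤ C * k.factorial / (ρ' : ℝ) ^ k) ∧
      ∀ k : ℕ, ∫ p, |pairSum v W W' p| ^ k ∂(P.prod P) ≤ C * k.factorial / (ρ' : ℝ) ^ k := by
  have hp := isPotential_tilt hv hK hR 1
  obtain ⟨C₀, hC₀⟩ := hW.exists_pow_mul_greenIter_le hd hv hK hR h
  obtain ⟨C, hC⟩ := hp.exists_pow_mul_bridgeIter_le hρ hC₀ hx hy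
  have hbr : ∀ᶠ t in atTop, ∀ k : ℕ,
      ∫ ω, pathIntegral (tilt v 1) (X t) t ω ^ k ∂(Q t) ≤ C * k.factorial / (ρ' : ℝ) ^ k := by
    filter_upwards [hC, eventually_gt_atTop 0] with t hCt ht k
    rw [((hX t ht).moment_pathIntegral ht hd (measurable_tilt hv 1) (tilt_nonneg 1) hp k).2,
      le_div_iff₀ (by positivity)]
    have h1 := ENNReal.toReal_mono (by finiteness) (hCt k)
    rw [ENNReal.toReal_mul, ENNReal.toReal_pow, ENNReal.coe_toReal, ENNReal.coe_toReal] at h1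
    have h2 := mul_le_mul_of_nonneg_left h1 (Nat.cast_nonneg (α := ℝ) k.factorial)
    linarith
  refine ⟨C, ?_, fun k => ?_⟩
  · filter_upwards [hbr, eventually_gt_atTop 0] with t h1 ht k
    refine le_trans (integral_mono ?_ ((hX t ht).moment_pathIntegral ht hd (measurable_tilt hv 1)
      (tilt_nonneg 1) hp k).1 fun ω => ?_) (h1 k)
    · simpa only [norm_pow, Real.norm_eq_abs] using
        ((hX t ht).integrable_pathIntegral_pow hd hv hK hR ht k).norm
    · refine pow_le_pow_left₀ (abs_nonneg _) ?_ k
      simp only [pathIntegral_eq_occupation _ (X t) ht]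
      exact abs_occupation_le ω
  · refine le_trans (integral_mono ?_ (moment_pairSum hW hW' hd (measurable_tilt hv 1)
      (tilt_nonneg 1) hp k).1 fun p => pow_le_pow_left₀ (abs_nonneg _) (abs_pairSum_le p) k) ?_
    · simpa only [norm_pow, Real.norm_eq_abs] using
        (integrable_pairSum_pow hd hv hK hR hW hW' k).norm
    -- The bound for the limit is inherited from the bridges; no exponential moment at `y₀` is
    -- assumed.
    · exact le_of_tendsto (tendsto_integral_pathIntegral_tilt_pow hd hv hK hR hX hx hy hW hW' 1 k)
        (hbr.mono fun t ht => ht k)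

lemma tendsto_integral_exp_pathIntegral {ρ : ℝ≥0} {α : ℝ} (hα : |α| < ρ)
    (h : Integrable (fun ω => Real.exp (ρ * totalPathIntegral (tilt v 1) W ω)) P) :
    Tendsto (fun t => ∫ ω, Real.exp (α * pathIntegral v (X t) t ω) ∂(Q t)) atTop
      (𝓝 (∫ p, Real.exp (α * pairSum v W W' p) ∂(P.prod P))) := by
  -- There is room on both sides: `|α| < r` for the series, and `r < ρ` to absorb the polynomial
  -- loss.
  obtain ⟨r, hr1, hr2⟩ := exists_between hα
  lift r to ℝ≥0 using (abs_nonneg α).trans hr1.le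
  have hr0 : 0 < r := by exact_mod_cast (abs_nonneg α).trans_lt hr1
  obtain ⟨C, hC, hC'⟩ := exists_abs_moments_le hd hv hK hR hX hx hy hW hW' hr0
    (by exact_mod_cast hr2) h
  have := tendsto_integral_pow_mul_exp (Q := Q) (Z := fun t => pathIntegral v (X t) t)
    (w := fun _ _ => 1) (S := pairSum v W W') (P := P.prod P) (w₀ := fun _ => 1) hr1
    (fun _ _ => zero_le_one) (fun _ => zero_le_one)
    (by
      filter_upwards [eventually_gt_atTop 0] with t ht k
      simpa using (hX t ht).integrable_pathIntegral_pow hd hv hK hR ht k)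
    (by simpa using hC) (by simpa using integrable_pairSum_pow hd hv hK hR hW hW')
    (by simpa using hC')
    (by simpa using tendsto_integral_pathIntegral_pow hd hv hK hR hX hx hy hW hW') 0
  simpa using this

lemma tendsto_integral_exp_neg_pathIntegral (hv0 : ∀ z, 0 ≤ v z) {γ : ℝ} (hγ : 0 < γ) :
    Tendsto (fun t => ∫ ω, Real.exp (-γ * pathIntegral v (X t) t ω) ∂(Q t)) atTop
      (𝓝 (∫ p, Real.exp (-γ * pairSum v W W' p) ∂(P.prod P))) := by
  -- Some small radius from Khasminskii's lemma is enough to start the continuation, however large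
  -- `γ` is.
  obtain ⟨α₀, hα₀, h⟩ := exists_integrable_exp_totalPathIntegral (P := P) hd hv hK hR
  obtain ⟨ρ, hρ0, hρ1⟩ := exists_between hα₀
  obtain ⟨r, hr0, hr1⟩ := exists_between hρ0
  lift ρ to ℝ≥0 using hρ0.le
  lift r to ℝ≥0 using hr0.le
  obtain ⟨C, hC, hC'⟩ := exists_abs_moments_le hd hv hK hR hX hx hy hW hW'
    (by exact_mod_cast hr0) (by exact_mod_cast hr1)
    (h x₀ W hW ρ (by rwa [abs_of_pos hρ0]))
  have hnn : ∀ᶠ t in atTop, ∀ ω, 0 ≤ pathIntegral v (X t) t ω := by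
    filter_upwards [eventually_gt_atTop 0] with t ht ω
    rw [pathIntegral_eq_occupation v (X t) ht]
    exact occupation_nonneg hv0 ω
  have hi : ∀ᶠ t in atTop, ∀ k : ℕ, Integrable (fun ω => pathIntegral v (X t) t ω ^ k) (Q t) := by
    filter_upwards [eventually_gt_atTop 0] with t ht k
    exact (hX t ht).integrable_pathIntegral_pow hd hv hK hR ht k
  refine tendsto_integral_exp_of_nonneg (C := C) hr0 hnn (pairSum_nonneg hv0) ?_
    (aestronglyMeasurable_pairSum hW hW' hv) hi ?_ (integrable_pairSum_pow hd hv hK hR hW hW')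
    ?_ (tendsto_integral_pathIntegral_pow hd hv hK hR hX hx hy hW hW') hγ
  · filter_upwards [hi] with t ht
    simpa using (ht 1).aestronglyMeasurable
  · filter_upwards [hC, hnn] with t ht h0 k
    simpa only [abs_of_nonneg (h0 _)] using ht k
  · simpa only [abs_of_nonneg (pairSum_nonneg hv0 _)] using hC'

end Convergence

/-! ### Passing from the product space to arbitrary independent copies. -/

section Transfer

variable {Ω Ω' : Type*} [MeasurableSpace Ω] [MeasurableSpace Ω'] {P : Measure Ω}
  {P' : Measure Ω'} {Y Y' : Ω' → ℝ}
  {T T' : Ω → ℝ}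

lemma identDistrib_comp_of_measurePreserving {g : Ω' → Ω} (hg : MeasurePreserving g P' P)
    (hT : AEMeasurable T P) : IdentDistrib (fun ω => T (g ω)) T P' P where
  aemeasurable_fst :=
    (hg.map_eq.symm ▸ hT : AEMeasurable T (P'.map g)).comp_aemeasurable hg.aemeasurable
  aemeasurable_snd := hT
  map_eq := by
    have h := AEMeasurable.map_map_of_aemeasurable (hg.map_eq.symm ▸ hT) hg.aemeasurable
    rw [hg.map_eq] at h
    exact h.symm

/-- Independence fixes the joint law as the product of the marginals, so the concrete model on `Ω ×
Ω` represents every independent pair. -/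
lemma identDistrib_add_of_indepFun [IsProbabilityMeasure P] [IsProbabilityMeasure P']
    (hY : IdentDistrib Y T P' P) (hY' : IdentDistrib Y' T' P' P)
    (hYY' : IndepFun Y Y' P') :
    IdentDistrib (Y + Y') (fun p : Ω × Ω => T p.1 + T' p.2) P' (P.prod P) := by
  have h1 := identDistrib_comp_of_measurePreserving
    (measurePreserving_fst (μ := P) (ν := P)) hY.aemeasurable_snd
  have h2 := identDistrib_comp_of_measurePreserving
    (measurePreserving_snd (μ := P) (ν := P)) hY'.aemeasurable_snd
  exact ((hY.trans h1.symm).prodMk (hY'.trans h2.symm) hYY'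
    (indepFun_prod₀ hY.aemeasurable_snd hY'.aemeasurable_snd)).comp
      (measurable_fst.add measurable_snd)

lemma integrable_exp_add_of_indepFun (hY : IdentDistrib Y T P' P) (hY' : IdentDistrib Y' T' P' P)
    (hYY' : IndepFun Y Y' P') {α : ℝ} (h : Integrable (fun ω => Real.exp (α * T ω)) P)
    (h' : Integrable (fun ω => Real.exp (α * T' ω)) P) :
    Integrable (fun ω => Real.exp (α * (Y ω + Y' ω))) P' := by
  have h1 : Integrable (fun ω => Real.exp (α * Y ω)) P' :=
    (hY.comp (u := fun a => Real.exp (α * a)) (by fun_prop)).integrable_iff.2 h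
  have h2 : Integrable (fun ω => Real.exp (α * Y' ω)) P' :=
    (hY'.comp (u := fun a => Real.exp (α * a)) (by fun_prop)).integrable_iff.2 h'
  exact hYY'.integrable_exp_mul_add h1 h2

lemma mgf_add_of_identDistrib (hY : IdentDistrib Y T P' P) (hY' : IdentDistrib Y' T' P' P)
    (hYY' : IndepFun Y Y' P') (α : ℝ) : mgf (Y + Y') P' α = mgf T P α * mgf T' P α := by
  rw [hYY'.mgf_add' hY.aemeasurable_fst.aestronglyMeasurable
    hY'.aemeasurable_fst.aestronglyMeasurable, mgf_congr_identDistrib hY,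
    mgf_congr_identDistrib hY']

end Transfer

/-! ### Assembly of the theorem. -/

theorem theorem1 {d : ℕ} (hd : 3 ≤ d)
    (v : EuclideanSpace ℝ (Fin d) → ℝ) (hv_meas : Measurable v)
    (hv_bdd : ∃ K : ℝ, ∀ z, |v z| ≤ K) (hv_supp : Bornology.IsBounded (Function.support v))
    -- for each `z`, a Brownian motion `W z` started at `z`
    {Ω : Type*} [MeasurableSpace Ω] (P : Measure Ω) [IsProbabilityMeasure P]
    (W : EuclideanSpace ℝ (Fin d) → ℝ≥0 → Ω → EuclideanSpace ℝ (Fin d))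
    (hW : ∀ z, IsBrownianMotionFrom z (W z) P)
    -- for each `t > 0`, a Brownian bridge `X t` of duration `t` from `x t` to `y t`
    (x y : ℝ → EuclideanSpace ℝ (Fin d))
    {Ω_br : ℝ → Type*} [∀ t, MeasurableSpace (Ω_br t)] (Q : ∀ t, Measure (Ω_br t))
    [∀ t, IsProbabilityMeasure (Q t)]
    (X : ∀ t : ℝ, ℝ → Ω_br t → EuclideanSpace ℝ (Fin d))
    (hX : ∀ t, 0 < t → IsBrownianBridge t (x t) (y t) (X t) (Q t))
    -- the endpoints converge
    (x_lim y_lim : EuclideanSpace ℝ (Fin d))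
    (hx : Tendsto x atTop (𝓝 x_lim)) (hy : Tendsto y atTop (𝓝 y_lim))
    -- independent copies `Y`, `Y'` of the path integrals along `W x_lim` and `W y_lim`
    {Ω' : Type*} [MeasurableSpace Ω'] (P' : Measure Ω') [IsProbabilityMeasure P']
    (Y Y' : Ω' → ℝ)
    (hY : IdentDistrib Y (totalPathIntegral v (W x_lim)) P' P)
    (hY' : IdentDistrib Y' (totalPathIntegral v (W y_lim)) P' P)
    (hYY' : IndepFun Y Y' P') :
    -- the whole-time path integrals converge absolutely
    (∀ z, ∀ᵐ ω ∂P, IntegrableOn (fun s : ℝ => v (W z s.toNNReal ω)) (Set.Ioi 0)) ∧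
    -- convergence of moments
    (∀ k : ℕ,
      (∀ t, 0 < t → Integrable (fun ω => pathIntegral v (X t) t ω ^ k) (Q t)) ∧
      Integrable (fun ω => (Y ω + Y' ω) ^ k) P' ∧
      Tendsto (fun t => moment (pathIntegral v (X t) t) k (Q t)) atTop
        (𝓝 (moment (Y + Y') k P'))) ∧
    -- convergence of moment generating functions on `(-α₀, α₀)`
    (∃ α₀ : ℝ, 0 < α₀ ∧ HasExpMomentsBelow P v W α₀) ∧
    (∀ α₀ : ℝ, HasExpMomentsBelow P v W α₀ → ∀ α : ℝ, |α| < α₀ →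
      (∀ t, 0 < t → Integrable (fun ω => Real.exp (α * pathIntegral v (X t) t ω)) (Q t)) ∧
      Integrable (fun ω => Real.exp (α * (Y ω + Y' ω))) P' ∧
      Tendsto (fun t => mgf (pathIntegral v (X t) t) (Q t) α) atTop (𝓝 (mgf (Y + Y') P' α)) ∧
      mgf (Y + Y') P' α =
        mgf (totalPathIntegral v (W x_lim)) P α * mgf (totalPathIntegral v (W y_lim)) P α) ∧
    -- for nonnegative `v`, convergence of moment generating functions on `(-∞, α₁)`
    ((∀ z, 0 ≤ v z) →
      0 < criticalExponent P v W ∧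
      ∀ α : ℝ, (α : EReal) < criticalExponent P v W →
        (∀ t, 0 < t → Integrable (fun ω => Real.exp (α * pathIntegral v (X t) t ω)) (Q t)) ∧
        Integrable (fun ω => Real.exp (α * (Y ω + Y' ω))) P' ∧
        Tendsto (fun t => mgf (pathIntegral v (X t) t) (Q t) α) atTop (𝓝 (mgf (Y + Y') P' α)) ∧
        mgf (Y + Y') P' α =
          mgf (totalPathIntegral v (W x_lim)) P α * mgf (totalPathIntegral v (W y_lim)) P α) := by
  obtain ⟨K, hK⟩ := hv_bdd
  obtain ⟨R, hR'⟩ := hv_supp.exists_norm_le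
  have hR : ∀ z, v z ≠ 0 → ‖z‖ ≤ R := fun z hz => hR' z hz
  have hsum := identDistrib_add_of_indepFun hY hY' hYY'
  have htilt : ∀ z, totalPathIntegral (fun u => |v u|) (W z) = totalPathIntegral (tilt v 1) (W z) :=
    fun z => by rw [tilt_one]
  obtain ⟨β, hβ, hexp⟩ := exists_integrable_exp_totalPathIntegral (P := P) hd hv_meas hK hR
  have hbelow : HasExpMomentsBelow P v W β := fun α hα z => by
    rw [htilt]
    exact hexp z (W z) (hW z) α hα
  have hmain : ∀ α₀ : ℝ, HasExpMomentsBelow P v W α₀ → ∀ α : ℝ, |α| < α₀ →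
      (∀ t, 0 < t → Integrable (fun ω => Real.exp (α * pathIntegral v (X t) t ω)) (Q t)) ∧
      Integrable (fun ω => Real.exp (α * (Y ω + Y' ω))) P' ∧
      Tendsto (fun t => mgf (pathIntegral v (X t) t) (Q t) α) atTop (𝓝 (mgf (Y + Y') P' α)) ∧
      mgf (Y + Y') P' α =
        mgf (totalPathIntegral v (W x_lim)) P α * mgf (totalPathIntegral v (W y_lim)) P α := by
    intro α₀ h₀ α hα
    have hint : ∀ z, Integrable (fun ω => Real.exp (α * totalPathIntegral v (W z) ω)) P := by
      intro z
      -- The signed integral is dominated by the integral of `|v|`, so the hypothesis is used at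
      -- `|α|`.
      refine (h₀ |α| (by rwa [abs_abs]) z).mono' (Real.continuous_exp.comp_aestronglyMeasurable
        (((hW z).aestronglyMeasurable_totalPathIntegral hv_meas).const_mul α))
        (ae_of_all _ fun ω => ?_)
      rw [Real.norm_of_nonneg (Real.exp_pos _).le, htilt]
      refine Real.exp_le_exp.2 ((le_abs_self _).trans ?_)
      rw [abs_mul]
      exact mul_le_mul_of_nonneg_left (abs_totalPathIntegral_le ω) (abs_nonneg α)
    refine ⟨fun t ht => (hX t ht).integrable_exp_pathIntegral hv_meas hK ht α,
      integrable_exp_add_of_indepFun hY hY' hYY' (hint _) (hint _), ?_,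
      mgf_add_of_identDistrib hY hY' hYY' α⟩
    obtain ⟨ρ, hρ, hρ'⟩ := exists_between hα
    lift ρ to ℝ≥0 using (abs_nonneg α).trans hρ.le
    rw [mgf_congr_identDistrib hsum]
    have h := h₀ ρ (by rwa [NNReal.abs_eq]) x_lim
    rw [htilt] at h
    exact tendsto_integral_exp_pathIntegral hd hv_meas hK hR hX hx hy (hW x_lim) (hW y_lim) hρ h
  refine ⟨fun z => (hW z).ae_integrableOn hd hv_meas hK hR, fun k => ⟨fun t ht =>
    (hX t ht).integrable_pathIntegral_pow hd hv_meas hK hR ht k, ?_, ?_⟩, ⟨β, hβ, hbelow⟩, hmain,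
    fun hv0 => ⟨?_, fun α hα => ?_⟩⟩
  · exact hsum.pow.integrable_iff.2
      (integrable_pairSum_pow hd hv_meas hK hR (hW x_lim) (hW y_lim) k)
  · have h1 : moment (Y + Y') k P' =
        ∫ p, pairSum v (W x_lim) (W y_lim) p ^ k ∂(P.prod P) := hsum.pow.integral_eq
    rw [h1]
    exact tendsto_integral_pathIntegral_pow hd hv_meas hK hR hX hx hy (hW x_lim) (hW y_lim) k
  -- For `v ≥ 0` the hypothesis on `|v|` is one on `v`, so half of the Khasminskii radius lies in
  -- the set defining the supremum.
  · have hmem : ((β / 2 : ℝ) : EReal) ≤ criticalExponent P v W := by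
      refine le_sSup ⟨β / 2, rfl, fun z => ?_⟩
      have h := hbelow (β / 2) (by rw [abs_of_pos (by positivity)]; linarith) z
      simpa only [abs_of_nonneg (hv0 _)] using h
    exact lt_of_lt_of_le (by exact_mod_cast (by positivity : 0 < β / 2)) hmem
  · obtain ⟨_, ⟨α', rfl, hα'⟩, hlt⟩ := lt_sSup_iff.1 hα
    have hlt' : α < α' := by exact_mod_cast hlt
    rcases le_or_gt 0 α with h0 | h0
    -- Since `v = |v|`, finiteness at the single exponent `α'` gives it for all `|γ| < α'`, so `α'`
    -- serves as `α₀`.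
    · refine hmain α' (fun γ hγ z => ?_) α (by rwa [abs_of_nonneg h0])
      simp only [abs_of_nonneg (hv0 _)]
      refine (hα' z).mono' (Real.continuous_exp.comp_aestronglyMeasurable
        (((hW z).aestronglyMeasurable_totalPathIntegral hv_meas).const_mul γ))
        (ae_of_all _ fun ω => ?_)
      rw [Real.norm_of_nonneg (Real.exp_pos _).le]
      exact Real.exp_le_exp.2 (mul_le_mul_of_nonneg_right ((le_abs_self γ).trans hγ.le)
        (totalPathIntegral_nonneg hv0 ω))
    -- For negative `α` the exponentials are at most `1`, and convergence comes from continuation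
    -- along the half-line, with no restriction on the size of `α`.
    · have hint : ∀ z, Integrable (fun ω => Real.exp (α * totalPathIntegral v (W z) ω)) P := by
        intro z
        refine Integrable.of_bound (C := 1) (Real.continuous_exp.comp_aestronglyMeasurable
          (((hW z).aestronglyMeasurable_totalPathIntegral hv_meas).const_mul α))
          (ae_of_all _ fun ω => ?_)
        rw [Real.norm_of_nonneg (Real.exp_pos _).le]
        exact Real.exp_le_one_iff.2
          (mul_nonpos_of_nonpos_of_nonneg h0.le (totalPathIntegral_nonneg hv0 ω))
      refine ⟨fun t ht => (hX t ht).integrable_exp_pathIntegral hv_meas hK ht α,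
        integrable_exp_add_of_indepFun hY hY' hYY' (hint _) (hint _), ?_,
        mgf_add_of_identDistrib hY hY' hYY' α⟩
      rw [mgf_congr_identDistrib hsum]
      have h := tendsto_integral_exp_neg_pathIntegral hd hv_meas hK hR hX hx hy (hW x_lim)
        (hW y_lim) hv0 (neg_pos.2 h0)
      simp only [neg_neg] at h
      exact h
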